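/- Consider 2-stage prophet set cover. There are a set system of $m$ sets $S_1,\dots,S_m$ with rational costs $c_j\ge 0$ covering a ground set of $N$ elements, unknown distributions $D^1,\dots,D^n$ on the ground set ($n\ge 1$), and a markup $\lambda>0$. In the first stage a collection $z_0$ of sets is bought at cost $c(z_0)$. In the second stage independent elements $v^t\sim D^t$, $t=1,\dots,n$, arrive one at a time and each must be covered immediately and irrevocably. If $z_1$ is the collection of additional sets bought in the second stage, the total cost is $c(z_0)+\lambda\,c(z_1)$. An online policy consists of a fixed first-stage collection $z_0$ and, for each $t$, a rule that chooses the sets bought at time $t$ as a function of $v^1,\dots,v^t$, such that almost surely every $v^t$ is covered on arrival. It may depend on $D^1,\dots,D^n$ and $\lambda$. A universal algorithm receives the set system, the costs, and $k=\lceil\lambda\rceil$ independent samples from each $D^t$. Before the second stage it fixes a collection $z_0$, which it buys, and a map $\mathfrak S$ that assigns to every element $u$ of the ground set a set containing $u$. In the second stage it covers each arriving $v^t$ by $\mathfrak S(v^t)$, so that $z_1=\{\mathfrak S(v^1),\dots,\mathfrak S(v^n)\}\setminus z_0$. Theorem. There are a randomized universal algorithm (a single program with fair coins), a polynomial $p$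 and an absolute constant $C$ such that, on every input, samples and coin tosses, the algorithm runs in time at most $p(\text{bit length of the input, including the } kn \text{ samples})$ on a random-access machine with logarithmic cost, and for all $D^1,\dots,D^n$ and all $\lambda>0$ its expected total cost (over samples, coins and arriving elements) satisfies $$\mathbb E\big[c(z_0)+\lambda\,c(z_1)\big]\;\le\; C\,\bigl(1+\log(mn\lceil\lambda\rceil)\bigr)\cdot \mathbb E\big[c(z_0^*)+\lambda\,c(z_1^*)\big]$$ for every online policy $(z_0^*,z_1^*)$, in particular for the optimal one. Thus the algorithm is $O(\log(mn))$-competitive against the optimal online policy for every fixed $\lambda$ and, uniformly, for all $\lambda$ bounded by a fixed polynomial in $mn$ (where $mn\ge 2$). -/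

import Mathlib

/-! ### Random-access programs with logarithmic cost

A program works on finitely many named, infinite arrays of natural numbers. Every evaluated
subexpression is charged one unit plus the number of bits of its value (so all operands, results
and addresses are charged bit by bit), and every elementary command is charged one further unit.
Randomness is available only through fair coins. -/

/-- Arithmetic expressions; `get a i` reads entry `i` of the array named `a`, `sub` is truncated
subtraction and `div` is integer division. -/
inductive Expr where
  | const (c : ℕ)
  | get (a : ℕ) (i : Expr)
  | add (e₁ e₂ : Expr)
  | sub (e₁ e₂ : Expr)
  | mul (e₁ e₂ : Expr)
  | div (e₁ e₂ : Expr)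

/-- `mem a i` is entry `i` of the array named `a`. -/
abbrev Memory := ℕ → ℕ → ℕ

def Expr.eval (mem : Memory) : Expr → ℕ
  | .const c => c
  | .get a i => mem a (i.eval mem)
  | .add e₁ e₂ => e₁.eval mem + e₂.eval mem
  | .sub e₁ e₂ => e₁.eval mem - e₂.eval mem
  | .mul e₁ e₂ => e₁.eval mem * e₂.eval mem
  | .div e₁ e₂ => e₁.eval mem / e₂.eval mem

/-- Logarithmic cost of evaluating an expression (`Nat.size` is the number of binary digits). -/
def Expr.cost (mem : Memory) : Expr → ℕ
  | .const c => 1 + Nat.size c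
  | .get a i => i.cost mem + 1 + Nat.size ((Expr.get a i).eval mem)
  | .add e₁ e₂ => e₁.cost mem + e₂.cost mem + 1 + Nat.size ((Expr.add e₁ e₂).eval mem)
  | .sub e₁ e₂ => e₁.cost mem + e₂.cost mem + 1 + Nat.size ((Expr.sub e₁ e₂).eval mem)
  | .mul e₁ e₂ => e₁.cost mem + e₂.cost mem + 1 + Nat.size ((Expr.mul e₁ e₂).eval mem)
  | .div e₁ e₂ => e₁.cost mem + e₂.cost mem + 1 + Nat.size ((Expr.div e₁ e₂).eval mem)

/-- Programs. `store a i e` writes the value of `e` to entry `i` of array `a`; `flip a i` writes a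
fresh fair coin there; a guard is true when its value is nonzero. -/
inductive Program where
  | skip
  | store (a : ℕ) (i e : Expr)
  | flip (a : ℕ) (i : Expr)
  | seq (p q : Program)
  | ite (g : Expr) (p q : Program)
  | loop (g : Expr) (p : Program)

/-- The memory and the coins that have not been used yet. -/
structure State where
  mem : Memory
  coins : ℕ → Bool

def Memory.write (mem : Memory) (a i v : ℕ) : Memory :=
  fun b j => if b = a ∧ j = i then v else mem b j

/-- `Exec p s T s'`: started in state `s`, the program `p` halts in state `s'` after time
exactly `T`. -/
inductive Exec : Program → State → ℕ → State → Prop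
  | skip (s : State) : Exec .skip s 1 s
  | store (a : ℕ) (i e : Expr) (s : State) :
      Exec (.store a i e) s (i.cost s.mem + e.cost s.mem + 1)
        { mem := Memory.write s.mem a (i.eval s.mem) (e.eval s.mem), coins := s.coins }
  | flip (a : ℕ) (i : Expr) (s : State) :
      Exec (.flip a i) s (i.cost s.mem + 1)
        { mem := Memory.write s.mem a (i.eval s.mem) (s.coins 0).toNat
          coins := fun l => s.coins (l + 1) }
  | seq (p q : Program) (s s₁ s₂ : State) (T₁ T₂ : ℕ) (h₁ : Exec p s T₁ s₁)
      (h₂ : Exec q s₁ T₂ s₂) : Exec (.seq p q) s (T₁ + T₂) s₂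
  | ite_true (g : Expr) (p q : Program) (s s₁ : State) (T : ℕ) (hg : g.eval s.mem ≠ 0)
      (h : Exec p s T s₁) : Exec (.ite g p q) s (g.cost s.mem + 1 + T) s₁
  | ite_false (g : Expr) (p q : Program) (s s₁ : State) (T : ℕ) (hg : g.eval s.mem = 0)
      (h : Exec q s T s₁) : Exec (.ite g p q) s (g.cost s.mem + 1 + T) s₁
  | loop_done (g : Expr) (p : Program) (s : State) (hg : g.eval s.mem = 0) :
      Exec (.loop g p) s (g.cost s.mem + 1) s
  | loop_step (g : Expr) (p : Program) (s s₁ s₂ : State) (T₁ T₂ : ℕ) (hg : g.eval s.mem ≠ 0)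
      (h₁ : Exec p s T₁ s₁) (h₂ : Exec (.loop g p) s₁ T₂ s₂) :
      Exec (.loop g p) s (g.cost s.mem + 1 + T₁ + T₂) s₂

/-! ### Two-stage prophet set cover -/

/-- A weighted set system: `m` sets covering a ground set of `N` elements. -/
structure SetSystem (N m : ℕ) where
  sets : Fin m → Finset (Fin N)
  cost : Fin m → ℚ≥0
  covers : ∀ u, ∃ j, u ∈ sets j

namespace SetSystem

variable {N m : ℕ} (I : SetSystem N m)

/-- Cost of a subcollection. -/
noncomputable def costOf (F : Finset (Fin m)) : ℝ := ∑ j ∈ F, (I.cost j : ℝ)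

/-- Cost of buying `z₀` in the first stage and `z₁` in the second stage with markup `lam`
(a set that is already owned is not bought again). -/
noncomputable def twoStageCost (lam : ℝ) (z₀ z₁ : Finset (Fin m)) : ℝ :=
  I.costOf z₀ + lam * I.costOf (z₁ \ z₀)

/-- Bit length of the input: the numbers `N, m, n, k`, the `N × m` incidence matrix, the costs,
and `k` samples (elements of the ground set) for each of the `n` distributions. -/
def inputSize (n k : ℕ) : ℕ :=
  Nat.size N + Nat.size m + Nat.size n + Nat.size k + N * m
    + (∑ j, (Nat.size (I.cost j).num + Nat.size (I.cost j).den)) + n * k * Nat.size N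

/-- Input memory. Array 0 holds `N, m, n, k`; array 1 the incidence matrix, row by row; arrays 2
and 3 the numerators and denominators of the costs; array 4 the samples, where entry `t * k + i`
is the `i`-th sample of the `t`-th distribution. Everything else is zero. -/
def inputMemory {n k : ℕ} (s : Fin n × Fin k → Fin N) : Memory := fun a i =>
  match a with
  | 0 => [N, m, n, k].getD i 0
  | 1 => if h : i / m < N ∧ i % m < m then
      (if (⟨i / m, h.1⟩ : Fin N) ∈ I.sets ⟨i % m, h.2⟩ then 1 else 0) else 0
  | 2 => if h : i < m then (I.cost ⟨i, h⟩).num else 0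
  | 3 => if h : i < m then (I.cost ⟨i, h⟩).den else 0
  | 4 => if h : i / k < n ∧ i % k < k then (s (⟨i / k, h.1⟩, ⟨i % k, h.2⟩) : ℕ) else 0
  | _ => 0

/-- Initial state on samples `s` and `T` coins `r` (padded by zeros). -/
def initState {n k T : ℕ} (s : Fin n × Fin k → Fin N) (r : Fin T → Bool) : State where
  mem := I.inputMemory s
  coins := fun l => if h : l < T then r ⟨l, h⟩ else false

end SetSystem

/-- What a universal algorithm fixes before the second stage: the sets `advance` bought in the
first stage, and the map `assign` from elements to sets that is used, obliviously, to cover the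
arriving elements. -/
structure UniversalPlan (N m : ℕ) where
  advance : Finset (Fin m)
  assign : Fin N → Fin m

namespace UniversalPlan

variable {N m : ℕ} (A : UniversalPlan N m)

/-- Every element is assigned to a set that contains it. -/
def Valid (I : SetSystem N m) : Prop := ∀ u, u ∈ I.sets (A.assign u)

/-- The sets used for the arriving elements `v`. -/
def used {n : ℕ} (v : Fin n → Fin N) : Finset (Fin m) := Finset.univ.image fun t => A.assign (v t)

/-- The plan is written in the memory: array 5 marks the sets of `advance` by nonzero entries,
array 6 is the table of `assign`. -/
def WrittenIn (mem : Memory) : Prop :=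
  (∀ j : Fin m, j ∈ A.advance ↔ mem 5 j ≠ 0) ∧ ∀ u : Fin N, mem 6 u = A.assign u

end UniversalPlan

/-- An online policy: the sets bought in advance, and the sets bought when the element with index
`t` arrives, as a function of the elements that have arrived up to and including it. -/
structure OnlinePolicy (N m n : ℕ) where
  advance : Finset (Fin m)
  buy : (t : Fin n) → (Fin (t + 1) → Fin N) → Finset (Fin m)

namespace OnlinePolicy

variable {N m n : ℕ} (Q : OnlinePolicy N m n)

/-- The sets bought at step `t` on the arrival sequence `v`. -/
def boughtAt (v : Fin n → Fin N) (t : Fin n) : Finset (Fin m) :=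
  Q.buy t fun i => v (Fin.castLE t.isLt i)

/-- All sets bought in the second stage. -/
def bought (v : Fin n → Fin N) : Finset (Fin m) := Finset.univ.biUnion (Q.boughtAt v)

/-- Almost surely, every element is covered as soon as it arrives. -/
def Feasible (I : SetSystem N m) (D : Fin n → PMF (Fin N)) : Prop :=
  ∀ v : Fin n → Fin N, (∀ t, v t ∈ (D t).support) →
    ∀ t, ∃ j, v t ∈ I.sets j ∧ (j ∈ Q.advance ∨ ∃ t' ≤ t, j ∈ Q.boughtAt v t')

end OnlinePolicy

/-- Expectation of `f` when its arguments are drawn independently, the `i`-th one from `D i`. -/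
noncomputable def indepExp {ι α : Type} [Fintype ι] [DecidableEq ι] [Fintype α]
    (D : ι → PMF α) (f : (ι → α) → ℝ) : ℝ :=
  ∑ x, (∏ i, (D i (x i)).toReal) * f x

/-- Expectation over `T` independent fair coins. -/
noncomputable def coinExp {T : ℕ} (f : (Fin T → Bool) → ℝ) : ℝ := (∑ r, f r) / 2 ^ T

/-! ### Reasoning about random-access programs -/

/-! Costs are scaled to integers by a common denominator. Write M = nk, and c(F) for the scaled cost
of a cover F of the samples. Fair coins split the samples into two sides. On each side a
deterministic multiplicative-weights learner computes a fractional cover, which is then rounded at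
random; the chosen sets are those picked on at least one side. An element contained in no chosen set
is assigned to its cheapest set, of cost κ.

Learner. It keeps a guess β of the optimum and a load D_j for each set. Set j has fractional value
proportional to 2^⌊D_j/C_j⌋ / C_j, normalized so that the fractional cover costs at most 16β. While
some sample u is fractionally covered by less than one, the learner pays κ(u), adds κ(u) to the load
of all sets containing u and restarts its scan. Being missed keeps the potential Σ 2^(D_j/C_j), made
piecewise linear, below m·exp(K/(4β)), where K is the amount paid under the current guess.
Conversely every payment loads a set of F, so K ≤ Σ_{j∈F} D_j. Together these show that K can exceed
5·size(m)·β only if β ≤ c(F) (`Learner.Inv.guess_lt`). The guess is then at least doubled, and the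
total payment is O(log m)·c(F).

Generalization. The final state depends only on the samples that were paid for
(`Learner.run_remove`). Hence a sample that is missed by the learner trained without it was paid for
in the full run, and the leave-one-out loss is O(log m)·c(F) (`Learner.leave_one_out`). The arriving
v^t has the law of the sample (t,i), and the learner on the side opposite to (t,i) never looks at
that sample, so v^t may be exchanged with it (`sum_mul_indepExp_swap`). Flipping the coin of (t,i)
turns this learner into the leave-one-out learner of the other side (`SetSystem.avg_missed_le`).
Summing over i gives k copies of the loss at time t, and k ≥ λ pays for the markup.

Rounding. With L = size(nk), each set is picked with probability about L times its fractional value.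
This costs O(L)·c(F) (`SetSystem.avg_chosen_le`) and leaves an element that is not missed uncovered
with probability at most e^(−L) ≤ 1/(nk) (`SetSystem.avg_uncovered_le`). The three losses are added
in `SetSystem.expected_algCost_le`.

Comparison. For F take everything that the policy buys when it is run on each of the k sample
sequences (s(t,i))_t. The expected cost is at most c(z₀*) + k·E c(z₁* \ z₀*), by
`SetSystem.expected_policyCover_le`. If λ > 1, then k < 2λ. If λ ≤ 1, then k = 1, nothing is bought
in advance, and the whole cover is paid at rate λ. `SetSystem.competitive` concludes.

Running time. `Spec` is a Hoare logic for total correctness with word length S and at most Φ rounds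
per loop. The program simulates the learner step by step (`Spec.learnStep`). Polynomial bounds for S
and Φ then give a polynomial time bound (`exists_main_polynomial`). -/

/-- Number of words needed for the value of an expression over a memory of words. -/
def Expr.width : Expr → ℕ
  | .const c => Nat.size c
  | .get _ _ => 1
  | .add e₁ e₂ => e₁.width + e₂.width
  | .sub e₁ _ => e₁.width
  | .mul e₁ e₂ => e₁.width + e₂.width
  | .div e₁ _ => e₁.width

/-- Bound for the cost of an expression over a memory of words of `S` bits. -/
def Expr.time (S : ℕ) : Expr → ℕ
  | .const c => 1 + Nat.size c
  | .get _ i => i.time S + 1 + S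
  | .add e₁ e₂ => e₁.time S + e₂.time S + 1 + (e₁.width + e₂.width) * S
  | .sub e₁ e₂ => e₁.time S + e₂.time S + 1 + e₁.width * S
  | .mul e₁ e₂ => e₁.time S + e₂.time S + 1 + (e₁.width + e₂.width) * S
  | .div e₁ e₂ => e₁.time S + e₂.time S + 1 + e₁.width * S

/-- Bound for the running time over a memory of words of `S` bits, if every loop is iterated at
most `Φ` times. -/
def Program.time (S Φ : ℕ) : Program → ℕ
  | .skip => 1
  | .store _ i e => i.time S + e.time S + 1
  | .flip _ i => i.time S + 1
  | .seq p q => p.time S Φ + q.time S Φ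
  | .ite g p q => g.time S + 1 + (p.time S Φ + q.time S Φ)
  | .loop g p => (Φ + 1) * (g.time S + 1 + p.time S Φ)

/-- Whether the program may write to the array `a`. -/
def Program.touches (a : ℕ) : Program → Bool
  | .skip => false
  | .store b _ _ => a == b
  | .flip b _ => a == b
  | .seq p q => p.touches a || q.touches a
  | .ite _ p q => p.touches a || q.touches a
  | .loop _ p => p.touches a

/-- Whether the program may toss a coin. -/
def Program.flips : Program → Bool
  | .skip => false
  | .store _ _ _ => false
  | .flip _ _ => true
  | .seq p q => p.flips || q.flips
  | .ite _ p q => p.flips || q.flips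
  | .loop _ p => p.flips

/-! ### Syntactic time bounds are polynomial -/

theorem Expr.exists_time_polynomial (e : Expr) (sp : Polynomial ℕ) :
    ∃ p : Polynomial ℕ, ∀ z, e.time (sp.eval z) = p.eval z := by
  induction e with
  | const c => exact ⟨Polynomial.C (1 + Nat.size c), fun z => by simp [Expr.time]⟩
  | get a i ih =>
    obtain ⟨p, hp⟩ := ih
    exact ⟨p + 1 + sp, fun z => by simp [Expr.time, hp]⟩
  | add e₁ e₂ h₁ h₂ | mul e₁ e₂ h₁ h₂ =>
    obtain ⟨p, hp⟩ := h₁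
    obtain ⟨q, hq⟩ := h₂
    exact ⟨p + q + 1 + Polynomial.C (e₁.width + e₂.width) * sp,
      fun z => by simp [Expr.time, hp, hq]⟩
  | sub e₁ e₂ h₁ h₂ | div e₁ e₂ h₁ h₂ =>
    obtain ⟨p, hp⟩ := h₁
    obtain ⟨q, hq⟩ := h₂
    exact ⟨p + q + 1 + Polynomial.C e₁.width * sp, fun z => by simp [Expr.time, hp, hq]⟩

/-- A loop multiplies the bound by Φ + 1, and the nesting depth is fixed by the program text, so
polynomial S and Φ keep the bound polynomial. -/
theorem Program.exists_time_polynomial (P : Program) (sp fp : Polynomial ℕ) :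
    ∃ p : Polynomial ℕ, ∀ z, P.time (sp.eval z) (fp.eval z) = p.eval z := by
  induction P with
  | skip => exact ⟨1, fun z => by simp [Program.time]⟩
  | store a i e =>
    obtain ⟨p, hp⟩ := i.exists_time_polynomial sp
    obtain ⟨q, hq⟩ := e.exists_time_polynomial sp
    exact ⟨p + q + 1, fun z => by simp [Program.time, hp, hq]⟩
  | flip a i =>
    obtain ⟨p, hp⟩ := i.exists_time_polynomial sp
    exact ⟨p + 1, fun z => by simp [Program.time, hp]⟩
  | seq P Q hP hQ =>
    obtain ⟨p, hp⟩ := hP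
    obtain ⟨q, hq⟩ := hQ
    exact ⟨p + q, fun z => by simp [Program.time, hp, hq]⟩
  | ite g P Q hP hQ =>
    obtain ⟨r, hr⟩ := g.exists_time_polynomial sp
    obtain ⟨p, hp⟩ := hP
    obtain ⟨q, hq⟩ := hQ
    exact ⟨r + 1 + (p + q), fun z => by simp [Program.time, hp, hq, hr]⟩
  | loop g P hP =>
    obtain ⟨r, hr⟩ := g.exists_time_polynomial sp
    obtain ⟨p, hp⟩ := hP
    exact ⟨(fp + 1) * (r + 1 + p), fun z => by simp [Program.time, hp, hr]⟩

/-- All entries of the memory have at most `S` bits. -/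
def Memory.Bdd (S : ℕ) (mem : Memory) : Prop := ∀ a i, Nat.size (mem a i) ≤ S

theorem Nat.size_add_le_add (a b : ℕ) : Nat.size (a + b) ≤ Nat.size a + Nat.size b := by
  rcases Nat.eq_zero_or_pos a with rfl | ha
  · simp
  rcases Nat.eq_zero_or_pos b with rfl | hb
  · simp
  have h₁ : 1 ≤ Nat.size a := Nat.size_pos.2 ha
  have h₂ : 1 ≤ Nat.size b := Nat.size_pos.2 hb
  have h : ∀ x y : ℕ, 1 ≤ y → 2 ^ x ≤ 2 ^ (x + y - 1) := fun x y hy =>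
    Nat.pow_le_pow_right (by norm_num) (by omega)
  have h₃ := h (Nat.size a) _ h₂
  have h₄ := h (Nat.size b) _ h₁
  rw [Nat.size_le]
  have h₅ : 2 ^ (Nat.size a + Nat.size b) = 2 * 2 ^ (Nat.size a + Nat.size b - 1) := by
    rw [← pow_succ']
    congr 1
    omega
  have h₆ := Nat.lt_size_self a
  have h₇ := Nat.lt_size_self b
  rw [Nat.add_comm (Nat.size b)] at h₄
  omega

theorem Nat.size_mul_le_add (a b : ℕ) : Nat.size (a * b) ≤ Nat.size a + Nat.size b := by
  rw [Nat.size_le, pow_add]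
  exact Nat.mul_lt_mul'' (Nat.lt_size_self a) (Nat.lt_size_self b)

/-- Intermediate values may be longer than a word, but only by a factor fixed by the syntax.
Truncated subtraction and integer division never exceed the left operand. -/
theorem Expr.size_eval_le {S : ℕ} (hS : 1 ≤ S) {mem : Memory} (hm : mem.Bdd S) (e : Expr) :
    Nat.size (e.eval mem) ≤ e.width * S := by
  induction e with
  | const c => simpa [Expr.eval, Expr.width] using Nat.le_mul_of_pos_right _ hS
  | get a i ih => simpa [Expr.eval, Expr.width] using hm a _
  | add e₁ e₂ h₁ h₂ =>
    simp only [Expr.eval, Expr.width, add_mul]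
    exact (Nat.size_add_le_add _ _).trans (add_le_add h₁ h₂)
  | mul e₁ e₂ h₁ h₂ =>
    simp only [Expr.eval, Expr.width, add_mul]
    exact (Nat.size_mul_le_add _ _).trans (add_le_add h₁ h₂)
  | sub e₁ e₂ h₁ h₂ => exact (Nat.size_le_size (Nat.sub_le _ _)).trans h₁
  | div e₁ e₂ h₁ h₂ => exact (Nat.size_le_size (Nat.div_le_self _ _)).trans h₁

theorem Expr.cost_le {S : ℕ} (hS : 1 ≤ S) {mem : Memory} (hm : mem.Bdd S) (e : Expr) :
    e.cost mem ≤ e.time S := by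
  induction e with
  | const c => simp [Expr.cost, Expr.time]
  | get a i ih =>
    have := hm a (i.eval mem)
    simp only [Expr.cost, Expr.time, Expr.eval]
    omega
  | add e₁ e₂ h₁ h₂ =>
    have := (Expr.add e₁ e₂).size_eval_le hS hm
    simp only [Expr.cost, Expr.time, Expr.width] at this ⊢
    omega
  | mul e₁ e₂ h₁ h₂ =>
    have := (Expr.mul e₁ e₂).size_eval_le hS hm
    simp only [Expr.cost, Expr.time, Expr.width] at this ⊢
    omega
  | sub e₁ e₂ h₁ h₂ =>
    have := (Expr.sub e₁ e₂).size_eval_le hS hm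
    simp only [Expr.cost, Expr.time, Expr.width] at this ⊢
    omega
  | div e₁ e₂ h₁ h₂ =>
    have := (Expr.div e₁ e₂).size_eval_le hS hm
    simp only [Expr.cost, Expr.time, Expr.width] at this ⊢
    omega

/-- The two states agree on everything that the program cannot change. -/
def Program.Same (P : Program) (s s' : State) : Prop :=
  (∀ a, P.touches a = false → s'.mem a = s.mem a) ∧ (P.flips = false → s'.coins = s.coins)

theorem Memory.write_of_ne {mem : Memory} {a b i v : ℕ} (h : b ≠ a) :
    mem.write a i v b = mem b := by
  funext j
  simp [Memory.write, h]

/-- The frame rule. `touches` and `flips` are computed from the syntax, so its side conditions are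
settled by `decide`. -/
theorem Exec.same {P : Program} {s s' : State} {T : ℕ} (h : Exec P s T s') : P.Same s s' := by
  induction h with
  | skip s => exact ⟨fun _ _ => rfl, fun _ => rfl⟩
  | store a i e s =>
    exact ⟨fun b hb => Memory.write_of_ne (by simpa [Program.touches] using hb), fun _ => rfl⟩
  | flip a i s =>
    exact ⟨fun b hb => Memory.write_of_ne (by simpa [Program.touches] using hb),
      fun h => by simp [Program.flips] at h⟩
  | seq p q s s₁ s₂ T₁ T₂ h₁ h₂ ih₁ ih₂ =>
    refine ⟨fun b hb => ?_, fun h => ?_⟩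
    · simp only [Program.touches, Bool.or_eq_false_iff] at hb
      rw [ih₂.1 b hb.2, ih₁.1 b hb.1]
    · simp only [Program.flips, Bool.or_eq_false_iff] at h
      rw [ih₂.2 h.2, ih₁.2 h.1]
  | ite_true g p q s s₁ T hg h ih =>
    refine ⟨fun b hb => ?_, fun h => ?_⟩
    · simp only [Program.touches, Bool.or_eq_false_iff] at hb
      exact ih.1 b hb.1
    · simp only [Program.flips, Bool.or_eq_false_iff] at h
      exact ih.2 h.1
  | ite_false g p q s s₁ T hg h ih =>
    refine ⟨fun b hb => ?_, fun h => ?_⟩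
    · simp only [Program.touches, Bool.or_eq_false_iff] at hb
      exact ih.1 b hb.2
    · simp only [Program.flips, Bool.or_eq_false_iff] at h
      exact ih.2 h.2
  | loop_done g p s hg => exact ⟨fun _ _ => rfl, fun _ => rfl⟩
  | loop_step g p s s₁ s₂ T₁ T₂ hg h₁ h₂ ih₁ ih₂ =>
    exact ⟨fun b hb => by rw [ih₂.1 b hb, ih₁.1 b hb], fun h => by rw [ih₂.2 h, ih₁.2 h]⟩

/-- Total correctness: started in `s`, if that memory holds words of `S` bits only, the program
halts in time, again with words of `S` bits only, in a state with the property `Q`. -/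
def Spec (S Φ : ℕ) (P : Program) (s : State) (Q : State → Prop) : Prop :=
  s.mem.Bdd S → ∃ T s', Exec P s T s' ∧ T ≤ P.time S Φ ∧ s'.mem.Bdd S ∧ Q s'

/-- The state after writing `v` to entry `i` of the array `a`. -/
def State.put (s : State) (a i v : ℕ) : State := { mem := s.mem.write a i v, coins := s.coins }

theorem State.put_mem_of_ne {s : State} {a b i v : ℕ} (h : b ≠ a) :
    (s.put a i v).mem b = s.mem b := Memory.write_of_ne h

theorem State.put_mem_self {s : State} {a i v : ℕ} :
    (s.put a i v).mem a = Function.update (s.mem a) i v := by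
  funext j
  by_cases h : j = i
  · subst h
    simp [State.put, Memory.write]
  · simp [State.put, Memory.write, h]

theorem State.put_coins {s : State} {a i v : ℕ} : (s.put a i v).coins = s.coins := rfl

theorem Memory.Bdd.write {S : ℕ} {mem : Memory} (h : mem.Bdd S) {a i v : ℕ}
    (hv : Nat.size v ≤ S) : (mem.write a i v).Bdd S := by
  intro b j
  unfold Memory.write
  split
  · exact hv
  · exact h b j

/-! ### Rules of the program logic -/

namespace Spec

variable {S Φ : ℕ} {s : State} {Q R : State → Prop}

theorem mono {P : Program} (h : Spec S Φ P s R)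
    (hq : ∀ s', s'.mem.Bdd S → P.Same s s' → R s' → Q s') : Spec S Φ P s Q := by
  intro hb
  obtain ⟨T, s', he, hT, hb', hr⟩ := h hb
  exact ⟨T, s', he, hT, hb', hq s' hb' he.same hr⟩

theorem skip (h : Q s) : Spec S Φ .skip s Q :=
  fun hb => ⟨1, s, .skip s, le_rfl, hb, h⟩

theorem store (hS : 1 ≤ S) {a : ℕ} {i e : Expr} (hv : s.mem.Bdd S → Nat.size (e.eval s.mem) ≤ S)
    (h : Q (s.put a (i.eval s.mem) (e.eval s.mem))) : Spec S Φ (.store a i e) s Q := by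
  intro hb
  refine ⟨_, _, .store a i e s, ?_, hb.write (hv hb), h⟩
  have h₁ := i.cost_le hS hb
  have h₂ := e.cost_le hS hb
  simp only [Program.time]
  omega

theorem seq {P P' : Program} (h : Spec S Φ P s R)
    (h' : ∀ s', s'.mem.Bdd S → P.Same s s' → R s' → Spec S Φ P' s' Q) :
    Spec S Φ (.seq P P') s Q := by
  intro hb
  obtain ⟨T, s₁, he, hT, hb₁, hr⟩ := h hb
  obtain ⟨T', s₂, he', hT', hb₂, hq⟩ := h' s₁ hb₁ he.same hr hb₁
  exact ⟨_, _, .seq _ _ _ _ _ _ _ he he', by simp only [Program.time]; omega, hb₂, hq⟩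

theorem store_seq (hS : 1 ≤ S) {a : ℕ} {i e : Expr} {P : Program}
    (hv : s.mem.Bdd S → Nat.size (e.eval s.mem) ≤ S)
    (h : Spec S Φ P (s.put a (i.eval s.mem) (e.eval s.mem)) Q) :
    Spec S Φ (.seq (.store a i e) P) s Q :=
  Spec.seq (R := fun s' => s' = s.put a (i.eval s.mem) (e.eval s.mem))
    (Spec.store hS hv rfl) (by rintro _ _ _ rfl; exact h)

theorem flip (hS : 1 ≤ S) {a : ℕ} {i : Expr}
    (h : Q { mem := s.mem.write a (i.eval s.mem) (s.coins 0).toNat,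
             coins := fun l => s.coins (l + 1) }) : Spec S Φ (.flip a i) s Q := by
  intro hb
  refine ⟨_, _, .flip a i s, ?_, hb.write ?_, h⟩
  · have h₁ := i.cost_le hS hb
    simp only [Program.time]
    omega
  · rw [Nat.size_le]
    calc (s.coins 0).toNat ≤ 1 := Bool.toNat_le _
      _ < 2 ^ 1 := by norm_num
      _ ≤ 2 ^ S := Nat.pow_le_pow_right (by norm_num) hS

theorem ite (hS : 1 ≤ S) {g : Expr} {P P' : Program}
    (h₁ : g.eval s.mem ≠ 0 → Spec S Φ P s Q) (h₂ : g.eval s.mem = 0 → Spec S Φ P' s Q) :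
    Spec S Φ (.ite g P P') s Q := by
  intro hb
  have hc := g.cost_le hS hb
  by_cases hg : g.eval s.mem = 0
  · obtain ⟨T, s', he, hT, hb', hq⟩ := h₂ hg hb
    exact ⟨_, _, .ite_false _ _ _ _ _ _ hg he, by simp only [Program.time]; omega, hb', hq⟩
  · obtain ⟨T, s', he, hT, hb', hq⟩ := h₁ hg hb
    exact ⟨_, _, .ite_true _ _ _ _ _ _ hg he, by simp only [Program.time]; omega, hb', hq⟩

/-- The values in `α` are ghost states: they describe the mathematical state behind the memory and
are not stored. `μ` bounds the remaining rounds. -/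
theorem loop (hS : 1 ≤ S) {g : Expr} {P : Program} {α : Type} (μ : α → ℕ) (Inv : α → State → Prop)
    (x₀ : α) (h0 : Inv x₀ s) (hμ : μ x₀ ≤ Φ)
    (hstep : ∀ x s', s'.mem.Bdd S → P.Same s s' → Inv x s' → g.eval s'.mem ≠ 0 →
      Spec S Φ P s' (fun s'' => ∃ y, Inv y s'' ∧ μ y < μ x)) :
    Spec S Φ (.loop g P) s (fun s' => ∃ x, Inv x s' ∧ g.eval s'.mem = 0) := by
  intro hb
  -- The guard is evaluated once more than the body is run, hence n + 1.
  suffices H : ∀ n x s', μ x ≤ n → s'.mem.Bdd S → P.Same s s' → Inv x s' →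
      ∃ T s'', Exec (.loop g P) s' T s'' ∧ T ≤ (n + 1) * (g.time S + 1 + P.time S Φ) ∧
        s''.mem.Bdd S ∧ (∃ x, Inv x s'' ∧ g.eval s''.mem = 0) by
    exact H Φ x₀ s hμ hb ⟨fun _ _ => rfl, fun _ => rfl⟩ h0
  intro n
  induction n with
  | zero =>
    intro x s' hn hb' hs hi
    have hc := g.cost_le hS hb'
    by_cases hg : g.eval s'.mem = 0
    · exact ⟨_, _, .loop_done _ _ _ hg, by rw [zero_add, one_mul]; omega, hb', x, hi, hg⟩
    · obtain ⟨T, s'', he, hT, hb'', y, hi', hlt⟩ := hstep x s' hb' hs hi hg hb'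
      omega
  | succ n ih =>
    intro x s' hn hb' hs hi
    have hc := g.cost_le hS hb'
    by_cases hg : g.eval s'.mem = 0
    · refine ⟨_, _, .loop_done _ _ _ hg, ?_, hb', x, hi, hg⟩
      have : 1 * (g.time S + 1 + P.time S Φ) ≤ (n + 1 + 1) * (g.time S + 1 + P.time S Φ) :=
        Nat.mul_le_mul_right _ (by omega)
      omega
    · obtain ⟨T, s₁, he, hT, hb₁, y, hi₁, hlt⟩ := hstep x s' hb' hs hi hg hb'
      have hs₁ : P.Same s s₁ := ⟨fun a ha => by rw [he.same.1 a ha, hs.1 a ha],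
        fun h => by rw [he.same.2 h, hs.2 h]⟩
      obtain ⟨T', s₂, he', hT', hb₂, hq⟩ := ih y s₁ (by omega) hb₁ hs₁ hi₁
      refine ⟨_, _, .loop_step _ _ _ _ _ _ _ hg he he', ?_, hb₂, hq⟩
      have : (n + 1 + 1) * (g.time S + 1 + P.time S Φ) =
        (n + 1) * (g.time S + 1 + P.time S Φ) + (g.time S + 1 + P.time S Φ) := by ring
      omega

end Spec

/-- Reading the variable `x`. -/
def Expr.var (x : ℕ) : Expr := .get x (.const 0)

/-- Assigning to the variable `x`. -/
def Program.set (x : ℕ) (e : Expr) : Program := .store x (.const 0) e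

/-- Repeat the body for all values of the variable `x` below `g`. -/
def Program.for (x : ℕ) (g : Expr) (P : Program) : Program :=
  .seq (.set x (.const 0))
    (.loop (.sub g (.var x)) (.seq P (.set x (.add (.var x) (.const 1)))))

/-- The bound `g` is evaluated anew in every round, so it must keep its value under everything the
loop writes. The invariant after the body is stated for the state in which the counter has already
been advanced. -/
theorem Spec.for {S Φ : ℕ} (hS : 1 ≤ S) {s : State} {x : ℕ} {g : Expr} {P : Program} (cnt : ℕ)
    (hcnt : Nat.size cnt ≤ S) (hΦ : cnt ≤ Φ) (Inv : ℕ → State → Prop)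
    (hx : P.touches x = false)
    (hg : ∀ s' : State, (Program.for x g P).Same s s' → g.eval s'.mem = cnt)
    (h0 : Inv 0 (s.put x 0 0))
    (hstep : ∀ i s', i < cnt → s'.mem.Bdd S → (Program.for x g P).Same s s' → s'.mem x 0 = i →
      Inv i s' → Spec S Φ P s' (fun s'' => Inv (i + 1) (s''.put x 0 (i + 1)))) :
    Spec S Φ (.for x g P) s (Inv cnt) := by
  have hsame : ∀ s', (Program.seq P (.set x (.add (.var x) (.const 1)))).Same (s.put x 0 0) s' →
      (Program.for x g P).Same s s' := by
    intro s' h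
    refine ⟨fun a ha => ?_, fun ha => ?_⟩
    · simp only [Program.for, Program.touches, Program.set, Bool.or_eq_false_iff] at ha
      rw [h.1 a (by simp [Program.touches, Program.set, ha]), State.put_mem_of_ne]
      simpa using ha.1
    · rw [h.2 (by simpa [Program.for, Program.flips, Program.set] using ha)]
      rfl
  refine Spec.store_seq hS (fun _ => by simp [Expr.eval]) ?_
  refine (Spec.loop hS (fun i => cnt - i)
    (fun i s' => s'.mem x 0 = i ∧ i ≤ cnt ∧ Inv i s') 0
    ⟨by simp [State.put_mem_self], Nat.zero_le _, h0⟩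
    ((Nat.sub_le _ _).trans hΦ) ?_).mono ?_
  · rintro i s' hb hs ⟨rfl, hle, hi⟩ hne
    have hs' := hsame s' hs
    have hlt : s'.mem x 0 < cnt := by
      simp only [Expr.eval, Expr.var, hg s' hs'] at hne
      omega
    refine Spec.seq (hstep _ s' hlt hb hs' rfl hi) ?_
    intro s'' hb'' hs'' hi'
    have hxx : s''.mem x = s'.mem x := hs''.1 x hx
    refine Spec.store hS (fun _ => ?_) ?_
    · simp only [Expr.eval, Expr.var, hxx]
      exact (Nat.size_le_size hlt).trans hcnt
    · simp only [Expr.eval, Expr.var, hxx]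
      exact ⟨s'.mem x 0 + 1, ⟨by simp [State.put_mem_self], hlt, hi'⟩, by omega⟩
  · rintro s' hb hs ⟨i, ⟨hi, hle, hInv⟩, h0'⟩
    simp only [Expr.eval, Expr.var, hg s' (hsame s' hs), hi] at h0'
    have : i = cnt := by omega
    rwa [this] at hInv

/-! ### Learning a fractional cover by multiplicative weights -/

/-- Parameters of the learner: `m` sets with integral costs `C`, the indices `sets u` of the sets
that contain `u`, the cost `κ u` of the cheapest of them, the number `M` of samples and the factor
`B` that decides when a guess of the optimum is given up. -/
structure Learner where
  m : ℕ
  M : ℕ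
  B : ℕ
  sets : ℕ → Finset ℕ
  C : ℕ → ℕ
  κ : ℕ → ℕ

/-- State of the learner: the guess `β` of the optimum, the amount `K` paid under this guess, the
position `q` of the scan, and the load `D` of the sets. The fields `tot` and `sv` record the total
amount paid and the positions of the samples it was paid for. -/
structure LearnerState where
  β : ℕ
  K : ℕ
  q : ℕ
  D : ℕ → ℕ
  tot : ℕ
  sv : Finset ℕ

namespace Learner

variable (X : Learner)

def pw (st : LearnerState) (j : ℕ) : ℕ := 2 ^ (st.D j / X.C j)

def total (st : LearnerState) : ℕ := ∑ j ∈ Finset.range X.m, X.pw st j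

/-- The fractional cover, up to normalization by `m * total`. -/
def wt (st : LearnerState) (j : ℕ) : ℕ := 16 * X.m * st.β * X.pw st j / X.C j

/-- Free sets have weight 0, since division by zero gives 0. Elements of free sets have κ = 0 and
are therefore exempted explicitly. -/
def Missed (st : LearnerState) (u : ℕ) : Prop :=
  X.κ u ≠ 0 ∧ ∑ j ∈ X.sets u, X.wt st j < X.m * X.total st

/-- With truncated subtraction the new guess is 2·max(β, κ u). Both branches return to the start of
the scan, so a completed scan has tested all samples against the same weights. -/
def event (st : LearnerState) (u : ℕ) : LearnerState :=
  if st.K + X.κ u ≤ X.B * st.β then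
    { β := st.β
      K := st.K + X.κ u
      q := 0
      D := fun j => if j ∈ X.sets u then st.D j + X.κ u else st.D j
      tot := st.tot + X.κ u
      sv := insert st.q st.sv }
  else
    { β := 2 * (st.β + (X.κ u - st.β))
      K := 0
      q := 0
      D := fun _ => 0
      tot := st.tot + X.κ u
      sv := insert st.q st.sv }

def next (st : LearnerState) : LearnerState :=
  { β := st.β, K := st.K, q := st.q + 1, D := st.D, tot := st.tot, sv := st.sv }

open Classical in
/-- One step on the samples `W`, of which some may be missing. -/
noncomputable def step (W : ℕ → Option ℕ) (st : LearnerState) : LearnerState :=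
  if X.M ≤ st.q then st
  else (W st.q).elim (next st) fun u => if X.Missed st u then X.event st u else next st

def init : LearnerState := { β := 0, K := 0, q := 0, D := fun _ => 0, tot := 0, sv := ∅ }

noncomputable def run (W : ℕ → Option ℕ) (T : ℕ) : LearnerState := (X.step W)^[T] init

theorem run_succ (W : ℕ → Option ℕ) (T : ℕ) : X.run W (T + 1) = X.step W (X.run W T) :=
  Function.iterate_succ_apply' _ _ _

variable {X}

theorem step_of_le {W : ℕ → Option ℕ} {st : LearnerState} (h : X.M ≤ st.q) :
    X.step W st = st := by
  simp [step, h]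

theorem step_of_none {W : ℕ → Option ℕ} {st : LearnerState} (h : st.q < X.M)
    (hW : W st.q = none) : X.step W st = next st := by
  simp [step, h.not_ge, hW]

theorem step_of_missed {W : ℕ → Option ℕ} {st : LearnerState} {u : ℕ} (h : st.q < X.M)
    (hW : W st.q = some u) (hu : X.Missed st u) : X.step W st = X.event st u := by
  simp [step, h.not_ge, hW, hu]

theorem step_of_not_missed {W : ℕ → Option ℕ} {st : LearnerState} {u : ℕ} (h : st.q < X.M)
    (hW : W st.q = some u) (hu : ¬ X.Missed st u) : X.step W st = next st := by
  simp [step, h.not_ge, hW, hu]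

theorem step_cases (W : ℕ → Option ℕ) (st : LearnerState) :
    (X.M ≤ st.q ∧ X.step W st = st) ∨
    (st.q < X.M ∧ (∀ u, W st.q = some u → ¬ X.Missed st u) ∧ X.step W st = next st) ∨
    (st.q < X.M ∧ ∃ u, W st.q = some u ∧ X.Missed st u ∧ X.step W st = X.event st u) := by
  rcases le_or_gt X.M st.q with h | h
  · exact Or.inl ⟨h, step_of_le h⟩
  right
  rcases hW : W st.q with _ | u
  · exact Or.inl ⟨h, by simp, step_of_none h hW⟩
  by_cases hu : X.Missed st u
  · exact Or.inr ⟨h, u, rfl, hu, step_of_missed h hW hu⟩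
  · refine Or.inl ⟨h, ?_, step_of_not_missed h hW hu⟩
    rintro v hv
    cases hv
    exact hu

/-- A completed scan is a fixed point of `step`. Hence the moment at which the program stops and the
a priori number of steps in `final` lead to the same state. -/
theorem run_eq_of_done {W : ℕ → Option ℕ} {T T' : ℕ} (h : X.M ≤ (X.run W T).q)
    (h' : X.M ≤ (X.run W T').q) : X.run W T = X.run W T' := by
  have H : ∀ T i, X.M ≤ (X.run W T).q → X.run W (T + i) = X.run W T := by
    intro T i h
    induction i with
    | zero => rfl
    | succ i ih => rw [← add_assoc, run_succ, ih, step_of_le h]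
  rcases le_total T T' with hT | hT
  · obtain ⟨i, rfl⟩ := Nat.exists_eq_add_of_le hT
    exact (H _ _ h).symm
  · obtain ⟨i, rfl⟩ := Nat.exists_eq_add_of_le hT
    exact H _ _ h'

theorem sv_subset_step (W : ℕ → Option ℕ) (st : LearnerState) : st.sv ⊆ (X.step W st).sv := by
  rcases X.step_cases W st with ⟨_, h⟩ | ⟨_, _, h⟩ | ⟨_, u, _, _, h⟩
  · rw [h]
  · rw [h]
    exact Finset.Subset.refl _
  · rw [h]
    unfold event
    split <;> exact Finset.subset_insert _ _

/-- Samples that never caused a payment may be removed without changing anything. -/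
theorem run_remove {W : ℕ → Option ℕ} {q : ℕ} (T : ℕ) (h : q ∉ (X.run W T).sv) :
    X.run (Function.update W q none) T = X.run W T := by
  induction T with
  | zero => rfl
  | succ T ih =>
    rw [run_succ] at h
    have h₁ := ih fun hq => h (sv_subset_step W _ hq)
    rw [run_succ, run_succ, h₁]
    set st := X.run W T
    by_cases hq : st.q = q
    -- The position q is being read. Without a payment the step merely moves on, as it does for a
    -- missing sample; a payment would record q in `sv`.
    · rcases X.step_cases W st with ⟨hM, h'⟩ | ⟨hM, _, h'⟩ | ⟨_, u, _, _, h'⟩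
      · rw [h', step_of_le hM]
      · rw [h', step_of_none hM (by simp [hq])]
      · refine absurd ?_ h
        rw [h', ← hq]
        unfold event
        split <;> exact Finset.mem_insert_self _ _
    · unfold step
      rw [Function.update_of_ne hq]

/-! #### Invariants -/

/-- The data of the learner fit together. -/
structure Proper (X : Learner) (N sm : ℕ) : Prop where
  m_pos : 0 < X.m
  m_lt : X.m < 2 ^ sm
  B_eq : X.B = 5 * sm
  sets_sub : ∀ u, X.sets u ⊆ Finset.range X.m
  κ_le : ∀ u < N, ∀ j ∈ X.sets u, X.κ u ≤ X.C j
  exists_le : ∀ u < N, ∃ j ∈ X.sets u, X.C j ≤ X.κ u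

/-- `F` covers the samples. -/
def IsCover (X : Learner) (W : ℕ → Option ℕ) (F : Finset ℕ) : Prop :=
  ∀ q < X.M, ∀ u, W q = some u → ∃ j ∈ F, j ∈ X.sets u

/-- Piecewise linear version of `2 ^ (D / C)`. -/
noncomputable def pot (C D : ℕ) : ℝ := 2 ^ (D / C) * (1 + ((D % C : ℕ) : ℝ) / C)

theorem pow_le_pot (C D : ℕ) : (2 : ℝ) ^ (D / C) ≤ pot C D := by
  unfold pot
  exact le_mul_of_one_le_right (by positivity) (le_add_of_nonneg_right (by positivity))

/-- On the l-th interval of length C the potential is linear with slope 2^l / C. As κ ≤ C, at most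
one breakpoint is crossed, and there the slope doubles. -/
theorem pot_add_le {C D κ : ℕ} (hC : 0 < C) (hκ : κ ≤ C) :
    pot C (D + κ) ≤ pot C D + 2 * 2 ^ (D / C) * κ / C := by
  have hC' : (0 : ℝ) < C := by exact_mod_cast hC
  have hr : D % C < C := Nat.mod_lt _ hC
  have hD := Nat.div_add_mod D C
  have hp : (0 : ℝ) < 2 ^ (D / C) := by positivity
  unfold pot
  rcases lt_or_ge (D % C + κ) C with h | h
  · have h₁ : (D + κ) / C = D / C ∧ (D + κ) % C = D % C + κ := by
      rw [Nat.div_mod_unique hC]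
      exact ⟨by omega, h⟩
    rw [h₁.1, h₁.2]
    push_cast
    have : (0 : ℝ) ≤ 2 ^ (D / C) * (κ / C) := by positivity
    field_simp at this ⊢
    nlinarith
  · have h₁ : (D + κ) / C = D / C + 1 ∧ (D + κ) % C = D % C + κ - C := by
      rw [Nat.div_mod_unique hC]
      refine ⟨?_, by omega⟩
      rw [mul_add, mul_one]
      omega
    rw [h₁.1, h₁.2, Nat.cast_sub h, pow_succ]
    push_cast
    have hr' : ((D % C : ℕ) : ℝ) ≤ C := by exact_mod_cast hr.le
    have : (2 : ℝ) ^ (D / C) * ((D % C : ℕ) : ℝ) ≤ 2 ^ (D / C) * C :=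
      mul_le_mul_of_nonneg_left hr' hp.le
    field_simp
    nlinarith

theorem cast_div_lt (a c : ℕ) (hc : 0 < c) : (a : ℝ) / c ≤ ((a / c : ℕ) : ℝ) + 1 := by
  rw [div_le_iff₀ (by exact_mod_cast hc)]
  have h₁ := Nat.div_add_mod a c
  have h₂ := Nat.mod_lt a hc
  have : a ≤ (a / c + 1) * c := by
    rw [add_mul, one_mul, mul_comm]
    omega
  exact_mod_cast this

variable {N sm : ℕ} {W : ℕ → Option ℕ} {st : LearnerState}

theorem le_total (st : LearnerState) : X.m ≤ X.total st := by
  unfold total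
  calc X.m = ∑ j ∈ Finset.range X.m, 1 := by simp
    _ ≤ _ := Finset.sum_le_sum fun j _ => Nat.one_le_two_pow

theorem Proper.C_pos (hX : X.Proper N sm) {u : ℕ} (hu : u < N) (hm : X.κ u ≠ 0) {j : ℕ}
    (hj : j ∈ X.sets u) : 0 < X.C j := by
  have := hX.κ_le u hu j hj
  omega

/-- Rounding a weight down loses at most one, so at most m in all, and m ≤ m·total. Being missed
thus bounds the sum of the unrounded weights by 2m·total, which turns the factor 16 into 8. -/
theorem Proper.missed_le (hX : X.Proper N sm) {u : ℕ} (hu : u < N) (hm : X.Missed st u) :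
    8 * (st.β : ℝ) * ∑ j ∈ X.sets u, (2 : ℝ) ^ (st.D j / X.C j) / X.C j ≤ X.total st := by
  have hm0 : (0 : ℝ) < X.m := by exact_mod_cast hX.m_pos
  have h₁ : ∀ j ∈ X.sets u, 16 * (X.m : ℝ) * st.β * (2 ^ (st.D j / X.C j) / X.C j) ≤
      X.wt st j + 1 := by
    intro j hj
    have := cast_div_lt (16 * X.m * st.β * X.pw st j) (X.C j) (hX.C_pos hu hm.1 hj)
    unfold wt
    refine le_trans (le_of_eq ?_) this
    unfold pw
    push_cast
    ring
  have h₂ := Finset.sum_le_sum h₁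
  rw [← Finset.mul_sum, Finset.sum_add_distrib] at h₂
  have h₃ : ∑ j ∈ X.sets u, (X.wt st j : ℝ) ≤ X.m * X.total st := by
    exact_mod_cast hm.2.le
  have h₄ : ∑ j ∈ X.sets u, (1 : ℝ) ≤ X.m := by
    simp only [Finset.sum_const, nsmul_eq_mul, mul_one]
    have := Finset.card_le_card (hX.sets_sub u)
    rw [Finset.card_range] at this
    exact_mod_cast this
  have h₅ : (1 : ℝ) ≤ X.total st := by
    exact_mod_cast hX.m_pos.trans_le (X.le_total st)
  have h₆ : (X.m : ℝ) ≤ X.m * X.total st := le_mul_of_one_le_right hm0.le h₅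
  refine le_of_mul_le_mul_left ?_ hm0
  nlinarith

/-- The invariant of the learner. -/
structure Inv (X : Learner) (W : ℕ → Option ℕ) (st : LearnerState) : Prop where
  K_le : st.K ≤ X.B * st.β
  tot_le : st.tot ≤ (X.B + 1) * st.β + st.K
  pot_le : ∑ j ∈ Finset.range X.m, pot (X.C j) (st.D j) ≤ X.m * Real.exp (st.K / (4 * st.β))
  K_le_cover : ∀ F, X.IsCover W F → st.K ≤ ∑ j ∈ F, st.D j
  β_le : ∀ F, X.IsCover W F → st.β ≤ 2 * ∑ j ∈ F, X.C j
  D_eq : ∀ j, X.C j = 0 → st.D j = 0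
  sv_sub : st.sv ⊆ (Finset.range X.M).filter fun q => (W q).isSome
  sv_le : ∑ q ∈ st.sv, (W q).elim 0 X.κ ≤ st.tot
  scanned : ∀ q < st.q, ∀ u, W q = some u → ¬ X.Missed st u
  q_le : st.q ≤ X.M

theorem inv_init : X.Inv W init where
  K_le := by simp [init]
  tot_le := by simp [init]
  pot_le := by simp [init, pot]
  K_le_cover := by simp [init]
  β_le := by simp [init]
  D_eq := by simp [init]
  sv_sub := by simp [init]
  sv_le := by simp [init]
  scanned := by simp [init]
  q_le := by simp [init]

/-- A single summand is at most the whole potential; take logarithms and use m < 2^sm. -/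
theorem Inv.log_le (h : X.Inv W st) (hX : X.Proper N sm) {j : ℕ} (hj : j < X.m) :
    ((st.D j / X.C j : ℕ) : ℝ) * Real.log 2 ≤ sm * Real.log 2 + st.K / (4 * st.β) := by
  have hm0 : (0 : ℝ) < X.m := by exact_mod_cast hX.m_pos
  have h₁ : (2 : ℝ) ^ (st.D j / X.C j) ≤ X.m * Real.exp (st.K / (4 * st.β)) := by
    refine (pow_le_pot _ _).trans (le_trans ?_ h.pot_le)
    refine Finset.single_le_sum (f := fun j => pot (X.C j) (st.D j)) (fun i _ => ?_)
      (Finset.mem_range.2 hj)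
    exact le_trans (by positivity) (pow_le_pot _ _)
  have h₂ := Real.log_le_log (by positivity) h₁
  rw [Real.log_pow, Real.log_mul hm0.ne' (Real.exp_pos _).ne', Real.log_exp] at h₂
  have h₃ : Real.log X.m ≤ sm * Real.log 2 := by
    rw [← Real.log_pow]
    exact Real.log_le_log hm0 (by exact_mod_cast hX.m_lt.le)
  linarith

theorem Proper.sm_pos (hX : X.Proper N sm) : 0 < sm := by
  rcases Nat.eq_zero_or_pos sm with rfl | h
  · have := hX.m_lt
    have := hX.m_pos
    omega
  · exact h

/-- K ≤ 5·sm·β gives K/(4β) ≤ 5·sm/4, and 5/4 ≤ 2 log 2. This keeps the weights within 2^(3·sm) and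
makes the termination measure small. -/
theorem Inv.exponent_le (h : X.Inv W st) (hX : X.Proper N sm) {j : ℕ} (hj : j < X.m) :
    st.D j / X.C j ≤ 3 * sm := by
  have h₁ := h.log_le hX hj
  have hl := Real.log_two_gt_d9
  have h₂ : (st.K : ℝ) / (4 * st.β) ≤ 5 * sm / 4 := by
    -- For the initial guess β = 0 the quotient is 0 by convention.
    rcases Nat.eq_zero_or_pos st.β with hb | hb
    · rw [hb]
      simp
      positivity
    · have hb' : (0 : ℝ) < st.β := by exact_mod_cast hb
      rw [div_le_iff₀ (by positivity)]
      have := h.K_le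
      rw [hX.B_eq] at this
      have : (st.K : ℝ) ≤ 5 * sm * st.β := by exact_mod_cast this
      linarith
  have hs : (0 : ℝ) < sm := by exact_mod_cast hX.sm_pos
  have h₃ : ((st.D j / X.C j : ℕ) : ℝ) * Real.log 2 ≤ 3 * sm * Real.log 2 := by nlinarith
  have h₄ := le_of_mul_le_mul_right h₃ (by linarith)
  exact_mod_cast h₄

theorem Inv.D_le (h : X.Inv W st) (hX : X.Proper N sm) {j : ℕ} (hj : j < X.m) :
    st.D j ≤ X.C j * (3 * sm + 1) := by
  rcases Nat.eq_zero_or_pos (X.C j) with hC | hC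
  · simp [h.D_eq j hC]
  · have h₁ := h.exponent_le hX hj
    have h₂ := Nat.lt_mul_div_succ (st.D j) hC
    exact h₂.le.trans (Nat.mul_le_mul_left _ (by omega))

theorem IsCover.κ_le {F : Finset ℕ} (hF : X.IsCover W F) (hX : X.Proper N sm) {q u : ℕ}
    (hq : q < X.M) (hu : u < N) (hW : W q = some u) : X.κ u ≤ ∑ j ∈ F, X.C j := by
  obtain ⟨j, hj, hju⟩ := hF q hq u hW
  exact (hX.κ_le u hu j hju).trans (Finset.single_le_sum (f := X.C) (fun _ _ => Nat.zero_le _) hj)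

/-- A guess is given up only if it is too low. -/
theorem Inv.guess_lt (h : X.Inv W st) (hX : X.Proper N sm) {F : Finset ℕ}
    (hF : X.IsCover W F) (hFm : F ⊆ Finset.range X.m) {q u : ℕ} (hq : q < X.M) (hu : u < N)
    (hW : W q = some u) (hκ : X.κ u ≠ 0) (hK : X.B * st.β < st.K + X.κ u) :
    st.β ≤ ∑ j ∈ F, X.C j := by
  by_contra! hlt
  set c := ∑ j ∈ F, X.C j with hc
  have hκc : X.κ u ≤ c := hF.κ_le hX hq hu hW
  have hβ : 0 < st.β := by omega
  have hβ' : (0 : ℝ) < st.β := by exact_mod_cast hβ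
  have hl := Real.log_two_gt_d9
  have hl0 : 0 < Real.log 2 := by linarith
  have hs : (1 : ℝ) ≤ sm := by exact_mod_cast hX.sm_pos
  set κ' : ℝ := (st.K : ℝ) / (4 * st.β) with hκ'
  have hκ0 : 0 ≤ κ' := by positivity
  -- The potential bounds ⌊D_j/C_j⌋, and one more multiple of C_j compensates for the floor. Free
  -- sets carry no load.
  have h₁ : ∀ j ∈ F, (st.D j : ℝ) ≤ X.C j * (sm + κ' / Real.log 2 + 1) := by
    intro j hj
    rcases Nat.eq_zero_or_pos (X.C j) with hC | hC
    · simp [h.D_eq j hC, hC]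
    · have h₂ := h.log_le hX (Finset.mem_range.1 (hFm hj))
      have h₃ : ((st.D j / X.C j : ℕ) : ℝ) ≤ sm + κ' / Real.log 2 := by
        rw [← mul_le_mul_iff_left₀ hl0, add_mul, div_mul_cancel₀ _ hl0.ne']
        exact h₂
      have h₄ : (st.D j : ℝ) ≤ X.C j * (((st.D j / X.C j : ℕ) : ℝ) + 1) := by
        exact_mod_cast (Nat.lt_mul_div_succ (st.D j) hC).le
      exact h₄.trans (mul_le_mul_of_nonneg_left (by linarith) (by positivity))
  have h₂ : (st.K : ℝ) ≤ c * (sm + κ' / Real.log 2 + 1) := by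
    have h₃ : (st.K : ℝ) ≤ ∑ j ∈ F, (st.D j : ℝ) := by exact_mod_cast h.K_le_cover F hF
    refine (h₃.trans (Finset.sum_le_sum h₁)).trans (le_of_eq ?_)
    rw [← Finset.sum_mul, hc]
    push_cast
    rfl
  have hcb : (c : ℝ) ≤ st.β := by exact_mod_cast hlt.le
  -- From c < β one gets c·K/(4β) ≤ K/4, and 1.443/4 < 0.361, where 1.443 ≥ 1/log 2.
  have h₃ : (c : ℝ) * (κ' / Real.log 2) ≤ (st.K : ℝ) * (0.361) := by
    have e : κ' / Real.log 2 ≤ κ' * 1.443 := by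
      rw [div_le_iff₀ hl0]
      nlinarith
    have e' : (c : ℝ) * κ' ≤ st.K / 4 := by
      calc (c : ℝ) * κ' ≤ st.β * κ' := mul_le_mul_of_nonneg_right hcb hκ0
        _ = st.K / 4 := by
          rw [hκ']
          field_simp
    have hc0 : (0 : ℝ) ≤ c := by positivity
    have hk0 : (0 : ℝ) ≤ st.K := by positivity
    nlinarith
  -- Now 0.639·K ≤ c·(sm + 1) ≤ 2·sm·c, whereas K > 5·sm·β − c ≥ (5·sm − 1)·c ≥ 4·sm·c. The factor 5
  -- in `B` is large enough for a contradiction.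
  have hK' : 5 * sm * (st.β : ℝ) < st.K + X.κ u := by
    rw [hX.B_eq] at hK
    exact_mod_cast hK
  have hκc' : (X.κ u : ℝ) ≤ c := by exact_mod_cast hκc
  have hc1 : (1 : ℝ) ≤ c := by exact_mod_cast (by omega : 1 ≤ c)
  nlinarith

theorem Inv.next (h : X.Inv W st) (hq : st.q < X.M)
    (hm : ∀ u, W st.q = some u → ¬ X.Missed st u) : X.Inv W (next st) where
  K_le := h.K_le
  tot_le := h.tot_le
  pot_le := h.pot_le
  K_le_cover := h.K_le_cover
  β_le := h.β_le
  D_eq := h.D_eq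
  sv_sub := h.sv_sub
  sv_le := h.sv_le
  scanned := fun q hq' u hu => by
    rcases Nat.lt_succ_iff_lt_or_eq.1 hq' with h' | rfl
    · exact h.scanned q h' u hu
    · exact hm u hu
  q_le := hq

theorem Inv.sv_insert_le (h : X.Inv W st) {u : ℕ} (hu : W st.q = some u) :
    ∑ q ∈ insert st.q st.sv, (W q).elim 0 X.κ ≤ st.tot + X.κ u := by
  have h₁ := h.sv_le
  have h₂ : (W st.q).elim 0 X.κ = X.κ u := by simp [hu]
  by_cases hmem : st.q ∈ st.sv
  · rw [Finset.insert_eq_of_mem hmem]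
    omega
  · rw [Finset.sum_insert hmem]
    omega

theorem Inv.sv_insert_sub (h : X.Inv W st) (hq : st.q < X.M) {u : ℕ} (hu : W st.q = some u) :
    insert st.q st.sv ⊆ (Finset.range X.M).filter fun q => (W q).isSome := by
  refine Finset.insert_subset ?_ h.sv_sub
  simp [hq, hu]

/-- The part of a cover that lies among the available sets is a cover. -/
theorem IsCover.inter {F : Finset ℕ} (hF : X.IsCover W F) (hX : X.Proper N sm) :
    X.IsCover W (F ∩ Finset.range X.m) := fun q hq u hu => by
  obtain ⟨j, hj, hju⟩ := hF q hq u hu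
  exact ⟨j, Finset.mem_inter.2 ⟨hj, hX.sets_sub u hju⟩, hju⟩

/-- If the guess is kept, the potential grows at most by the factor 1 + κ/(4β) ≤ exp(κ/(4β)), and
every cover contains a set whose load rises by κ. If it is given up, both β and κ are at most the
cost of any cover, which bounds the new guess; the old payments form a geometric sum. -/
theorem Inv.event (h : X.Inv W st) (hX : X.Proper N sm) (hN : ∀ q u, W q = some u → u < N)
    (hq : st.q < X.M) {u : ℕ} (hu : W st.q = some u) (hm : X.Missed st u) :
    X.Inv W (X.event st u) := by
  have huN := hN _ _ hu
  have hκ := hm.1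
  unfold Learner.event
  split
  case isTrue hK =>
    have hβ : 0 < st.β := by
      rcases Nat.eq_zero_or_pos st.β with hb | hb
      · rw [hb] at hK
        omega
      · exact hb
    have hβ' : (0 : ℝ) < st.β := by exact_mod_cast hβ
    refine ⟨hK, ?_, ?_, ?_, h.β_le, ?_, h.sv_insert_sub hq hu, h.sv_insert_le hu, ?_,
      Nat.zero_le _⟩
    · have := h.tot_le
      simp only
      omega
    · set Ψ := ∑ j ∈ Finset.range X.m, pot (X.C j) (st.D j) with hΨ
      have h₁ : ∑ j ∈ Finset.range X.m,
          pot (X.C j) (if j ∈ X.sets u then st.D j + X.κ u else st.D j) ≤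
          Ψ + ∑ j ∈ X.sets u, 2 * (2 : ℝ) ^ (st.D j / X.C j) * X.κ u / X.C j := by
        have e := Finset.sum_ite_mem (Finset.range X.m) (X.sets u)
          fun j => 2 * (2 : ℝ) ^ (st.D j / X.C j) * X.κ u / X.C j
        rw [Finset.inter_eq_right.2 (hX.sets_sub u)] at e
        rw [← e, hΨ, ← Finset.sum_add_distrib]
        refine Finset.sum_le_sum fun j hj => ?_
        split
        case isTrue hj' => exact pot_add_le (hX.C_pos huN hκ hj') (hX.κ_le u huN j hj')
        case isFalse => simp
      have h₂ := hX.missed_le huN hm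
      have h₃ : (X.total st : ℝ) ≤ Ψ := by
        rw [hΨ]
        unfold total pw
        push_cast
        exact Finset.sum_le_sum fun j _ => pow_le_pot _ _
      have h₄ : ∑ j ∈ X.sets u, 2 * (2 : ℝ) ^ (st.D j / X.C j) * X.κ u / X.C j =
          2 * X.κ u * ∑ j ∈ X.sets u, (2 : ℝ) ^ (st.D j / X.C j) / X.C j := by
        rw [Finset.mul_sum]
        exact Finset.sum_congr rfl fun j _ => by ring
      set w := ∑ j ∈ X.sets u, (2 : ℝ) ^ (st.D j / X.C j) / X.C j
      have h₅ : 2 * (X.κ u : ℝ) * w ≤ Ψ * (X.κ u / (4 * st.β)) := by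
        have : w ≤ Ψ / (8 * st.β) := by
          rw [le_div_iff₀ (by positivity)]
          linarith
        calc 2 * (X.κ u : ℝ) * w ≤ 2 * X.κ u * (Ψ / (8 * st.β)) :=
              mul_le_mul_of_nonneg_left this (by positivity)
          _ = _ := by
            field_simp
            ring
      have hΨ0 : 0 ≤ Ψ := le_trans (by positivity) h₃
      calc _ ≤ Ψ + 2 * X.κ u * w := by rw [← h₄]; exact h₁
        _ ≤ Ψ * (X.κ u / (4 * st.β) + 1) := by linarith
        _ ≤ Ψ * Real.exp (X.κ u / (4 * st.β)) :=
          mul_le_mul_of_nonneg_left (Real.add_one_le_exp _) hΨ0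
        _ ≤ X.m * Real.exp (st.K / (4 * st.β)) * Real.exp (X.κ u / (4 * st.β)) :=
          mul_le_mul_of_nonneg_right h.pot_le (Real.exp_pos _).le
        _ = _ := by
          rw [mul_assoc, ← Real.exp_add, ← add_div]
          push_cast
          rfl
    · intro F hF
      obtain ⟨j, hj, hju⟩ := hF _ hq u hu
      simp only
      calc st.K + X.κ u ≤ ∑ j ∈ F, st.D j + X.κ u := Nat.add_le_add_right (h.K_le_cover F hF) _
        _ ≤ ∑ j ∈ F, st.D j + ∑ j ∈ F, (if j ∈ X.sets u then X.κ u else 0) := by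
          refine Nat.add_le_add_left ?_ _
          refine le_trans (le_of_eq ?_) (Finset.single_le_sum
            (f := fun j => if j ∈ X.sets u then X.κ u else 0) (fun _ _ => Nat.zero_le _) hj)
          simp [hju]
        _ = _ := by
          rw [← Finset.sum_add_distrib]
          refine Finset.sum_congr rfl fun j _ => ?_
          split <;> simp
    · intro j hj
      have : j ∉ X.sets u := fun hju => by
        have := hX.C_pos huN hκ hju
        omega
      simp [this, h.D_eq j hj]
    · intro q hq
      exact absurd hq (Nat.not_lt_zero _)
  case isFalse hK =>
    refine ⟨Nat.zero_le _, ?_, ?_, fun F _ => Nat.zero_le _, ?_, fun _ _ => rfl,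
      h.sv_insert_sub hq hu, h.sv_insert_le hu, ?_, Nat.zero_le _⟩
    · have h₁ := h.tot_le
      have h₂ := h.K_le
      simp only
      -- Here b = max(β, κ u), and the old total (B + 1)β + Bβ together with κ u fits into (B +
      -- 1)·2b.
      set b := st.β + (X.κ u - st.β) with hb
      have h₃ : (X.B + 1) * st.β ≤ (X.B + 1) * b := Nat.mul_le_mul_left _ (by omega)
      have h₄ : X.B * st.β ≤ X.B * b := Nat.mul_le_mul_left _ (by omega)
      have h₅ : X.κ u ≤ b := by omega
      have h₆ : (X.B + 1) * (2 * b) = (X.B + 1) * b + (X.B * b + b) := by ring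
      omega
    · simp [pot]
    · intro F hF
      -- The potential controls only the loads of indices below m, so the cover is first cut down to
      -- these.
      have hF' := hF.inter hX
      have h₁ := h.guess_lt hX hF' Finset.inter_subset_right hq huN hu hκ (by omega)
      have h₂ := hF'.κ_le hX hq huN hu
      have h₃ : ∑ j ∈ F ∩ Finset.range X.m, X.C j ≤ ∑ j ∈ F, X.C j :=
        Finset.sum_le_sum_of_subset Finset.inter_subset_left
      simp only
      omega
    · intro q hq
      exact absurd hq (Nat.not_lt_zero _)

theorem Inv.step (h : X.Inv W st) (hX : X.Proper N sm) (hN : ∀ q u, W q = some u → u < N) :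
    X.Inv W (X.step W st) := by
  rcases X.step_cases W st with ⟨_, h'⟩ | ⟨hq, hm, h'⟩ | ⟨hq, u, hu, hm, h'⟩
  · rwa [h']
  · rw [h']
    exact h.next hq hm
  · rw [h']
    exact h.event hX hN hq hu hm

theorem inv_run (hX : X.Proper N sm) (hN : ∀ q u, W q = some u → u < N) (T : ℕ) :
    X.Inv W (X.run W T) := by
  induction T with
  | zero => exact inv_init
  | succ T ih =>
    rw [run_succ]
    exact ih.step hX hN

theorem Proper.isCover_range (hX : X.Proper N sm) (hN : ∀ q u, W q = some u → u < N) :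
    X.IsCover W (Finset.range X.m) := fun q _ u hu => by
  obtain ⟨j, hj, _⟩ := hX.exists_le u (hN q u hu)
  exact ⟨j, hX.sets_sub u hj, hj⟩

/-! #### Termination -/

/-- A bound for the remaining number of steps. -/
def meas (X : Learner) (sm : ℕ) (st : LearnerState) : ℕ :=
  ((Nat.size (2 * ∑ j ∈ Finset.range X.m, X.C j) - Nat.size st.β) * (X.m * (3 * sm) + 1) +
    (X.m * (3 * sm) - ∑ j ∈ Finset.range X.m, st.D j / X.C j)) * (X.M + 1) + (X.M - st.q)

theorem Inv.sum_exponent_le (h : X.Inv W st) (hX : X.Proper N sm) :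
    ∑ j ∈ Finset.range X.m, st.D j / X.C j ≤ X.m * (3 * sm) := by
  refine (Finset.sum_le_sum fun j hj => h.exponent_le hX (Finset.mem_range.1 hj)).trans ?_
  simp

theorem size_lt_size_two_mul {a b : ℕ} (h : a ≤ b) (hb : 0 < b) :
    Nat.size a < Nat.size (2 * b) := by
  have : Nat.size (2 * b) = Nat.size b + 1 := by
    have := Nat.size_bit (b := false) (n := b) (by simp [Nat.bit]; omega)
    simpa [Nat.bit] using this
  rw [this]
  exact Nat.lt_succ_of_le (Nat.size_le_size h)

/-- The measure is lexicographic. Giving up a guess lengthens β, which stays below twice the sum of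
all costs. A payment under the same guess raises the exponent of a cheapest set containing u by at
least one, because its cost is κ u, and the exponents are bounded. All other steps advance the scan.
-/
theorem Inv.meas_lt (h : X.Inv W st) (hX : X.Proper N sm) (hN : ∀ q u, W q = some u → u < N)
    (hq : st.q < X.M) : X.meas sm (X.step W st) < X.meas sm st := by
  have h' := h.step hX hN
  have hcov := hX.isCover_range hN
  rcases X.step_cases W st with ⟨hq', _⟩ | ⟨_, _, e⟩ | ⟨_, u, hu, hm, e⟩
  · omega
  · rw [e]
    simp only [meas, Learner.next]
    omega
  · have hκ := hm.1
    have h₁ := h'.β_le _ hcov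
    have h₂ := h'.sum_exponent_le hX
    have key : ∀ a b q, a + 1 ≤ b → a * (X.M + 1) + (X.M - q) < b * (X.M + 1) + (X.M - st.q) := by
      intro a b q hab
      have : (a + 1) * (X.M + 1) ≤ b * (X.M + 1) := Nat.mul_le_mul_right _ hab
      rw [add_mul, one_mul] at this
      omega
    rw [e] at h₁ h₂ ⊢
    unfold meas
    refine key _ _ _ ?_
    unfold Learner.event at h₁ h₂ ⊢
    split at h₁
    case isTrue hK =>
      simp only [hK, if_true] at h₂ ⊢
      obtain ⟨j, hj, hjC⟩ := hX.exists_le u (hN _ _ hu)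
      have hC := hX.C_pos (hN _ _ hu) hκ hj
      have hlt : ∑ j ∈ Finset.range X.m, st.D j / X.C j < ∑ j ∈ Finset.range X.m,
          (if j ∈ X.sets u then st.D j + X.κ u else st.D j) / X.C j := by
        refine Finset.sum_lt_sum (fun i _ => Nat.div_le_div_right (by split <;> omega))
          ⟨j, hX.sets_sub u hj, ?_⟩
        rw [if_pos hj]
        calc st.D j / X.C j < st.D j / X.C j + 1 := Nat.lt_succ_self _
          _ = (st.D j + X.C j) / X.C j := (Nat.add_div_right _ hC).symm
          _ ≤ _ := Nat.div_le_div_right (by omega)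
      omega
    case isFalse hK =>
      simp only [hK, if_false] at h₂ ⊢
      have hs : Nat.size st.β < Nat.size (2 * (st.β + (X.κ u - st.β))) :=
        size_lt_size_two_mul (by omega) (by omega)
      have hs' := Nat.size_le_size h₁
      simp only [Nat.zero_div, Finset.sum_const_zero, Nat.sub_zero]
      set x := Nat.size (2 * ∑ j ∈ Finset.range X.m, X.C j)
      set y := Nat.size (2 * (st.β + (X.κ u - st.β)))
      have : (x - y + 1) * (X.m * (3 * sm) + 1) ≤ (x - Nat.size st.β) * (X.m * (3 * sm) + 1) :=
        Nat.mul_le_mul_right _ (by omega)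
      rw [add_mul, one_mul] at this
      omega

/-- The state in which the learner stops. -/
noncomputable def final (X : Learner) (sm : ℕ) (W : ℕ → Option ℕ) : LearnerState :=
  X.run W (X.meas sm init)

theorem final_done (hX : X.Proper N sm) (hN : ∀ q u, W q = some u → u < N) :
    X.M ≤ (X.final sm W).q := by
  have H : ∀ T, X.M ≤ (X.run W T).q ∨ T + X.meas sm (X.run W T) ≤ X.meas sm init := by
    intro T
    induction T with
    | zero =>
      right
      rw [zero_add]
      rfl
    | succ T ih =>
      rcases le_or_gt X.M (X.run W T).q with h | h
      · left
        rw [run_succ, step_of_le h]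
        exact h
      · right
        have h₁ := ih.resolve_left h.not_ge
        have h₂ := (inv_run hX hN T).meas_lt hX hN h
        rw [run_succ]
        omega
  by_contra! hlt
  have h₁ := (H (X.meas sm init)).resolve_left hlt.not_ge
  have h₂ := (inv_run hX hN (X.meas sm init)).meas_lt hX hN hlt
  omega

theorem inv_final (hX : X.Proper N sm) (hN : ∀ q u, W q = some u → u < N) :
    X.Inv W (X.final sm W) := inv_run hX hN _

/-- The scan restarts after each payment, so its completion certifies every sample for the final
weights. -/
theorem final_not_missed (hX : X.Proper N sm) (hN : ∀ q u, W q = some u → u < N) {q u : ℕ}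
    (hq : q < X.M) (hu : W q = some u) : ¬ X.Missed (X.final sm W) u :=
  (inv_final hX hN).scanned q (hq.trans_le (final_done hX hN)) u hu

open Classical in
/-- Leave-one-out bound: the cost of the samples that are missed if the learner does not see
them. -/
theorem leave_one_out (hX : X.Proper N sm) (hN : ∀ q u, W q = some u → u < N) {F : Finset ℕ}
    (hF : X.IsCover W F) :
    ∑ q ∈ Finset.range X.M, (W q).elim 0 (fun u =>
      if X.Missed (X.final sm (Function.update W q none)) u then X.κ u else 0) ≤
    (4 * X.B + 2) * ∑ j ∈ F, X.C j := by
  have hi := inv_final hX hN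
  set st := X.final sm W with hst
  have h₁ : ∀ q ∈ Finset.range X.M, ((W q).elim 0 (fun u =>
      if X.Missed (X.final sm (Function.update W q none)) u then X.κ u else 0)) ≤
      if q ∈ st.sv then (W q).elim 0 X.κ else 0 := by
    intro q hq
    rcases hW : W q with _ | u
    · simp
    · simp only [Option.elim_some]
      split
      case isTrue h =>
        rw [if_pos]
        -- If q was never paid for, its removal does not change the run; but the final state of the
        -- full run misses none of its samples.
        by_contra hsv
        refine final_not_missed hX hN (Finset.mem_range.1 hq) hW ?_
        rwa [final, run_remove _ hsv] at h
      case isFalse => exact Nat.zero_le _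
  refine (Finset.sum_le_sum h₁).trans ?_
  rw [← Finset.sum_filter]
  have h₂ : (Finset.range X.M).filter (· ∈ st.sv) = st.sv := by
    ext q
    simp only [Finset.mem_filter, Finset.mem_range, and_iff_right_iff_imp]
    intro hq
    have := hi.sv_sub hq
    simp only [Finset.mem_filter, Finset.mem_range] at this
    exact this.1
  rw [h₂]
  -- The total is at most (B + 1)β + K ≤ (2B + 1)β, and β ≤ 2c(F).
  refine hi.sv_le.trans (hi.tot_le.trans ?_)
  have h₃ := hi.K_le
  have h₄ := Nat.mul_le_mul_left (2 * X.B + 1) (hi.β_le F hF)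
  have h₅ : (X.B + 1) * st.β + X.B * st.β = (2 * X.B + 1) * st.β := by ring
  have h₆ : (2 * X.B + 1) * (2 * ∑ j ∈ F, X.C j) = (4 * X.B + 2) * ∑ j ∈ F, X.C j := by ring
  omega

end Learner

/-! ### The program

Arrays: 7 scaled costs, 8 sides of the samples, 9 random numbers, 11 cheapest sets, 12 loads,
13 weights, 14 selected sets. Variables: 20 size of `m`, 21 size of the number of samples, 22 range
of the random numbers, 23 common denominator, 30 to 32 state of the learner, 33 and 34 sums,
35 number of samples; the others are counters. -/

namespace Program

open Expr

/-- Entry of the incidence matrix for the element `u` and the current set. -/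
def inc (u j : Expr) : Expr := .get 1 (.add (.mul u (.get 0 (.const 1))) j)

def size (x c : ℕ) (e : Expr) : Program :=
  .seq (.set x e) (.seq (.set c (.const 0))
    (.loop (.var x) (.seq (.set x (.div (.var x) (.const 2)))
      (.set c (.add (.var c) (.const 1))))))

/-- Sum of the weights. -/
def sumWeights : Program :=
  .seq (.set 34 (.const 0))
    (.for 27 (.get 0 (.const 1)) (.set 34 (.add (.var 34) (.get 13 (.var 27)))))

/-- Scaled value of the current set in the fractional cover. -/
def frac : Expr :=
  .div (.mul (.mul (.mul (.const 16) (.get 0 (.const 1))) (.var 30)) (.get 13 (.var 27)))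
    (.get 7 (.var 27))

/-- The current sample and its cost. -/
def sample : Expr := .get 4 (.var 32)

def price : Expr := .get 7 (.get 11 sample)

/-- Coverage of the current sample. -/
def sumCover : Program :=
  .seq (.set 33 (.const 0))
    (.for 27 (.get 0 (.const 1)) (.ite (inc sample (.var 27))
      (.set 33 (.add (.var 33) frac)) .skip))

def reset : Program :=
  .for 27 (.get 0 (.const 1)) (.seq (.store 12 (.var 27) (.const 0))
    (.store 13 (.var 27) (.const 1)))

/-- There is no exponentiation: a weight is multiplied by one plus the increase of its exponent. It
is updated before the load because the old exponent is needed. -/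
def reload : Program :=
  .for 27 (.get 0 (.const 1)) (.ite (inc sample (.var 27))
    (.seq (.store 13 (.var 27) (.mul (.get 13 (.var 27)) (.add (.const 1)
        (.sub (.div (.add (.get 12 (.var 27)) price) (.get 7 (.var 27)))
          (.div (.get 12 (.var 27)) (.get 7 (.var 27)))))))
      (.store 12 (.var 27) (.add (.get 12 (.var 27)) price))) .skip)

/-- What happens when the current sample is missed. -/
def pay : Program :=
  .ite (.sub (.add (.var 31) price) (.mul (.mul (.const 5) (.var 20)) (.var 30)))
    (.seq (.set 30 (.mul (.const 2) (.add (.var 30) (.sub price (.var 30)))))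
      (.seq (.set 31 (.const 0)) (.seq reset (.set 32 (.const 0)))))
    (.seq (.set 31 (.add (.var 31) price)) (.seq reload (.set 32 (.const 0))))

def scanNext : Program := .set 32 (.add (.var 32) (.const 1))

/-- One step of the learner on the samples of the side stored in variable 29. -/
def learnStep : Program :=
  .ite (.sub (.const 1) (.add (.sub (.get 8 (.var 32)) (.var 29))
      (.sub (.var 29) (.get 8 (.var 32)))))
    (.seq sumWeights (.seq sumCover
      (.ite (.mul price (.sub (.mul (.get 0 (.const 1)) (.var 34)) (.var 33))) pay scanNext)))
    scanNext

def learn : Program :=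
  .seq (.set 30 (.const 0)) (.seq (.set 31 (.const 0)) (.seq reset (.seq (.set 32 (.const 0))
    (.loop (.sub (.var 35) (.var 32)) learnStep))))

end Program

-- The program simulates the learner

attribute [simp] State.put_mem_of_ne State.put_mem_self State.put_coins

/-- The memory contains the data of the learner. -/
structure Env (X : Learner) (N sm : ℕ) (mem : Memory) : Prop where
  m_eq : mem 0 1 = X.m
  M_eq : mem 35 0 = X.M
  sm_eq : mem 20 0 = sm
  sets_iff : ∀ u < N, ∀ j < X.m, mem 1 (u * X.m + j) ≠ 0 ↔ j ∈ X.sets u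
  C_eq : ∀ j < X.m, mem 7 j = X.C j
  κ_eq : ∀ u < N, mem 7 (mem 11 u) = X.κ u
  smp_lt : ∀ q < X.M, mem 4 q < N

/-- Words of `S` bits and `Φ` iterations suffice for the learner. -/
structure Enough (X : Learner) (sm S Φ : ℕ) : Prop where
  one_le : 1 ≤ S
  m_le : X.m ≤ Φ
  m_lt : X.m < 2 ^ S
  M_lt : X.M < 2 ^ S
  meas_le : X.meas sm Learner.init ≤ Φ
  lt : 16 * X.m ^ 2 * (2 * (∑ j ∈ Finset.range X.m, X.C j) + 1) * 2 ^ (3 * sm) * (5 * sm + 1)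
    < 2 ^ S

theorem Env.of_eq {X : Learner} {N sm : ℕ} {mem mem' : Memory} (h : Env X N sm mem)
    (he : ∀ a ∈ [0, 1, 4, 7, 11, 20, 35], mem' a = mem a) : Env X N sm mem' := by
  simp only [List.mem_cons, List.not_mem_nil, or_false, forall_eq_or_imp, forall_eq] at he
  obtain ⟨h₁, h₂, h₃, h₄, h₅, h₆, h₇⟩ := he
  constructor
  · rw [h₁, h.m_eq]
  · rw [h₇, h.M_eq]
  · rw [h₆, h.sm_eq]
  · rw [h₂]; exact h.sets_iff
  · rw [h₄]; exact h.C_eq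
  · rw [h₄, h₅]; exact h.κ_eq
  · rw [h₃]; exact h.smp_lt

theorem Env.same {X : Learner} {N sm : ℕ} {s s' : State} {P : Program} (h : Env X N sm s.mem)
    (hs : P.Same s s') (hP : ∀ a ∈ [0, 1, 4, 7, 11, 20, 35], P.touches a = false) :
    Env X N sm s'.mem :=
  h.of_eq fun a ha => hs.1 a (hP a ha)

theorem Env.put {X : Learner} {N sm : ℕ} {s : State} {a i v : ℕ} (h : Env X N sm s.mem)
    (ha : a ∉ [0, 1, 4, 7, 11, 20, 35]) : Env X N sm (s.put a i v).mem :=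
  h.of_eq fun _ hb => State.put_mem_of_ne fun hab => ha (hab ▸ hb)

namespace Spec

variable {S Φ : ℕ} {X : Learner} {N sm : ℕ} {s : State}

theorem sumWeights (hE : Env X N sm s.mem) (hB : Enough X sm S Φ)
    (hlt : ∑ j ∈ Finset.range X.m, s.mem 13 j < 2 ^ S) :
    Spec S Φ .sumWeights s (fun s' => s'.mem 34 0 = ∑ j ∈ Finset.range X.m, s.mem 13 j) := by
  have hS := hB.one_le
  refine Spec.store_seq hS (fun _ => by simp [Expr.eval]) ?_
  refine Spec.for hS X.m (Nat.size_le.2 hB.m_lt) hB.m_le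
    (fun i s' => s'.mem 34 0 = ∑ j ∈ Finset.range i, s.mem 13 j) (by decide) ?_ ?_ ?_
  · intro s' hs
    simp [Expr.eval, hs.1 0 (by decide), hE.m_eq]
  · simp [Expr.eval]
  · intro i s' hi _ hs hx hInv
    have h13 : s'.mem 13 = s.mem 13 := by simp [hs.1 13 (by decide)]
    refine Spec.store hS (fun _ => ?_) ?_
    · simp only [Expr.eval, Expr.var, hx, hInv, h13, ← Finset.sum_range_succ]
      rw [Nat.size_le]
      exact (Finset.sum_le_sum_of_subset (Finset.range_mono hi)).trans_lt hlt
    · simp [Expr.eval, Expr.var, hx, hInv, h13, Finset.sum_range_succ]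

end Spec

/-- The memory contains the state of the learner. -/
structure Holds (X : Learner) (st : LearnerState) (mem : Memory) : Prop where
  β_eq : mem 30 0 = st.β
  K_eq : mem 31 0 = st.K
  q_eq : mem 32 0 = st.q
  D_eq : ∀ j < X.m, mem 12 j = st.D j
  pw_eq : ∀ j < X.m, mem 13 j = X.pw st j

theorem Holds.of_eq {X : Learner} {st : LearnerState} {mem mem' : Memory} (h : Holds X st mem)
    (he : ∀ a ∈ [30, 31, 32, 12, 13], mem' a = mem a) : Holds X st mem' := by
  simp only [List.mem_cons, List.not_mem_nil, or_false, forall_eq_or_imp, forall_eq] at he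
  obtain ⟨h₁, h₂, h₃, h₄, h₅⟩ := he
  exact ⟨by rw [h₁, h.β_eq], by rw [h₂, h.K_eq], by rw [h₃, h.q_eq], by rw [h₄]; exact h.D_eq,
    by rw [h₅]; exact h.pw_eq⟩

theorem Holds.same {X : Learner} {st : LearnerState} {s s' : State} {P : Program}
    (h : Holds X st s.mem) (hs : P.Same s s')
    (hP : ∀ a ∈ [30, 31, 32, 12, 13], P.touches a = false) : Holds X st s'.mem :=
  h.of_eq fun a ha => hs.1 a (hP a ha)

/-- Every number stored by the learner is bounded by a product of 16m², a guess or cost, a weight,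
and a multiple of sm, so the single inequality `Enough.lt` serves for all of them. -/
theorem Enough.size_le {X : Learner} {sm S Φ v : ℕ} (h : Enough X sm S Φ) (a b c : ℕ)
    (ha : a ≤ 2 * (∑ j ∈ Finset.range X.m, X.C j) + 1) (hb : b ≤ 2 ^ (3 * sm))
    (hc : c ≤ 5 * sm + 1) (hv : v ≤ 16 * X.m ^ 2 * a * b * c) : Nat.size v ≤ S := by
  rw [Nat.size_le]
  refine lt_of_le_of_lt (hv.trans ?_) h.lt
  gcongr

theorem Enough.size_le' {X : Learner} {sm S Φ v : ℕ} (h : Enough X sm S Φ) (hm : 0 < X.m)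
    (a b c : ℕ) (ha : a ≤ 2 * (∑ j ∈ Finset.range X.m, X.C j) + 1) (hb : b ≤ 2 ^ (3 * sm))
    (hc : c ≤ 5 * sm + 1) (hv : v ≤ a * b * c) : Nat.size v ≤ S := by
  refine h.size_le a b c ha hb hc (hv.trans ?_)
  have : 1 ≤ 16 * X.m ^ 2 := by
    have := Nat.pow_pos (n := 2) hm
    omega
  calc a * b * c = 1 * (a * b * c) := (one_mul _).symm
    _ ≤ 16 * X.m ^ 2 * (a * b * c) := Nat.mul_le_mul_right _ this
    _ = _ := by ring

namespace Learner

variable {X : Learner} {N sm S Φ : ℕ} {W : ℕ → Option ℕ} {st : LearnerState}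

theorem Inv.β_le_sum (h : X.Inv W st) (hX : X.Proper N sm) (hN : ∀ q u, W q = some u → u < N) :
    st.β ≤ 2 * (∑ j ∈ Finset.range X.m, X.C j) + 1 :=
  (h.β_le _ (hX.isCover_range hN)).trans (Nat.le_succ _)

theorem Inv.size_β (h : X.Inv W st) (hX : X.Proper N sm) (hN : ∀ q u, W q = some u → u < N)
    (hB : Enough X sm S Φ) : Nat.size st.β ≤ S :=
  hB.size_le' hX.m_pos st.β 1 1 (h.β_le_sum hX hN) Nat.one_le_two_pow (by omega) (by omega)

theorem Inv.size_K (h : X.Inv W st) (hX : X.Proper N sm) (hN : ∀ q u, W q = some u → u < N)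
    (hB : Enough X sm S Φ) : Nat.size st.K ≤ S :=
  hB.size_le' hX.m_pos st.β 1 (5 * sm) (h.β_le_sum hX hN) Nat.one_le_two_pow (by omega) (by
    have := h.K_le
    rw [hX.B_eq] at this
    rw [mul_one, mul_comm]
    exact this)

theorem Inv.pw_le (h : X.Inv W st) (hX : X.Proper N sm) {j : ℕ} (hj : j < X.m) :
    X.pw st j ≤ 2 ^ (3 * sm) :=
  Nat.pow_le_pow_right (by norm_num) (h.exponent_le hX hj)

theorem Inv.size_D (h : X.Inv W st) (hX : X.Proper N sm) (hB : Enough X sm S Φ) {j : ℕ}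
    (hj : j < X.m) : Nat.size (st.D j) ≤ S :=
  hB.size_le' hX.m_pos (X.C j) 1 (3 * sm + 1) (by
    have := Finset.single_le_sum (f := X.C) (fun _ _ => Nat.zero_le _) (Finset.mem_range.2 hj)
    omega) Nat.one_le_two_pow (by omega) (by simpa using h.D_le hX hj)

theorem Inv.size_pw (h : X.Inv W st) (hX : X.Proper N sm) (hB : Enough X sm S Φ) {j : ℕ}
    (hj : j < X.m) : Nat.size (X.pw st j) ≤ S :=
  hB.size_le' hX.m_pos 1 (2 ^ (3 * sm)) 1 (by omega) le_rfl (by omega) (by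
    simpa using h.pw_le hX hj)

theorem Inv.total_le (h : X.Inv W st) (hX : X.Proper N sm) :
    X.total st ≤ X.m * 2 ^ (3 * sm) := by
  refine (Finset.sum_le_sum fun j hj => h.pw_le hX (Finset.mem_range.1 hj)).trans ?_
  simp

theorem Inv.total_lt (h : X.Inv W st) (hX : X.Proper N sm) (hB : Enough X sm S Φ) :
    X.total st < 2 ^ S := by
  rw [← Nat.size_le]
  refine hB.size_le 1 (2 ^ (3 * sm)) 1 (by omega) le_rfl (by omega) ?_
  have h₁ := h.total_le hX
  have h₂ : X.m ≤ 16 * X.m ^ 2 := by nlinarith [hX.m_pos]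
  calc X.total st ≤ X.m * 2 ^ (3 * sm) := h₁
    _ ≤ 16 * X.m ^ 2 * 2 ^ (3 * sm) := Nat.mul_le_mul_right _ h₂
    _ = _ := by ring

theorem Inv.size_sum_wt (h : X.Inv W st) (hX : X.Proper N sm)
    (hN : ∀ q u, W q = some u → u < N) (hB : Enough X sm S Φ) :
    Nat.size (∑ j ∈ Finset.range X.m, X.wt st j) ≤ S := by
  refine hB.size_le st.β (2 ^ (3 * sm)) 1 (h.β_le_sum hX hN) le_rfl (by omega) ?_
  have : ∀ j ∈ Finset.range X.m, X.wt st j ≤ 16 * X.m * st.β * 2 ^ (3 * sm) := fun j hj =>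
    (Nat.div_le_self _ _).trans (Nat.mul_le_mul_left _ (h.pw_le hX (Finset.mem_range.1 hj)))
  refine (Finset.sum_le_sum this).trans (le_of_eq ?_)
  simp
  ring

/-- As κ ≤ C, the exponent grows by 0 or 1, and 1 + 0 = 2^0, 1 + 1 = 2^1. -/
theorem two_pow_div_mul {C D κ : ℕ} (hC : 0 < C) (hκ : κ ≤ C) :
    2 ^ (D / C) * (1 + ((D + κ) / C - D / C)) = 2 ^ ((D + κ) / C) := by
  have h₁ : D / C ≤ (D + κ) / C := Nat.div_le_div_right (by omega)
  have h₂ : (D + κ) / C ≤ D / C + 1 := by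
    rw [← Nat.add_div_right _ hC]
    exact Nat.div_le_div_right (by omega)
  rcases Nat.lt_or_ge (D / C) ((D + κ) / C) with h | h
  · have : (D + κ) / C = D / C + 1 := by omega
    rw [this, pow_succ]
    simp
  · have : (D + κ) / C = D / C := by omega
    simp [this]

end Learner

namespace Spec

variable {S Φ : ℕ} {X : Learner} {N sm : ℕ} {s : State} {W : ℕ → Option ℕ} {st : LearnerState}

theorem eval_price {mem : Memory} (hE : Env X N sm mem) (hq : mem 32 0 < X.M) :
    Program.price.eval mem = X.κ (mem 4 (mem 32 0)) :=
  hE.κ_eq _ (hE.smp_lt _ hq)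

theorem eval_inc {mem : Memory} (hE : Env X N sm mem) (hq : mem 32 0 < X.M)
    (hj : mem 27 0 < X.m) :
    (Program.inc Program.sample (.var 27)).eval mem ≠ 0 ↔
      mem 27 0 ∈ X.sets (mem 4 (mem 32 0)) := by
  rw [← hE.sets_iff _ (hE.smp_lt _ hq) _ hj]
  simp [Program.inc, Program.sample, Expr.eval, Expr.var, hE.m_eq]

theorem eval_frac {mem : Memory} (hE : Env X N sm mem) (hH : Holds X st mem)
    (hj : mem 27 0 < X.m) : Program.frac.eval mem = X.wt st (mem 27 0) := by
  simp [Program.frac, Expr.eval, Expr.var, hE.m_eq, hH.β_eq, hH.pw_eq _ hj, hE.C_eq _ hj,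
    Learner.wt]

theorem sumCover (hE : Env X N sm s.mem) (hB : Enough X sm S Φ) (hX : X.Proper N sm)
    (hN : ∀ q u, W q = some u → u < N) (hI : X.Inv W st) (hH : Holds X st s.mem)
    (hq : st.q < X.M) :
    Spec S Φ .sumCover s (fun s' => s'.mem 33 0 =
      ∑ j ∈ X.sets (s.mem 4 st.q), X.wt st j) := by
  have hS := hB.one_le
  have hsum : ∀ i ≤ X.m, Nat.size (∑ j ∈ Finset.range i,
      if j ∈ X.sets (s.mem 4 st.q) then X.wt st j else 0) ≤ S := by
    intro i hi
    refine le_trans (Nat.size_le_size ?_) (hI.size_sum_wt hX hN hB)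
    refine (Finset.sum_le_sum fun j _ => ?_).trans
      (Finset.sum_le_sum_of_subset (Finset.range_mono hi))
    split
    · exact le_rfl
    · exact Nat.zero_le _
  refine Spec.store_seq hS (fun _ => by simp [Expr.eval]) ?_
  refine (Spec.for hS X.m (Nat.size_le.2 hB.m_lt) hB.m_le
    (fun i s' => s'.mem 33 0 = ∑ j ∈ Finset.range i,
      if j ∈ X.sets (s.mem 4 st.q) then X.wt st j else 0) (by decide) ?_ ?_ ?_).mono ?_
  · intro s' hs
    simp [Expr.eval, hs.1 0 (by decide), hE.m_eq]
  · simp [Expr.eval]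
  · intro i s' hi _ hs hx hInv
    have hE' := (hE.put (i := 0) (v := 0) (a := 33) (by decide)).same hs (by decide)
    have hH' : Holds X st s'.mem := (hH.of_eq (mem' := (s.put 33 0 0).mem) (by simp)).same hs
      (by decide)
    have h4 : s'.mem 4 = s.mem 4 := by simp [hs.1 4 (by decide)]
    have hi' := eval_inc hE' (by rwa [hH'.q_eq]) (by rwa [hx])
    rw [hx, hH'.q_eq, h4] at hi'
    refine Spec.ite hS (fun h => ?_) (fun h => ?_)
    · have hv : (Expr.add (.var 33) Program.frac).eval s'.mem = ∑ j ∈ Finset.range (i + 1),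
          if j ∈ X.sets (s.mem 4 st.q) then X.wt st j else 0 := by
        rw [Finset.sum_range_succ, if_pos (hi'.1 h), Expr.eval, eval_frac hE' hH' (by rwa [hx]),
          hx, Expr.var, Expr.eval, Expr.eval, hInv]
      refine Spec.store hS (fun _ => ?_) ?_
      · rw [hv]
        exact hsum _ hi
      · rw [hv]
        simp [Expr.eval]
    · refine Spec.skip ?_
      have : i ∉ X.sets (s.mem 4 st.q) := fun hm => hi'.2 hm h
      rw [Finset.sum_range_succ, if_neg this, add_zero]
      simpa using hInv
  · intro s' _ _ h
    rw [h, Finset.sum_ite_mem, Finset.inter_eq_right.2 (hX.sets_sub _)]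

theorem reset (hE : Env X N sm s.mem) (hB : Enough X sm S Φ) :
    Spec S Φ .reset s (fun s' => ∀ j < X.m, s'.mem 12 j = 0 ∧ s'.mem 13 j = 1) := by
  have hS := hB.one_le
  refine Spec.for hS X.m (Nat.size_le.2 hB.m_lt) hB.m_le
    (fun i s' => ∀ j < i, s'.mem 12 j = 0 ∧ s'.mem 13 j = 1) (by decide) ?_ ?_ ?_
  · intro s' hs
    simp [Expr.eval, hs.1 0 (by decide), hE.m_eq]
  · simp
  · intro i s' hi _ hs hx hInv
    refine Spec.store_seq hS (fun _ => by simp [Expr.eval]) ?_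
    refine Spec.store hS (fun _ => by simpa [Expr.eval] using hS) ?_
    intro j hj
    rcases Nat.lt_succ_iff_lt_or_eq.1 hj with hj | rfl
    · simp [Expr.eval, Expr.var, hx, Function.update_of_ne hj.ne, hInv j hj]
    · simp [Expr.eval, Expr.var, hx]

/-- Only arrays 12 and 13 are required to hold `st`, since the amount paid has already been
overwritten at this point. The invariant of the new state `st'` bounds the words about to be
written. -/
theorem reload (hE : Env X N sm s.mem) (hB : Enough X sm S Φ) (hX : X.Proper N sm)
    {st' : LearnerState} (hI : X.Inv W st') (hq : s.mem 32 0 < X.M)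
    (hκ : X.κ (s.mem 4 (s.mem 32 0)) ≠ 0)
    (hD : ∀ j < X.m, s.mem 12 j = st.D j) (hpw : ∀ j < X.m, s.mem 13 j = X.pw st j)
    (hst' : st'.D = fun j => if j ∈ X.sets (s.mem 4 (s.mem 32 0)) then
      st.D j + X.κ (s.mem 4 (s.mem 32 0)) else st.D j) :
    Spec S Φ .reload s (fun s' => ∀ j < X.m, s'.mem 12 j = st'.D j ∧ s'.mem 13 j = X.pw st' j) := by
  have hS := hB.one_le
  refine (Spec.for hS X.m (Nat.size_le.2 hB.m_lt) hB.m_le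
    (fun i s' => ∀ j < X.m, s'.mem 12 j = (if j < i then st'.D j else st.D j) ∧
      s'.mem 13 j = (if j < i then X.pw st' j else X.pw st j)) (by decide) ?_ ?_ ?_).mono ?_
  · intro s' hs
    simp [Expr.eval, hs.1 0 (by decide), hE.m_eq]
  · intro j hj
    simp [hD j hj, hpw j hj]
  · intro i s' hi _ hs hx hInv
    have hE' := hE.same hs (by decide)
    have h4 : s'.mem 4 = s.mem 4 := hs.1 4 (by decide)
    have h32 : s'.mem 32 = s.mem 32 := hs.1 32 (by decide)
    have hi' := eval_inc hE' (by rwa [h32]) (by rwa [hx])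
    have hp : Program.price.eval s'.mem = _ := eval_price hE' (by rwa [h32])
    rw [hx, h32, h4] at hi'
    rw [h32, h4] at hp
    have hi₁ := hInv i hi
    simp only [lt_irrefl, if_false] at hi₁
    refine Spec.ite hS (fun h => ?_) (fun h => ?_)
    · have hmem := hi'.1 h
      have huN : s.mem 4 (s.mem 32 0) < N := hE.smp_lt _ hq
      have hC := hX.C_pos huN hκ hmem
      have hD' : st'.D i = st.D i + X.κ (s.mem 4 (s.mem 32 0)) := by simp [hst', hmem]
      have hpw' : X.pw st' i = X.pw st i * (1 + ((st.D i + X.κ (s.mem 4 (s.mem 32 0))) / X.C i -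
          st.D i / X.C i)) := by
        rw [Learner.pw, Learner.pw, hD', Learner.two_pow_div_mul hC (hX.κ_le _ huN _ hmem)]
      have hv : (Expr.mul (.get 13 (.var 27)) (.add (.const 1)
        (.sub (.div (.add (.get 12 (.var 27)) Program.price) (.get 7 (.var 27)))
          (.div (.get 12 (.var 27)) (.get 7 (.var 27)))))).eval s'.mem = X.pw st' i := by
        simp only [Expr.eval, Expr.var, hx, hp, hi₁, hE'.C_eq i hi, hpw']
      refine Spec.store_seq hS (fun _ => by rw [hv]; exact hI.size_pw hX hB hi) ?_
      rw [hv]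
      have hx' : (Expr.var 27).eval s'.mem = i := hx
      rw [hx']
      have hp' : Program.price.eval (s'.put 13 i (X.pw st' i)).mem =
          X.κ (s.mem 4 (s.mem 32 0)) := by
        rw [eval_price (hE'.put (by decide)) (by simpa [h32] using hq)]
        simp [h4, h32]
      have hv' : (Expr.add (.get 12 (.var 27)) Program.price).eval
          (s'.put 13 i (X.pw st' i)).mem = st'.D i := by
        rw [Expr.eval, hp', hD']
        simp [Expr.eval, Expr.var, hx, hi₁]
      refine Spec.store hS (fun _ => by rw [hv']; exact hI.size_D hX hB hi) ?_
      rw [hv']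
      intro j hj
      by_cases hji : j = i
      · subst hji
        simp [Expr.eval, Expr.var, hx]
      · have h₁ : j < i + 1 ↔ j < i := by omega
        simp [Expr.eval, Expr.var, hx, Function.update_of_ne hji, hInv j hj, h₁]
    · refine Spec.skip ?_
      have hm : i ∉ X.sets (s.mem 4 (s.mem 32 0)) := fun hm => hi'.2 hm h
      have hD' : st'.D i = st.D i := by simp [hst', hm]
      intro j hj
      by_cases hji : j = i
      · subst hji
        simp [hi₁, hD', Learner.pw]
      · have h₁ : j < i + 1 ↔ j < i := by omega
        simp [hInv j hj, h₁]
  · intro s' _ _ h j hj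
    simpa [hj] using h j hj

theorem scanNext (hB : Enough X sm S Φ) (hH : Holds X st s.mem) (hq : st.q < X.M) :
    Spec S Φ .scanNext s (fun s' => Holds X (Learner.next st) s'.mem) := by
  refine Spec.store hB.one_le (fun _ => ?_) ?_
  · simp only [Expr.eval, Expr.var, hH.q_eq]
    exact (Nat.size_le_size hq).trans (Nat.size_le.2 hB.M_lt)
  · exact ⟨by simp [Learner.next, hH.β_eq], by simp [Learner.next, hH.K_eq],
      by simp [Learner.next, Expr.eval, Expr.var, hH.q_eq],
      fun j hj => by simp [Learner.next, hH.D_eq j hj],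
      fun j hj => by simp [hH.pw_eq j hj, Learner.pw, Learner.next]⟩

theorem pay (hE : Env X N sm s.mem) (hB : Enough X sm S Φ) (hX : X.Proper N sm)
    (hN : ∀ q u, W q = some u → u < N) (hI : X.Inv W st) (hH : Holds X st s.mem)
    (hq : st.q < X.M) (hW : W st.q = some (s.mem 4 st.q)) (hm : X.Missed st (s.mem 4 st.q)) :
    Spec S Φ .pay s (fun s' => Holds X (X.event st (s.mem 4 st.q)) s'.mem) := by
  have hS := hB.one_le
  have hI' := hI.event hX hN hq hW hm
  have hq' : s.mem 32 0 < X.M := by rwa [hH.q_eq]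
  have hp := eval_price hE hq'
  rw [hH.q_eq] at hp
  have hg : (Expr.sub (.add (.var 31) Program.price)
      (.mul (.mul (.const 5) (.var 20)) (.var 30))).eval s.mem =
      st.K + X.κ (s.mem 4 st.q) - X.B * st.β := by
    simp [Expr.eval, Expr.var, hp, hH.K_eq, hH.β_eq, hE.sm_eq, hX.B_eq]
  unfold Learner.event at hI' ⊢
  refine Spec.ite hS (fun h => ?_) (fun h => ?_) <;> rw [hg] at h
  · have hlt : ¬ st.K + X.κ (s.mem 4 st.q) ≤ X.B * st.β := by omega
    rw [if_neg hlt] at hI' ⊢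
    have hv : (Expr.mul (.const 2) (.add (.var 30) (.sub Program.price (.var 30)))).eval s.mem =
        2 * (st.β + (X.κ (s.mem 4 st.q) - st.β)) := by
      simp [Expr.eval, Expr.var, hp, hH.β_eq]
    refine Spec.store_seq hS (fun _ => by rw [hv]; exact hI'.size_β hX hN hB) ?_
    rw [hv]
    refine Spec.store_seq hS (fun _ => by simp [Expr.eval]) ?_
    refine Spec.seq (Spec.reset ((hE.put (by decide)).put (by decide)) hB) ?_
    intro s₁ _ hs₁ h₁
    refine Spec.store hS (fun _ => by simp [Expr.eval]) ?_
    exact ⟨by simp [hs₁.1 30 (by decide), Expr.eval], by simp [hs₁.1 31 (by decide), Expr.eval],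
      by simp [Expr.eval], fun j hj => by simp [h₁ j hj],
      fun j hj => by simp [h₁ j hj, Learner.pw]⟩
  · have hle : st.K + X.κ (s.mem 4 st.q) ≤ X.B * st.β := by omega
    rw [if_pos hle] at hI' ⊢
    have hv : (Expr.add (.var 31) Program.price).eval s.mem = st.K + X.κ (s.mem 4 st.q) := by
      simp [Expr.eval, Expr.var, hp, hH.K_eq]
    refine Spec.store_seq hS (fun _ => by rw [hv]; exact hI'.size_K hX hN hB) ?_
    rw [hv]
    refine Spec.seq (Spec.reload (st := st) (hE.put (by decide)) hB hX hI' (by simpa using hq')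
      (by simpa [hH.q_eq] using hm.1) (fun j hj => by simp [hH.D_eq j hj])
      (fun j hj => by simp [hH.pw_eq j hj]) (by simp [hH.q_eq])) ?_
    intro s₁ _ hs₁ h₁
    refine Spec.store hS (fun _ => by simp [Expr.eval]) ?_
    exact ⟨by simp [hs₁.1 30 (by decide), Expr.eval, hH.β_eq],
      by simp [hs₁.1 31 (by decide), Expr.eval],
      by simp [Expr.eval], fun j hj => by simp [h₁ j hj],
      fun j hj => by simp [h₁ j hj]⟩

theorem learnStep (hE : Env X N sm s.mem) (hB : Enough X sm S Φ) (hX : X.Proper N sm)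
    (hN : ∀ q u, W q = some u → u < N) (hI : X.Inv W st) (hH : Holds X st s.mem)
    (hq : st.q < X.M)
    (hW : ∀ q < X.M, W q = if s.mem 8 q = s.mem 29 0 then some (s.mem 4 q) else none) :
    Spec S Φ .learnStep s (fun s' => Holds X (X.step W st) s'.mem) := by
  have hS := hB.one_le
  -- Subtracting in both directions yields |x − y|, so the guard 1 − |x − y| tests equality.
  have hg : (Expr.sub (.const 1) (.add (.sub (.get 8 (.var 32)) (.var 29))
      (.sub (.var 29) (.get 8 (.var 32))))).eval s.mem ≠ 0 ↔ s.mem 8 st.q = s.mem 29 0 := by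
    simp only [Expr.eval, Expr.var, hH.q_eq]
    omega
  refine Spec.ite hS (fun h => ?_) (fun h => ?_)
  · have hWq : W st.q = some (s.mem 4 st.q) := by rw [hW _ hq, if_pos (hg.1 h)]
    have hsum : ∑ j ∈ Finset.range X.m, s.mem 13 j = X.total st :=
      Finset.sum_congr rfl fun j hj => hH.pw_eq j (Finset.mem_range.1 hj)
    refine Spec.seq (Spec.sumWeights hE hB (by rw [hsum]; exact hI.total_lt hX hB)) ?_
    intro s₁ _ hs₁ h₁
    rw [hsum] at h₁
    have hE₁ := hE.same hs₁ (by decide)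
    have hH₁ := hH.same hs₁ (by decide)
    refine Spec.seq (Spec.sumCover hE₁ hB hX hN hI hH₁ hq) ?_
    intro s₂ _ hs₂ h₂
    have hE₂ := hE₁.same hs₂ (by decide)
    have hH₂ := hH₁.same hs₂ (by decide)
    have h34 : s₂.mem 34 0 = X.total st := by rw [hs₂.1 34 (by decide), h₁]
    have e4 : s₁.mem 4 = s.mem 4 := hs₁.1 4 (by decide)
    have e4' : s₂.mem 4 = s.mem 4 := by rw [hs₂.1 4 (by decide), e4]
    rw [e4] at h₂
    have hp := eval_price hE₂ (by rwa [hH₂.q_eq])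
    rw [hH₂.q_eq, e4'] at hp
    have hmiss : (Expr.mul Program.price (.sub (.mul (.get 0 (.const 1)) (.var 34))
        (.var 33))).eval s₂.mem ≠ 0 ↔ X.Missed st (s.mem 4 st.q) := by
      simp only [Expr.eval, hp, Expr.var, h34, h₂, hE₂.m_eq, Learner.Missed]
      rw [mul_ne_zero_iff]
      exact and_congr_right fun _ => by omega
    refine Spec.ite hS (fun h' => ?_) (fun h' => ?_)
    · have hm := hmiss.1 h'
      rw [Learner.step_of_missed hq hWq hm]
      have := Spec.pay hE₂ hB hX hN hI hH₂ hq (by rw [e4']; exact hWq) (by rwa [e4'])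
      rwa [e4'] at this
    · have hm : ¬ X.Missed st (s.mem 4 st.q) := fun hm => hmiss.2 hm h'
      rw [Learner.step_of_not_missed hq hWq hm]
      exact Spec.scanNext hB hH₂ hq
  · have hWq : W st.q = none := by
      rw [hW _ hq, if_neg fun h' => hg.2 h' h]
    rw [Learner.step_of_none hq hWq]
    exact Spec.scanNext hB hH hq

theorem learn (hE : Env X N sm s.mem) (hB : Enough X sm S Φ) (hX : X.Proper N sm)
    (hN : ∀ q u, W q = some u → u < N)
    (hW : ∀ q < X.M, W q = if s.mem 8 q = s.mem 29 0 then some (s.mem 4 q) else none) :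
    Spec S Φ .learn s (fun s' => Holds X (X.final sm W) s'.mem) := by
  have hS := hB.one_le
  refine Spec.store_seq hS (fun _ => by simp [Expr.eval]) ?_
  refine Spec.store_seq hS (fun _ => by simp [Expr.eval]) ?_
  have hE₀ := (hE.put (a := 30) (i := 0) (v := 0) (by decide)).put (a := 31) (i := 0) (v := 0)
    (by decide)
  refine Spec.seq (Spec.reset hE₀ hB) ?_
  intro s₁ _ hs₁ h₁
  refine Spec.store_seq hS (fun _ => by simp [Expr.eval]) ?_
  have hE₁ := (hE₀.same hs₁ (by decide)).put (a := 32) (i := 0) (v := 0) (by decide)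
  have hH₁ : Holds X (X.run W 0) (s₁.put 32 0 0).mem :=
    ⟨by simp [hs₁.1 30 (by decide), Expr.eval, Learner.run, Learner.init],
      by simp [hs₁.1 31 (by decide), Expr.eval, Learner.run, Learner.init],
      by simp [Learner.run, Learner.init],
      fun j hj => by simp [h₁ j hj, Learner.run, Learner.init],
      fun j hj => by simp [h₁ j hj, Learner.run, Learner.init, Learner.pw]⟩
  -- The ghost value is the number T of learner steps already made.
  refine (Spec.loop hS (fun T => X.meas sm (X.run W T))
    (fun T s' => Holds X (X.run W T) s'.mem) 0 hH₁ hB.meas_le ?_).mono ?_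
  · intro T s₂ _ hs₂ hH₂ hne
    have hE₂ := hE₁.same hs₂ (by decide)
    have hq : (X.run W T).q < X.M := by
      simp only [Expr.eval, Expr.var, hE₂.M_eq, hH₂.q_eq] at hne
      omega
    have hI := Learner.inv_run hX hN T
    have e₂ : ∀ a ∈ [4, 8, 29], s₂.mem a = s.mem a := by
      simp [hs₂.1 4 (by decide), hs₂.1 8 (by decide), hs₂.1 29 (by decide),
        hs₁.1 4 (by decide), hs₁.1 8 (by decide), hs₁.1 29 (by decide)]
    refine (Spec.learnStep hE₂ hB hX hN hI hH₂ hq ?_).mono ?_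
    · rwa [e₂ 4 (by decide), e₂ 8 (by decide), e₂ 29 (by decide)]
    · intro s₃ _ _ h₃
      rw [← Learner.run_succ] at h₃
      refine ⟨T + 1, h₃, ?_⟩
      rw [Learner.run_succ]
      exact hI.meas_lt hX hN hq
  · rintro s₂ _ hs₂ ⟨T, hT, h0⟩
    have hE₂ := hE₁.same hs₂ (by decide)
    simp only [Expr.eval, Expr.var, hE₂.M_eq, hT.q_eq] at h0
    -- The loop ends after some T steps with a completed scan, which need not be the number of steps
    -- used in `final`.
    rwa [Learner.final, Learner.run_eq_of_done (Learner.final_done hX hN) (T' := T) (by omega)]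

end Spec

/-! ### Preprocessing, rounding and output -/

namespace Program

open Expr

/-- Write random bits to array 8 and random numbers of `5 * size m` bits to array 9. -/
def randomize : Program :=
  .seq (.for 32 (.var 35) (.flip 8 (.var 32)))
    (.for 25 (.mul (.const 2) (.get 0 (.const 1))) (.for 26 (.mul (.const 5) (.var 20))
      (.seq (.flip 10 (.const 0)) (.store 9 (.var 25)
        (.add (.mul (.const 2) (.get 9 (.var 25))) (.get 10 (.const 0)))))))

def power : Program :=
  .seq (.set 22 (.const 1)) (.for 26 (.mul (.const 5) (.var 20))
    (.set 22 (.mul (.const 2) (.var 22))))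

def scale : Program :=
  .seq (.set 23 (.const 1)) (.seq
    (.for 27 (.get 0 (.const 1)) (.set 23 (.mul (.var 23) (.get 3 (.var 27)))))
    (.for 27 (.get 0 (.const 1)) (.store 7 (.var 27)
      (.mul (.get 2 (.var 27)) (.div (.var 23) (.get 3 (.var 27)))))))

/-- Write the cheapest sets to array 11. -/
def cheapest : Program :=
  .for 28 (.get 0 (.const 0)) (.for 27 (.get 0 (.const 1))
    (.ite (.mul (inc (.var 28) (.var 27)) (.add
        (.sub (.const 1) (inc (.var 28) (.get 11 (.var 28))))
        (.sub (.get 7 (.get 11 (.var 28))) (.get 7 (.var 27)))))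
      (.store 11 (.var 28) (.var 27)) .skip))

/-- Round the fractional cover at random. -/
def select : Program :=
  .seq sumWeights (.for 27 (.get 0 (.const 1))
    (.ite (.sub (.mul (.mul (.var 22) (.var 21)) frac)
        (.mul (.get 9 (.add (.mul (.var 29) (.get 0 (.const 1))) (.var 27)))
          (.mul (.get 0 (.const 1)) (.var 34))))
      (.store 14 (.var 27) (.const 1)) .skip))

def sides : Program := .for 29 (.const 2) (.seq learn select)

/-- For k = 1 the factor k − 1 vanishes and no set is marked for the first stage. The table prefers
any selected set containing the element and falls back on the cheapest one. -/
def output : Program :=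
  .seq (.for 27 (.get 0 (.const 1)) (.ite (.mul (.get 14 (.var 27))
      (.sub (.get 0 (.const 3)) (.const 1))) (.store 5 (.var 27) (.const 1))
      (.store 5 (.var 27) (.const 0))))
    (.for 28 (.get 0 (.const 0)) (.seq (.store 6 (.var 28) (.get 11 (.var 28)))
      (.for 27 (.get 0 (.const 1)) (.ite (.mul (inc (.var 28) (.var 27)) (.get 14 (.var 27)))
        (.store 6 (.var 28) (.var 27)) .skip))))

def main : Program :=
  .seq (size 24 20 (.get 0 (.const 1))) (.seq (.set 35 (.mul (.get 0 (.const 2)) (.get 0 (.const 3))))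
    (.seq (size 24 21 (.var 35)) (.seq randomize (.seq power (.seq scale (.seq cheapest
      (.seq sides output)))))))

end Program

/-- Number with the binary digits `c 0, …, c (l - 1)`, highest digit first. -/
def binVal (c : ℕ → Bool) : ℕ → ℕ
  | 0 => 0
  | l + 1 => 2 * binVal c l + (c l).toNat

theorem binVal_lt (c : ℕ → Bool) (l : ℕ) : binVal c l < 2 ^ l := by
  induction l with
  | zero => simp [binVal]
  | succ l ih =>
    have := Bool.toNat_le (c l)
    rw [binVal, pow_succ]
    omega

/-- The samples of side `σ`. -/
def Learner.samples (X : Learner) (msk smp : ℕ → ℕ) (σ : ℕ) (q : ℕ) : Option ℕ :=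
  if q < X.M ∧ msk q = σ then some (smp q) else none

/-- The set `j` is picked in the rounding with the random number `r` below `p`. -/
def Learner.Picked (X : Learner) (st : LearnerState) (p L r j : ℕ) : Prop :=
  r * (X.m * X.total st) < p * L * X.wt st j

/-! ### Correctness of preprocessing, rounding and output -/

namespace Spec

variable {S Φ : ℕ} {X : Learner} {N sm : ℕ} {s : State} {W : ℕ → Option ℕ} {st : LearnerState}

theorem size (hS : 1 ≤ S) {x c : ℕ} {e : Expr} (hxc : x ≠ c) {v : ℕ} (hv : e.eval s.mem = v)
    (hvS : Nat.size v ≤ S) (hvΦ : Nat.size v ≤ Φ) :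
    Spec S Φ (.size x c e) s (fun s' => s'.mem c 0 = Nat.size v) := by
  subst hv
  set v := e.eval s.mem
  refine Spec.store_seq hS (fun _ => hvS) ?_
  refine Spec.store_seq hS (fun _ => by simp [Expr.eval]) ?_
  refine (Spec.loop hS (fun i => Nat.size v - i)
    (fun i s' => s'.mem x 0 = v / 2 ^ i ∧ s'.mem c 0 = i ∧ i ≤ Nat.size v) 0
    ⟨by simp [Expr.eval, hxc, v], by simp [Expr.eval], Nat.zero_le _⟩
    ((Nat.sub_le _ _).trans hvΦ) ?_).mono ?_
  · rintro i s' _ _ ⟨h₁, h₂, h₃⟩ hne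
    have hlt : i < Nat.size v := by
      by_contra! h
      rw [Nat.size_le] at h
      simp [Expr.eval, Expr.var, h₁, Nat.div_eq_of_lt h] at hne
    refine Spec.store_seq hS (fun _ => ?_) ?_
    · simp only [Expr.eval, Expr.var, h₁]
      exact (Nat.size_le_size ((Nat.div_le_self _ _).trans (Nat.div_le_self _ _))).trans hvS
    refine Spec.store hS (fun _ => ?_) ?_
    · simp only [Expr.eval, Expr.var, State.put_mem_of_ne hxc.symm, h₂]
      exact Nat.size_le.2 (lt_of_le_of_lt (hlt.trans_le hvS : i + 1 ≤ S) Nat.lt_two_pow_self)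
    · refine ⟨i + 1, ⟨?_, ?_, hlt⟩, by omega⟩
      · simp [Expr.eval, Expr.var, hxc, h₁, Nat.div_div_eq_div_mul, pow_succ]
      · simp [Expr.eval, Expr.var, hxc.symm, h₂]
  · rintro s' _ _ ⟨i, ⟨h₁, h₂, h₃⟩, h0⟩
    simp only [Expr.eval, Expr.var, h₁, Nat.div_eq_zero_iff] at h0
    rw [h₂]
    refine le_antisymm h₃ (Nat.size_le.2 ?_)
    rcases h0 with h0 | h0
    · simp at h0
    · exact h0

/-- Coins are consumed in order: M for the sides, then one block of 5·sm for each random number. The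
equations for the remaining coins in the invariants keep track of the position. -/
theorem randomize (hS : 1 ≤ S) {M m : ℕ} (hM : s.mem 35 0 = M) (hm : s.mem 0 1 = m)
    (hsm : s.mem 20 0 = sm) (h9 : ∀ e, s.mem 9 e = 0) (hMΦ : M ≤ Φ) (hmΦ : 2 * m ≤ Φ)
    (hsΦ : 5 * sm ≤ Φ) (hMS : M < 2 ^ S) (hmS : 2 * m < 2 ^ S) (hsS : 5 * sm ≤ S) :
    Spec S Φ .randomize s (fun s' => (∀ q < M, s'.mem 8 q = (s.coins q).toNat) ∧
      ∀ e < 2 * m, s'.mem 9 e = binVal (fun l => s.coins (M + e * (5 * sm) + l)) (5 * sm)) := by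
  refine Spec.seq (Spec.for hS M (Nat.size_le.2 hMS) hMΦ
    (fun i s' => (∀ q < i, s'.mem 8 q = (s.coins q).toNat) ∧ s'.coins = fun l => s.coins (i + l))
    (by decide) ?_ ?_ ?_) ?_
  · intro s' hs
    simp [Expr.eval, Expr.var, hs.1 35 (by decide), hM]
  · simp
  · rintro i s' hi _ hs hx ⟨h₁, h₂⟩
    refine Spec.flip hS ⟨fun q hq => ?_, ?_⟩
    · have hx' : (Expr.var 32).eval s'.mem = i := hx
      rw [State.put_mem_of_ne (by decide), hx', h₂]
      rcases Nat.lt_succ_iff_lt_or_eq.1 hq with hq | rfl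
      · simp [Memory.write, hq.ne, h₁ q hq]
      · simp [Memory.write]
    · simp only [State.put_coins, h₂]
      funext l
      congr 1
      omega
  · rintro s₁ _ hs₁ ⟨h₁, h₂⟩
    refine (Spec.for hS (2 * m) (Nat.size_le.2 hmS) hmΦ
      (fun i s' => (∀ e < i, s'.mem 9 e =
          binVal (fun l => s.coins (M + e * (5 * sm) + l)) (5 * sm)) ∧
        (∀ e ≥ i, s'.mem 9 e = 0) ∧ s'.coins = fun l => s.coins (M + i * (5 * sm) + l))
      (by decide) ?_ ?_ ?_).mono ?_
    · intro s' hs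
      simp [Expr.eval, hs.1 0 (by decide), hs₁.1 0 (by decide), hm]
    · simp [hs₁.1 9 (by decide), h9, h₂]
    · rintro i s₂ hi _ hs₂ hx ⟨h₃, h₄, h₅⟩
      refine (Spec.for hS (5 * sm) ((Nat.size_le.2 (lt_of_le_of_lt hsS Nat.lt_two_pow_self))) hsΦ
        (fun l s' => (∀ e ≠ i, s'.mem 9 e = s₂.mem 9 e) ∧
          s'.mem 9 i = binVal (fun l => s.coins (M + i * (5 * sm) + l)) l ∧
          s'.coins = fun t => s.coins (M + i * (5 * sm) + (l + t))) (by decide) ?_ ?_ ?_).mono ?_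
      · intro s' hs
        simp [Expr.eval, Expr.var, hs.1 20 (by decide), hs₂.1 20 (by decide),
          hs₁.1 20 (by decide), hsm]
      · simp [h₄ i le_rfl, binVal, h₅]
      · rintro l s₃ hl _ hs₃ hl' ⟨h₆, h₇, h₈⟩
        refine Spec.seq (R := fun s' => s'.mem 10 0 = (s.coins (M + i * (5 * sm) + l)).toNat ∧
          s'.coins = fun t => s.coins (M + i * (5 * sm) + (l + 1 + t)))
          (Spec.flip hS ⟨?_, ?_⟩) ?_
        · simp [Memory.write, Expr.eval, h₈]
        · simp only [h₈]
          funext t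
          congr 1
          omega
        · rintro s₄ _ hs₄ ⟨h₉, h₁₀⟩
          have e₁ : s₄.mem 25 0 = i := by
            rw [hs₄.1 25 (by decide), hs₃.1 25 (by decide), hx]
          have e₂ : s₄.mem 9 = s₃.mem 9 := hs₄.1 9 (by decide)
          have hv : (Expr.add (.mul (.const 2) (.get 9 (.var 25)))
              (.get 10 (.const 0))).eval s₄.mem =
              binVal (fun l => s.coins (M + i * (5 * sm) + l)) (l + 1) := by
            simp [Expr.eval, Expr.var, e₁, e₂, h₇, h₉, binVal]
          refine Spec.store hS (fun _ => ?_) ?_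
          · rw [hv, Nat.size_le]
            exact (binVal_lt _ _).trans_le (Nat.pow_le_pow_right (by norm_num) (by omega))
          · have hi' : (Expr.var 25).eval s₄.mem = i := e₁
            rw [hv, hi']
            exact ⟨fun e he => by simp [he, e₂, h₆ e he], by simp, by simp [h₁₀]⟩
      · rintro s₃ _ hs₃ ⟨h₆, h₇, h₈⟩
        refine ⟨fun e he => ?_, fun e he => ?_, ?_⟩
        · rw [State.put_mem_of_ne (by decide)]
          rcases Nat.lt_succ_iff_lt_or_eq.1 he with he | rfl
          · rw [h₆ e he.ne, h₃ e he]
          · exact h₇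
        · rw [State.put_mem_of_ne (by decide), h₆ e (by omega), h₄ e (by omega)]
        · simp only [State.put_coins, h₈]
          funext t
          congr 1
          ring
    · rintro s' _ hs' ⟨h₃, -, -⟩
      exact ⟨fun q hq => by rw [hs'.1 8 (by decide), h₁ q hq], h₃⟩

theorem power (hS : 1 ≤ S) (hsm : s.mem 20 0 = sm) (hsΦ : 5 * sm ≤ Φ) (hsS : 5 * sm < S) :
    Spec S Φ .power s (fun s' => s'.mem 22 0 = 2 ^ (5 * sm)) := by
  refine Spec.store_seq hS (fun _ => by simpa [Expr.eval] using hS) ?_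
  refine Spec.for hS (5 * sm) (Nat.size_le.2 (hsS.trans Nat.lt_two_pow_self)) hsΦ
    (fun i s' => s'.mem 22 0 = 2 ^ i) (by decide) ?_ ?_ ?_
  · intro s' hs
    simp [Expr.eval, Expr.var, hs.1 20 (by decide), hsm]
  · simp [Expr.eval]
  · intro i s' hi _ _ _ h
    have hv : (Expr.mul (.const 2) (.var 22)).eval s'.mem = 2 ^ (i + 1) := by
      simp [Expr.eval, Expr.var, h, pow_succ, mul_comm]
    refine Spec.store hS (fun _ => ?_) (by rw [hv]; simp [Expr.eval])
    rw [hv, Nat.size_pow]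
    omega

theorem scale (hS : 1 ≤ S) {m : ℕ} (hm : s.mem 0 1 = m) (hmΦ : m ≤ Φ) (hmS : m < 2 ^ S)
    (hden : ∀ j < m, 0 < s.mem 3 j) (hP : ∏ j ∈ Finset.range m, s.mem 3 j < 2 ^ S)
    (hC : ∀ j < m, s.mem 2 j * ((∏ j ∈ Finset.range m, s.mem 3 j) / s.mem 3 j) < 2 ^ S) :
    Spec S Φ .scale s (fun s' => ∀ j < m, s'.mem 7 j =
      s.mem 2 j * ((∏ j ∈ Finset.range m, s.mem 3 j) / s.mem 3 j)) := by
  refine Spec.store_seq hS (fun _ => by simpa [Expr.eval] using hS) ?_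
  refine Spec.seq (Spec.for hS m (Nat.size_le.2 hmS) hmΦ
    (fun i s' => s'.mem 23 0 = ∏ j ∈ Finset.range i, s.mem 3 j) (by decide) ?_ ?_ ?_) ?_
  · intro s' hs
    simp [Expr.eval, hs.1 0 (by decide), hm]
  · simp [Expr.eval]
  · intro i s' hi _ hs hx h
    have hv : (Expr.mul (.var 23) (.get 3 (.var 27))).eval s'.mem =
        ∏ j ∈ Finset.range (i + 1), s.mem 3 j := by
      simp [Expr.eval, Expr.var, h, hx, hs.1 3 (by decide), Finset.prod_range_succ]
    refine Spec.store hS (fun _ => ?_) (by rw [hv]; simp [Expr.eval])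
    rw [hv, Nat.size_le]
    refine lt_of_le_of_lt ?_ hP
    exact Finset.prod_le_prod_of_subset_of_one_le' (Finset.range_mono hi)
      fun j hj _ => hden j (Finset.mem_range.1 hj)
  · intro s₁ _ hs₁ h₁
    refine Spec.for hS m (Nat.size_le.2 hmS) hmΦ
      (fun i s' => ∀ j < i, s'.mem 7 j =
        s.mem 2 j * ((∏ j ∈ Finset.range m, s.mem 3 j) / s.mem 3 j)) (by decide) ?_ ?_ ?_
    · intro s' hs
      simp [Expr.eval, hs.1 0 (by decide), hs₁.1 0 (by decide), hm]
    · simp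
    · intro i s' hi _ hs hx h
      have hv : (Expr.mul (.get 2 (.var 27)) (.div (.var 23) (.get 3 (.var 27)))).eval s'.mem =
          s.mem 2 i * ((∏ j ∈ Finset.range m, s.mem 3 j) / s.mem 3 i) := by
        simp [Expr.eval, Expr.var, hx, hs.1 3 (by decide), hs.1 2 (by decide),
          hs.1 23 (by decide), h₁, hs₁.1 3 (by decide), hs₁.1 2 (by decide)]
      refine Spec.store hS (fun _ => ?_) ?_
      · rw [hv]
        exact Nat.size_le.2 (hC i hi)
      · have hx' : (Expr.var 27).eval s'.mem = i := hx
        rw [hv, hx']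
        intro j hj
        rcases Nat.lt_succ_iff_lt_or_eq.1 hj with hj | rfl
        · simp [hj.ne, h j hj]
        · simp

/-- The table initially names set 0, which need not contain the element. A candidate therefore also
replaces an entry that does not contain it, and `hex` provides at least one candidate. -/
theorem cheapest (hS : 1 ≤ S) {m : ℕ} (hm : s.mem 0 1 = m) (hN : s.mem 0 0 = N) (hmΦ : m ≤ Φ)
    (hmS : m < 2 ^ S) (hNΦ : N ≤ Φ) (hNS : N < 2 ^ S) (h11 : ∀ u, s.mem 11 u = 0)
    (hex : ∀ u < N, ∃ j < m, s.mem 1 (u * m + j) ≠ 0) :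
    Spec S Φ .cheapest s (fun s' => ∀ u < N, s'.mem 11 u < m ∧
      s.mem 1 (u * m + s'.mem 11 u) ≠ 0 ∧
      ∀ j < m, s.mem 1 (u * m + j) ≠ 0 → s.mem 7 (s'.mem 11 u) ≤ s.mem 7 j) := by
  refine (Spec.for hS N (Nat.size_le.2 hNS) hNΦ
    (fun i s' => (∀ u < i, s'.mem 11 u < m ∧ s.mem 1 (u * m + s'.mem 11 u) ≠ 0 ∧
      ∀ j < m, s.mem 1 (u * m + j) ≠ 0 → s.mem 7 (s'.mem 11 u) ≤ s.mem 7 j) ∧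
      ∀ u ≥ i, s'.mem 11 u = 0) (by decide) ?_ ?_ ?_).mono ?_
  · intro s' hs
    simp [Expr.eval, hs.1 0 (by decide), hN]
  · simp [h11]
  · rintro u s₁ hu _ hs₁ hx ⟨h₁, h₂⟩
    obtain ⟨j₀, hj₀, hju⟩ := hex u hu
    refine (Spec.for hS m (Nat.size_le.2 hmS) hmΦ
      (fun i s' => (∀ u' ≠ u, s'.mem 11 u' = s₁.mem 11 u') ∧ s'.mem 11 u < m ∧
        ∀ j < i, s.mem 1 (u * m + j) ≠ 0 → s.mem 1 (u * m + s'.mem 11 u) ≠ 0 ∧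
          s.mem 7 (s'.mem 11 u) ≤ s.mem 7 j) (by decide) ?_ ?_ ?_).mono ?_
    · intro s' hs
      simp [Expr.eval, hs.1 0 (by decide), hs₁.1 0 (by decide), hm]
    · simp [h₂ u le_rfl]
      omega
    · rintro i s₂ hi _ hs₂ hx₂ ⟨h₃, h₄, h₅⟩
      have hu₂ : s₂.mem 28 0 = u := by rw [hs₂.1 28 (by decide), hx]
      have e1 : s₂.mem 1 = s.mem 1 := by rw [hs₂.1 1 (by decide), hs₁.1 1 (by decide)]
      have e0 : s₂.mem 0 1 = m := by rw [hs₂.1 0 (by decide), hs₁.1 0 (by decide), hm]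
      have e7 : s₂.mem 7 = s.mem 7 := by rw [hs₂.1 7 (by decide), hs₁.1 7 (by decide)]
      have hg : (Expr.mul (Program.inc (.var 28) (.var 27)) (.add
          (.sub (.const 1) (Program.inc (.var 28) (.get 11 (.var 28))))
          (.sub (.get 7 (.get 11 (.var 28))) (.get 7 (.var 27))))).eval s₂.mem ≠ 0 ↔
          s.mem 1 (u * m + i) ≠ 0 ∧ (s.mem 1 (u * m + s₂.mem 11 u) = 0 ∨
            s.mem 7 i < s.mem 7 (s₂.mem 11 u)) := by
        simp only [Expr.eval, Program.inc, Expr.var, hu₂, hx₂, e0, e1, e7]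
        rw [mul_ne_zero_iff]
        exact and_congr_right fun _ => by omega
      refine Spec.ite hS (fun h => ?_) (fun h => ?_)
      · obtain ⟨h₆, h₇⟩ := hg.1 h
        have hx₂' : (Expr.var 27).eval s₂.mem = i := hx₂
        have hu₂' : (Expr.var 28).eval s₂.mem = u := hu₂
        refine Spec.store hS (fun _ => ?_) ?_
        · rw [hx₂']
          exact Nat.size_le.2 (hi.trans hmS)
        · rw [hx₂', hu₂']
          refine ⟨fun u' hu' => by simp [hu', h₃ u' hu'], by simpa using hi, fun j hj hj' => ?_⟩
          rw [State.put_mem_of_ne (by decide), State.put_mem_self, Function.update_self]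
          refine ⟨h₆, ?_⟩
          rcases Nat.lt_succ_iff_lt_or_eq.1 hj with hj | rfl
          · obtain ⟨h₈, h₉⟩ := h₅ j hj hj'
            exact (h₇.resolve_left h₈).le.trans h₉
          · exact le_rfl
      · refine Spec.skip ⟨by simpa using h₃, by simpa using h₄, fun j hj hj' => ?_⟩
        rw [State.put_mem_of_ne (by decide)]
        rcases Nat.lt_succ_iff_lt_or_eq.1 hj with hj | rfl
        · exact h₅ j hj hj'
        · have := mt hg.2 (not_not.2 h)
          push Not at this
          exact this hj'
    · rintro s' _ _ ⟨h₃, h₄, h₅⟩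
      refine ⟨fun u' hu' => ?_, fun u' hu' => ?_⟩
      · rw [State.put_mem_of_ne (by decide)]
        rcases Nat.lt_succ_iff_lt_or_eq.1 hu' with hu' | rfl
        · rw [h₃ u' hu'.ne]
          exact h₁ u' hu'
        · exact ⟨h₄, (h₅ j₀ hj₀ hju).1, fun j hj hj' => (h₅ j hj hj').2⟩
      · rw [State.put_mem_of_ne (by decide), h₃ u' (by omega), h₂ u' (by omega)]
  · rintro s' _ _ ⟨h, -⟩
    exact h

/-- Probabilities are compared by cross-multiplication of integers. The disjunction with the old
contents of array 14 accumulates the picks of the two sides. -/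
theorem select (hE : Env X N sm s.mem) (hB : Enough X sm S Φ) (hX : X.Proper N sm)
    (hI : X.Inv W st) (hH : Holds X st s.mem) :
    Spec S Φ .select s (fun s' => ∀ j < X.m, s'.mem 14 j ≠ 0 ↔ s.mem 14 j ≠ 0 ∨
      X.Picked st (s.mem 22 0) (s.mem 21 0) (s.mem 9 (s.mem 29 0 * X.m + j)) j) := by
  have hS := hB.one_le
  have hsum : ∑ j ∈ Finset.range X.m, s.mem 13 j = X.total st :=
    Finset.sum_congr rfl fun j hj => hH.pw_eq j (Finset.mem_range.1 hj)
  refine Spec.seq (Spec.sumWeights hE hB (by rw [hsum]; exact hI.total_lt hX hB)) ?_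
  intro s₁ _ hs₁ h₁
  rw [hsum] at h₁
  have hE₁ := hE.same hs₁ (by decide)
  have hH₁ := hH.same hs₁ (by decide)
  refine (Spec.for hS X.m (Nat.size_le.2 hB.m_lt) hB.m_le
    (fun i s' => ∀ j < X.m, s'.mem 14 j ≠ 0 ↔ s.mem 14 j ≠ 0 ∨ (j < i ∧
      X.Picked st (s.mem 22 0) (s.mem 21 0) (s.mem 9 (s.mem 29 0 * X.m + j)) j))
    (by decide) ?_ ?_ ?_).mono ?_
  · intro s' hs
    simp [Expr.eval, hs.1 0 (by decide), hE₁.m_eq]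
  · simp [hs₁.1 14 (by decide)]
  · intro i s₂ hi _ hs₂ hx h
    have hE₂ := hE₁.same hs₂ (by decide)
    have hH₂ := hH₁.same hs₂ (by decide)
    have hf := eval_frac hE₂ hH₂ (by rwa [hx])
    have hg : (Expr.sub (.mul (.mul (.var 22) (.var 21)) Program.frac)
        (.mul (.get 9 (.add (.mul (.var 29) (.get 0 (.const 1))) (.var 27)))
          (.mul (.get 0 (.const 1)) (.var 34)))).eval s₂.mem ≠ 0 ↔
        X.Picked st (s.mem 22 0) (s.mem 21 0) (s.mem 9 (s.mem 29 0 * X.m + i)) i := by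
      simp only [Expr.eval, hf, Expr.var, hx, hE₂.m_eq, Learner.Picked]
      simp only [hs₂.1 22 (by decide), hs₂.1 21 (by decide), hs₂.1 9 (by decide),
        hs₂.1 29 (by decide), hs₂.1 34 (by decide), h₁, hs₁.1 22 (by decide),
        hs₁.1 21 (by decide), hs₁.1 9 (by decide), hs₁.1 29 (by decide)]
      omega
    have hx' : (Expr.var 27).eval s₂.mem = i := hx
    refine Spec.ite hS (fun h' => ?_) (fun h' => ?_)
    · have hp := hg.1 h'
      refine Spec.store hS (fun _ => by simpa [Expr.eval] using hS) ?_
      rw [hx']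
      intro j hj
      by_cases hji : j = i
      · subst hji
        simp [Expr.eval, hp]
      · have : j < i + 1 ↔ j < i := by omega
        simp [hji, this, h j hj]
    · have hp := mt hg.2 (not_not.2 h')
      refine Spec.skip fun j hj => ?_
      by_cases hji : j = i
      · subst hji
        simp [hp, h j hj]
      · have : j < i + 1 ↔ j < i := by omega
        simp [this, h j hj]
  · intro s' _ _ h j hj
    rw [h j hj]
    simp [hj]

theorem sides (hE : Env X N sm s.mem) (hB : Enough X sm S Φ) (hX : X.Proper N sm) (hΦ : 2 ≤ Φ)
    (hS2 : 2 ≤ S) (h14 : ∀ j, s.mem 14 j = 0) :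
    Spec S Φ .sides s (fun s' => ∀ j < X.m, s'.mem 14 j ≠ 0 ↔ ∃ σ < 2,
      X.Picked (X.final sm (X.samples (s.mem 8) (s.mem 4) σ)) (s.mem 22 0) (s.mem 21 0)
        (s.mem 9 (σ * X.m + j)) j) := by
  have hS := hB.one_le
  refine Spec.for hS 2 (Nat.size_le.2 ((by norm_num : 2 < 2 ^ 2).trans_le
    (Nat.pow_le_pow_right (by norm_num) hS2))) hΦ
    (fun i s' => ∀ j < X.m, s'.mem 14 j ≠ 0 ↔ ∃ σ < i,
      X.Picked (X.final sm (X.samples (s.mem 8) (s.mem 4) σ)) (s.mem 22 0) (s.mem 21 0)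
        (s.mem 9 (σ * X.m + j)) j) (by decide) ?_ ?_ ?_
  · intro s' _
    rfl
  · simp [h14]
  · intro i s₁ hi _ hs₁ hx h
    have hE₁ := hE.same hs₁ (by decide)
    set W := X.samples (s.mem 8) (s.mem 4) i with hW
    have hN : ∀ q u, W q = some u → u < N := by
      intro q u hu
      rw [hW, Learner.samples] at hu
      split at hu
      case isTrue hq =>
        cases hu
        exact hE.smp_lt q hq.1
      case isFalse => cases hu
    refine Spec.seq (Spec.learn hE₁ hB hX hN ?_) ?_
    · intro q hq
      rw [hx, hs₁.1 8 (by decide), hs₁.1 4 (by decide), hW, Learner.samples]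
      simp [hq]
    · intro s₂ _ hs₂ h₂
      refine (Spec.select (hE₁.same hs₂ (by decide)) hB hX (Learner.inv_final hX hN) h₂).mono ?_
      intro s₃ _ _ h₃ j hj
      rw [State.put_mem_of_ne (by decide), h₃ j hj, hs₂.1 14 (by decide), h j hj, hs₂.1 22 (by decide),
        hs₂.1 21 (by decide), hs₂.1 9 (by decide), hs₂.1 29 (by decide), hx,
        hs₁.1 22 (by decide), hs₁.1 21 (by decide), hs₁.1 9 (by decide)]
      constructor
      · rintro (⟨σ, hσ, hp⟩ | hp)
        · exact ⟨σ, by omega, hp⟩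
        · exact ⟨i, by omega, hp⟩
      · rintro ⟨σ, hσ, hp⟩
        rcases Nat.lt_succ_iff_lt_or_eq.1 hσ with hσ | rfl
        · exact Or.inl ⟨σ, hσ, hp⟩
        · exact Or.inr hp

theorem output (hS : 1 ≤ S) {m k : ℕ} (hm : s.mem 0 1 = m) (hN : s.mem 0 0 = N)
    (hk : s.mem 0 3 = k) (hmΦ : m ≤ Φ) (hmS : m < 2 ^ S) (hNΦ : N ≤ Φ) (hNS : N < 2 ^ S) :
    Spec S Φ .output s (fun s' => (∀ j < m, s'.mem 5 j ≠ 0 ↔ s.mem 14 j ≠ 0 ∧ 2 ≤ k) ∧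
      ∀ u < N, (∃ j < m, s'.mem 6 u = j ∧ s.mem 1 (u * m + j) ≠ 0 ∧ s.mem 14 j ≠ 0) ∨
        (s'.mem 6 u = s.mem 11 u ∧ ∀ j < m, s.mem 1 (u * m + j) ≠ 0 → s.mem 14 j = 0)) := by
  refine Spec.seq (Spec.for hS m (Nat.size_le.2 hmS) hmΦ
    (fun i s' => ∀ j < i, s'.mem 5 j ≠ 0 ↔ s.mem 14 j ≠ 0 ∧ 2 ≤ k) (by decide) ?_ ?_ ?_) ?_
  · intro s' hs
    simp [Expr.eval, hs.1 0 (by decide), hm]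
  · simp
  · intro i s₁ hi _ hs₁ hx h
    have hv : (Expr.mul (.get 14 (.var 27)) (.sub (.get 0 (.const 3)) (.const 1))).eval s₁.mem =
        s.mem 14 i * (k - 1) := by
      simp [Expr.eval, Expr.var, hx, hs₁.1 14 (by decide), hs₁.1 0 (by decide), hk]
    have hx' : (Expr.var 27).eval s₁.mem = i := hx
    refine Spec.ite hS (fun h' => ?_) (fun h' => ?_) <;> rw [hv] at h'
    · refine Spec.store hS (fun _ => by simpa [Expr.eval] using hS) ?_
      rw [hx']
      intro j hj
      rcases Nat.lt_succ_iff_lt_or_eq.1 hj with hj | rfl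
      · simpa [hj.ne] using h j hj
      · obtain ⟨h₁, h₂⟩ := mul_ne_zero_iff.1 h'
        simp only [State.put_mem_of_ne (by decide : 5 ≠ 27), State.put_mem_self,
          Function.update_self, Expr.eval]
        exact ⟨fun _ => ⟨h₁, by omega⟩, fun _ => one_ne_zero⟩
    · refine Spec.store hS (fun _ => by simp [Expr.eval]) ?_
      rw [hx']
      intro j hj
      rcases Nat.lt_succ_iff_lt_or_eq.1 hj with hj | rfl
      · simpa [hj.ne] using h j hj
      · simp only [State.put_mem_of_ne (by decide : 5 ≠ 27), State.put_mem_self,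
          Function.update_self, Expr.eval]
        refine ⟨fun h₁ => absurd rfl h₁, fun ⟨h₁, h₂⟩ => ?_⟩
        rcases mul_eq_zero.1 h' with h₃ | h₃
        · exact absurd h₃ h₁
        · omega
  · intro s₁ _ hs₁ h₁
    refine (Spec.for hS N (Nat.size_le.2 hNS) hNΦ
      (fun i s' => ∀ u < i,
        (∃ j < m, s'.mem 6 u = j ∧ s.mem 1 (u * m + j) ≠ 0 ∧ s.mem 14 j ≠ 0) ∨
        (s'.mem 6 u = s.mem 11 u ∧ ∀ j < m, s.mem 1 (u * m + j) ≠ 0 → s.mem 14 j = 0))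
      (by decide) ?_ ?_ ?_).mono ?_
    · intro s' hs
      simp [Expr.eval, hs.1 0 (by decide), hs₁.1 0 (by decide), hN]
    · simp
    · intro u s₂ hu hb₂ hs₂ hx h₂
      have hx' : (Expr.var 28).eval s₂.mem = u := hx
      have hv : (Expr.get 11 (.var 28)).eval s₂.mem = s.mem 11 u := by
        simp [Expr.eval, hx', hs₂.1 11 (by decide), hs₁.1 11 (by decide)]
      refine Spec.store_seq hS (fun hb => hb _ _) ?_
      rw [hx', hv]
      refine (Spec.for hS m (Nat.size_le.2 hmS) hmΦ
        (fun i s' => (∀ u' ≠ u, s'.mem 6 u' = s₂.mem 6 u') ∧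
          ((∃ j < m, s'.mem 6 u = j ∧ s.mem 1 (u * m + j) ≠ 0 ∧ s.mem 14 j ≠ 0) ∨
          (s'.mem 6 u = s.mem 11 u ∧ ∀ j < i, s.mem 1 (u * m + j) ≠ 0 → s.mem 14 j = 0)))
        (by decide) ?_ ?_ ?_).mono ?_
      · intro s' hs
        simp [Expr.eval, hs.1 0 (by decide), hs₂.1 0 (by decide), hs₁.1 0 (by decide), hm]
      · refine ⟨fun u' hu' => by simp [hu'], Or.inr ⟨by simp, by simp⟩⟩
      · rintro i s₃ hi _ hs₃ hi₃ ⟨h₃, h₄⟩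
        have e28 : s₃.mem 28 0 = u := by simp [hs₃.1 28 (by decide), hx]
        have hg : (Expr.mul (Program.inc (.var 28) (.var 27))
            (.get 14 (.var 27))).eval s₃.mem ≠ 0 ↔
            s.mem 1 (u * m + i) ≠ 0 ∧ s.mem 14 i ≠ 0 := by
          rw [← mul_ne_zero_iff]
          simp [Expr.eval, Program.inc, Expr.var, e28, hi₃, hs₃.1 0 (by decide),
            hs₂.1 0 (by decide), hs₁.1 0 (by decide), hm, hs₃.1 1 (by decide),
            hs₂.1 1 (by decide), hs₁.1 1 (by decide), hs₃.1 14 (by decide),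
            hs₂.1 14 (by decide), hs₁.1 14 (by decide)]
        have h27 : (Expr.var 27).eval s₃.mem = i := hi₃
        have h28 : (Expr.var 28).eval s₃.mem = u := e28
        refine Spec.ite hS (fun h => ?_) (fun h => ?_)
        · refine Spec.store hS (fun _ => ?_) ?_
          · rw [h27]
            exact Nat.size_le.2 (hi.trans hmS)
          · rw [h27, h28]
            exact ⟨fun u' hu' => by simp [hu', h₃ u' hu'],
              Or.inl ⟨i, hi, by simp, hg.1 h⟩⟩
        · refine Spec.skip ⟨by simpa using h₃, ?_⟩
          rw [State.put_mem_of_ne (by decide)]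
          refine h₄.imp_right fun ⟨h₅, h₆⟩ => ⟨h₅, fun j hj hj' => ?_⟩
          rcases Nat.lt_succ_iff_lt_or_eq.1 hj with hj | rfl
          · exact h₆ j hj hj'
          · by_contra hz
            exact hg.2 ⟨hj', hz⟩ h
      · rintro s' _ _ ⟨h₃, h₄⟩ u' hu'
        rw [State.put_mem_of_ne (by decide)]
        rcases Nat.lt_succ_iff_lt_or_eq.1 hu' with hu' | rfl
        · rw [h₃ u' hu'.ne]
          exact h₂ u' hu'
        · exact h₄
    · intro s' _ hs' h
      exact ⟨fun j hj => by rw [hs'.1 5 (by decide)]; exact h₁ j hj, h⟩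

end Spec

/-! ### The program on a set system -/

namespace SetSystem

variable {N m : ℕ} (I : SetSystem N m)

/-- A common denominator of the costs. -/
def denom : ℕ := ∏ j, (I.cost j).den

/-- The costs multiplied by the common denominator. -/
def scaledCost (j : ℕ) : ℕ :=
  if h : j < m then (I.cost ⟨j, h⟩).num * (I.denom / (I.cost ⟨j, h⟩).den) else 0

open Classical in
/-- The learner for this set system and `M` samples. -/
noncomputable def learner (M : ℕ) : Learner where
  m := m
  M := M
  B := 5 * Nat.size m
  sets u := (Finset.range m).filter fun j => ∃ (hu : u < N) (hj : j < m), ⟨u, hu⟩ ∈ I.sets ⟨j, hj⟩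
  C := I.scaledCost
  κ u := sInf (I.scaledCost ''
    {j | ∃ (hu : u < N) (hj : j < m), (⟨u, hu⟩ : Fin N) ∈ I.sets ⟨j, hj⟩})

theorem mem_learner_sets {M u j : ℕ} : j ∈ (I.learner M).sets u ↔
    ∃ (hu : u < N) (hj : j < m), ⟨u, hu⟩ ∈ I.sets ⟨j, hj⟩ := by
  simp only [learner, Finset.mem_filter, Finset.mem_range, and_iff_right_iff_imp]
  rintro ⟨_, hj, _⟩
  exact hj

theorem κ_learner_le {M u j : ℕ} (hj : j ∈ (I.learner M).sets u) :
    (I.learner M).κ u ≤ I.scaledCost j :=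
  Nat.sInf_le ⟨j, I.mem_learner_sets.1 hj, rfl⟩

theorem learner_proper (hm : 0 < m) (M : ℕ) : (I.learner M).Proper N (Nat.size m) where
  m_pos := hm
  m_lt := Nat.lt_size_self m
  B_eq := rfl
  sets_sub u := Finset.filter_subset _ _
  κ_le u _ j hj := I.κ_learner_le hj
  exists_le u hu := by
    obtain ⟨j, hj⟩ := I.covers ⟨u, hu⟩
    have hne : (I.scaledCost ''
        {j | ∃ (hu : u < N) (hj : j < m), (⟨u, hu⟩ : Fin N) ∈ I.sets ⟨j, hj⟩}).Nonempty :=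
      ⟨_, j, ⟨hu, j.2, hj⟩, rfl⟩
    obtain ⟨i, hi, hi'⟩ := Nat.sInf_mem hne
    exact ⟨i, I.mem_learner_sets.2 hi, hi'.le⟩

theorem denom_pos : 0 < I.denom := Finset.prod_pos fun j _ => (I.cost j).den_pos

theorem cast_scaledCost (j : Fin m) : (I.scaledCost j : ℝ) = I.denom * (I.cost j : ℝ) := by
  have hd : (I.cost j).den ∣ I.denom := Finset.dvd_prod_of_mem _ (Finset.mem_univ j)
  have h0 : ((I.cost j).den : ℝ) ≠ 0 := by exact_mod_cast (I.cost j).den_pos.ne'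
  have hc : (I.cost j : ℝ) = (I.cost j).num / (I.cost j).den := by
    conv_lhs => rw [← NNRat.num_div_den (I.cost j)]
    push_cast
    rfl
  rw [scaledCost, dif_pos j.2, Nat.cast_mul, Nat.cast_div hd h0, hc]
  ring

theorem size_cost_le (n k : ℕ) (j : Fin m) :
    Nat.size (I.cost j).num + Nat.size (I.cost j).den ≤ I.inputSize n k := by
  have := Finset.single_le_sum
    (f := fun j => Nat.size (I.cost j).num + Nat.size (I.cost j).den)
    (fun _ _ => Nat.zero_le _) (Finset.mem_univ j)
  simp only [inputSize]
  omega

theorem prod_le_two_pow_sum_size {ι : Type*} (s : Finset ι) (f : ι → ℕ) :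
    ∏ i ∈ s, f i ≤ 2 ^ ∑ i ∈ s, Nat.size (f i) := by
  rw [← Finset.prod_pow_eq_pow_sum]
  exact Finset.prod_le_prod' fun i _ => (Nat.lt_size_self _).le

/-- The size of the product of all denominators is at most the sum of their sizes, and these are
counted in the input separately from the numerator. -/
theorem num_mul_denom_lt (n k : ℕ) (j : Fin m) :
    (I.cost j).num * I.denom < 2 ^ I.inputSize n k := by
  have h₁ := prod_le_two_pow_sum_size Finset.univ (fun j => (I.cost j).den)
  have h₂ : (I.cost j).num < 2 ^ Nat.size (I.cost j).num := Nat.lt_size_self _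
  have h₃ := Finset.single_le_sum (f := fun j => Nat.size (I.cost j).num)
    (fun _ _ => Nat.zero_le _) (Finset.mem_univ j)
  calc (I.cost j).num * I.denom
      < 2 ^ Nat.size (I.cost j).num * 2 ^ ∑ j, Nat.size (I.cost j).den :=
        Nat.mul_lt_mul_of_lt_of_le h₂ h₁ (by positivity)
    _ ≤ _ := by
      rw [← pow_add]
      refine Nat.pow_le_pow_right (by norm_num) ?_
      simp only [inputSize, Finset.sum_add_distrib]
      omega

theorem scaledCost_lt (n k : ℕ) (j : ℕ) : I.scaledCost j < 2 ^ I.inputSize n k := by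
  unfold scaledCost
  split
  case isTrue h =>
    refine lt_of_le_of_lt ?_ (I.num_mul_denom_lt n k ⟨j, h⟩)
    exact Nat.mul_le_mul_left _ (Nat.div_le_self _ _)
  case isFalse => positivity

theorem m_le_inputSize (n k : ℕ) : m ≤ I.inputSize n k := by
  have : ∑ j : Fin m, 1 ≤ ∑ j, (Nat.size (I.cost j).num + Nat.size (I.cost j).den) :=
    Finset.sum_le_sum fun j _ => by
      have := Nat.size_pos.2 (I.cost j).den_pos
      omega
  simp only [Finset.sum_const, Finset.card_univ, Fintype.card_fin, smul_eq_mul, mul_one] at this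
  simp only [inputSize]
  omega

theorem N_le_inputSize (n k : ℕ) (hm : 0 < m) : N ≤ I.inputSize n k := by
  have := Nat.le_mul_of_pos_right N hm
  simp only [inputSize]
  omega

theorem samples_le_inputSize (n k : ℕ) (hN : 0 < N) : n * k ≤ I.inputSize n k := by
  have := Nat.le_mul_of_pos_right (n * k) (Nat.size_pos.2 hN)
  simp only [inputSize]
  omega

theorem size_le_self (a : ℕ) : Nat.size a ≤ a := Nat.size_le.2 Nat.lt_two_pow_self

/-- Word length on inputs of size `z`. -/
def word (z : ℕ) : ℕ := 8 * z + 10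

/-- Number of iterations of any loop on inputs of size `z`. -/
def iters (z : ℕ) : ℕ :=
  ((2 * z + 2) * (z * (3 * z) + 1) + z * (3 * z)) * (z + 1) + z + (5 * z + 2)

theorem sum_scaledCost_lt (n k : ℕ) :
    ∑ j ∈ Finset.range m, I.scaledCost j < 2 ^ (2 * I.inputSize n k) := by
  have hm := I.m_le_inputSize n k
  calc ∑ j ∈ Finset.range m, I.scaledCost j ≤ ∑ j ∈ Finset.range m, 2 ^ I.inputSize n k :=
        Finset.sum_le_sum fun j _ => (I.scaledCost_lt n k j).le
    _ = m * 2 ^ I.inputSize n k := by simp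
    _ < 2 ^ I.inputSize n k * 2 ^ I.inputSize n k :=
        Nat.mul_lt_mul_of_pos_right (hm.trans_lt Nat.lt_two_pow_self) (by positivity)
    _ = _ := by rw [← pow_add, two_mul]

/-- The factors 2^4, 2^(2z), 2^(2z+2), 2^(3z) and 2^(z+3) multiply to 2^(8z+9), whence the word
length. The number of iterations is the initial termination measure with its ingredients bounded in
terms of z, plus room for the counting loops. -/
theorem enough (n k : ℕ) (hN : 0 < N) (hm : 0 < m) :
    Enough (I.learner (n * k)) (Nat.size m) (word (I.inputSize n k))
      (iters (I.inputSize n k)) := by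
  set z := I.inputSize n k
  have hmz : m ≤ z := I.m_le_inputSize n k
  have hMz : n * k ≤ z := I.samples_le_inputSize n k hN
  have hC : ∑ j ∈ Finset.range m, I.scaledCost j < 2 ^ (2 * z) := I.sum_scaledCost_lt n k
  have hsm : Nat.size m ≤ z := (size_le_self m).trans hmz
  have hlt : ∀ a ≤ z, a < 2 ^ word z := fun a ha =>
    (ha.trans (by unfold word; omega : z ≤ word z)).trans_lt Nat.lt_two_pow_self
  refine ⟨by unfold word; omega, ?_, hlt _ hmz, hlt _ hMz, ?_, ?_⟩
  · change m ≤ _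
    unfold iters
    omega
  · change ((Nat.size (2 * ∑ j ∈ Finset.range m, I.scaledCost j) - Nat.size 0) *
      (m * (3 * Nat.size m) + 1) + (m * (3 * Nat.size m) -
        ∑ j ∈ Finset.range m, 0 / I.scaledCost j)) * (n * k + 1) + (n * k - 0) ≤ _
    have h₁ : Nat.size (2 * ∑ j ∈ Finset.range m, I.scaledCost j) ≤ 2 * z + 2 := by
      rw [Nat.size_le, pow_add]
      omega
    unfold iters
    refine le_trans ?_ (Nat.le_add_right _ _)
    gcongr ?_ * ?_ + ?_
    · refine Nat.add_le_add (Nat.mul_le_mul ?_ ?_) ?_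
      · omega
      · gcongr
      · refine (Nat.sub_le _ _).trans ?_
        gcongr
    · omega
    · omega
  · change 16 * m ^ 2 * (2 * (∑ j ∈ Finset.range m, I.scaledCost j) + 1) * 2 ^ (3 * Nat.size m) *
      (5 * Nat.size m + 1) < _
    have h₁ : m ≤ 2 ^ z := hmz.trans Nat.lt_two_pow_self.le
    have h₂ : 2 * (∑ j ∈ Finset.range m, I.scaledCost j) + 1 ≤ 2 ^ (2 * z + 2) := by
      rw [pow_add]
      omega
    have h₃ : 5 * Nat.size m + 1 ≤ 2 ^ (z + 3) := by
      have : z < 2 ^ z := Nat.lt_two_pow_self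
      rw [pow_add]
      omega
    calc _ ≤ 2 ^ 4 * (2 ^ z) ^ 2 * 2 ^ (2 * z + 2) * 2 ^ (3 * z) * 2 ^ (z + 3) := by
          gcongr <;> norm_num
      _ = 2 ^ (8 * z + 9) := by
          rw [← pow_mul, ← pow_add, ← pow_add, ← pow_add, ← pow_add]
          congr 1
          ring
      _ < 2 ^ word z := Nat.pow_lt_pow_right (by norm_num) (by unfold word; omega)

theorem inputMemory_bdd {n k : ℕ} (s : Fin n × Fin k → Fin N) :
    (I.inputMemory s).Bdd (word (I.inputSize n k)) := by
  have hz : I.inputSize n k ≤ word (I.inputSize n k) := by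
    unfold word
    omega
  intro a i
  refine le_trans ?_ hz
  have h₀ : Nat.size N + Nat.size m + Nat.size n + Nat.size k ≤ I.inputSize n k := by
    simp only [inputSize]
    omega
  have h0 : Nat.size 0 = 0 := rfl
  unfold inputMemory
  split
  · rcases i with _ | _ | _ | _ | i <;> simp <;> omega
  · split
    case isTrue h =>
      have : N * m ≤ I.inputSize n k := by
        simp only [inputSize]
        omega
      have hp : 0 < N * m := Nat.mul_pos
        ((Nat.zero_le _).trans_lt h.1) ((Nat.zero_le _).trans_lt h.2)
      split <;> simp
      omega
    case isFalse => simp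
  · split
    case isTrue h =>
      have := I.size_cost_le n k ⟨i, h⟩
      omega
    case isFalse => simp
  · split
    case isTrue h =>
      have := I.size_cost_le n k ⟨i, h⟩
      omega
    case isFalse => simp
  · split
    case isTrue h =>
      have := Nat.size_le_size (s (⟨i / k, h.1⟩, ⟨i % k, h.2⟩)).2.le
      omega
    case isFalse => simp
  · simp

/-- The sets picked by the rounding, given the sides of the samples, the samples, and the random
numbers. -/
def Chosen (n k : ℕ) (msk smp y : ℕ → ℕ) (j : ℕ) : Prop :=
  ∃ σ < 2, (I.learner (n * k)).Picked ((I.learner (n * k)).final (Nat.size m)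
    ((I.learner (n * k)).samples msk smp σ)) (2 ^ (5 * Nat.size m)) (Nat.size (n * k))
    (y (σ * m + j)) j

theorem Chosen.congr {n k : ℕ} {msk msk' smp y y' : ℕ → ℕ} (hmsk : ∀ q < n * k, msk q = msk' q)
    (hy : ∀ e < 2 * m, y e = y' e) {j : ℕ} (hj : j < m) :
    I.Chosen n k msk smp y j ↔ I.Chosen n k msk' smp y' j := by
  refine exists_congr fun σ => and_congr_right fun hσ => ?_
  have h₁ : (I.learner (n * k)).samples msk smp σ = (I.learner (n * k)).samples msk' smp σ := by
    funext q
    unfold Learner.samples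
    by_cases hq : q < n * k
    · rw [hmsk q hq]
    · have : ¬ q < (I.learner (n * k)).M := hq
      simp [this]
  have h₂ : σ * m + j < 2 * m := by
    have := Nat.mul_le_mul_right m (Nat.le_of_lt_succ hσ)
    omega
  rw [h₁, hy _ h₂]

/-- Each fragment writes to few arrays, so the facts established for earlier states are transported
to later ones by the frame rule. -/
theorem spec_main {n k : ℕ} (hN : 0 < N) (hm : 0 < m) (s : Fin n × Fin k → Fin N) (c : ℕ → Bool) :
    Spec (word (I.inputSize n k)) (iters (I.inputSize n k)) Program.main
      { mem := I.inputMemory s, coins := c } (fun s' =>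
      (∀ j < m, s'.mem 5 j ≠ 0 ↔ I.Chosen n k (fun q => (c q).toNat) (I.inputMemory s 4)
        (fun e => binVal (fun l => c (n * k + e * (5 * Nat.size m) + l)) (5 * Nat.size m)) j ∧
          2 ≤ k) ∧
      ∀ u < N, (∃ j < m, s'.mem 6 u = j ∧ j ∈ (I.learner (n * k)).sets u ∧
        I.Chosen n k (fun q => (c q).toNat) (I.inputMemory s 4)
        (fun e => binVal (fun l => c (n * k + e * (5 * Nat.size m) + l)) (5 * Nat.size m)) j) ∨
        (s'.mem 6 u ∈ (I.learner (n * k)).sets u ∧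
          I.scaledCost (s'.mem 6 u) = (I.learner (n * k)).κ u ∧
          ∀ j ∈ (I.learner (n * k)).sets u,
            ¬ I.Chosen n k (fun q => (c q).toNat) (I.inputMemory s 4)
        (fun e => binVal (fun l => c (n * k + e * (5 * Nat.size m) + l)) (5 * Nat.size m)) j)) := by
  set z := I.inputSize n k with hz
  set X := I.learner (n * k) with hXdef
  set sm := Nat.size m with hsm
  have hB : Enough X sm (word z) (iters z) := I.enough n k hN hm
  have hX : X.Proper N sm := I.learner_proper hm _
  have hS := hB.one_le
  have hmz : m ≤ z := I.m_le_inputSize n k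
  have hMz : n * k ≤ z := I.samples_le_inputSize n k hN
  have hNz : N ≤ z := I.N_le_inputSize n k hm
  have hsmz : sm ≤ z := (size_le_self m).trans hmz
  have hzS : 8 * z + 10 = word z := rfl
  have hlt : ∀ a, a ≤ word z → a < 2 ^ word z := fun a ha => ha.trans_lt Nat.lt_two_pow_self
  have hzΦ : 5 * z + 2 ≤ iters z := by
    unfold iters
    omega
  have hprod : ∏ j ∈ Finset.range m, I.inputMemory s 3 j = I.denom := by
    rw [Finset.prod_range]
    refine Finset.prod_congr rfl fun j _ => ?_
    exact dif_pos j.2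
  have hinc : ∀ u < N, ∀ j < m, I.inputMemory s 1 (u * m + j) ≠ 0 ↔ j ∈ X.sets u := by
    intro u hu j hj
    rw [hXdef, mem_learner_sets]
    have h₁ : (u * m + j) / m = u := by
      rw [mul_comm, Nat.mul_add_div hm, Nat.div_eq_of_lt hj, add_zero]
    have h₂ : (u * m + j) % m = j := by
      rw [mul_comm, Nat.mul_add_mod, Nat.mod_eq_of_lt hj]
    simp only [inputMemory, h₁, h₂, hu, hj, and_self, dif_pos, exists_true_left]
    split <;> simp_all
  have hsmp : ∀ q < n * k, I.inputMemory s 4 q < N := by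
    intro q _
    simp only [inputMemory]
    split
    · exact Fin.is_lt _
    · exact hN
  refine Spec.seq (Spec.size hS (v := m) (by decide) rfl (by omega) (by omega)) ?_
  intro s₁ _ hs₁ h₁
  have e₁ : ∀ a < 20, s₁.mem a = I.inputMemory s a := fun a ha => hs₁.1 a (by
    interval_cases a <;> decide)
  refine Spec.store_seq hS (fun _ => ?_) ?_
  · have : (Expr.mul (.get 0 (.const 2)) (.get 0 (.const 3))).eval s₁.mem = n * k := by
      simp [Expr.eval, e₁ 0 (by norm_num), inputMemory]
    rw [this]
    exact Nat.size_le.2 (hlt _ (by omega))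
  set s₂ := s₁.put 35 ((Expr.const 0).eval s₁.mem)
    ((Expr.mul (.get 0 (.const 2)) (.get 0 (.const 3))).eval s₁.mem) with hs₂
  have h₂ : s₂.mem 35 0 = n * k := by
    simp [hs₂, Expr.eval, e₁ 0 (by norm_num), inputMemory]
  have hsizeM := size_le_self (n * k)
  refine Spec.seq (Spec.size hS (v := n * k) (by decide) h₂ (by omega) (by omega)) ?_
  intro s₃ _ hs₃ h₃
  have e₃ : ∀ a < 20, s₃.mem a = I.inputMemory s a := fun a ha => by
    rw [hs₃.1 a (by interval_cases a <;> decide), hs₂, State.put_mem_of_ne (by omega), e₁ a ha]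
  have h₃M : s₃.mem 35 0 = n * k := by rw [hs₃.1 35 (by decide), h₂]
  have h₃m : s₃.mem 20 0 = sm := by
    rw [hs₃.1 20 (by decide), hs₂, State.put_mem_of_ne (by decide), h₁]
  have h₃c : s₃.coins = c := by
    rw [hs₃.2 (by decide), hs₂, State.put_coins, hs₁.2 (by decide)]
  refine Spec.seq (Spec.randomize hS h₃M (m := m) (by rw [e₃ 0 (by norm_num)]; rfl) h₃m
    (fun e => by rw [e₃ 9 (by norm_num)]; rfl) (by omega) (by omega) (by omega)
    (hlt _ (by omega)) (hlt _ (by omega)) (by omega)) ?_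
  intro s₄ _ hs₄ h₄
  rw [h₃c] at h₄
  refine Spec.seq (Spec.power hS (sm := sm) (by rw [hs₄.1 20 (by decide), h₃m]) (by omega)
    (by omega)) ?_
  intro s₅ _ hs₅ h₅
  have e₅ : ∀ a < 8, s₅.mem a = I.inputMemory s a := fun a ha => by
    rw [hs₅.1 a (by interval_cases a <;> decide), hs₄.1 a (by interval_cases a <;> decide),
      e₃ a (by omega)]
  have hden : ∀ j < m, 0 < s₅.mem 3 j := fun j hj => by
    rw [e₅ 3 (by norm_num)]
    simp [inputMemory, hj, NNRat.den_pos]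
  have hcost : ∀ j < m, s₅.mem 2 j * ((∏ j ∈ Finset.range m, s₅.mem 3 j) / s₅.mem 3 j) =
      I.scaledCost j := fun j hj => by
    rw [e₅ 3 (by norm_num), e₅ 2 (by norm_num), hprod]
    simp [inputMemory, scaledCost, hj]
  have hpow : 2 ^ z < 2 ^ word z := Nat.pow_lt_pow_right (by norm_num) (by omega)
  refine Spec.seq (Spec.scale hS (m := m) (by rw [e₅ 0 (by norm_num)]; rfl) (by omega)
    (hlt _ (by omega)) hden ?_ ?_) ?_
  · rw [e₅ 3 (by norm_num), hprod]
    have h := prod_le_two_pow_sum_size Finset.univ (fun j => (I.cost j).den)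
    refine (h.trans (Nat.pow_le_pow_right (by norm_num) ?_)).trans_lt hpow
    simp only [hz, inputSize, Finset.sum_add_distrib]
    omega
  · intro j hj
    rw [hcost j hj]
    exact (I.scaledCost_lt n k j).trans hpow
  intro s₆ _ hs₆ h₆
  have h₆C : ∀ j < m, s₆.mem 7 j = I.scaledCost j := fun j hj => by rw [h₆ j hj, hcost j hj]
  have e₆ : ∀ a < 7, s₆.mem a = I.inputMemory s a := fun a ha => by
    rw [hs₆.1 a (by interval_cases a <;> decide), e₅ a (by omega)]
  have h₆z : ∀ a ∈ [11, 14], ∀ i, s₆.mem a i = 0 := by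
    intro a ha i
    have : a = 11 ∨ a = 14 := by simpa using ha
    rcases this with rfl | rfl <;>
    rw [hs₆.1 _ (by decide), hs₅.1 _ (by decide), hs₄.1 _ (by decide), e₃ _ (by norm_num)] <;> rfl
  refine Spec.seq (Spec.cheapest hS (m := m) (N := N) (by rw [e₆ 0 (by norm_num)]; rfl)
    (by rw [e₆ 0 (by norm_num)]; rfl) (by omega) (hlt _ (by omega)) (by omega) (hlt _ (by omega))
    (h₆z 11 (by simp)) ?_) ?_
  · intro u hu
    obtain ⟨j, hj⟩ := I.covers ⟨u, hu⟩
    refine ⟨j, j.2, ?_⟩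
    rw [e₆ 1 (by norm_num), hinc u hu j j.2, hXdef, mem_learner_sets]
    exact ⟨hu, j.2, hj⟩
  intro s₇ _ hs₇ h₇
  have e₇ : ∀ a < 7, s₇.mem a = I.inputMemory s a := fun a ha => by
    rw [hs₇.1 a (by interval_cases a <;> decide), e₆ a ha]
  have h7 : s₇.mem 7 = s₆.mem 7 := hs₇.1 7 (by decide)
  have hch : ∀ u < N, s₇.mem 11 u ∈ X.sets u ∧ I.scaledCost (s₇.mem 11 u) = X.κ u := by
    intro u hu
    obtain ⟨hlt', hmem, hmin⟩ := h₇ u hu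
    rw [e₆ 1 (by norm_num), hinc u hu _ hlt'] at hmem
    refine ⟨hmem, le_antisymm ?_ (I.κ_learner_le hmem)⟩
    obtain ⟨j, hj, hj'⟩ := hX.exists_le u hu
    have hjm : j < m := Finset.mem_range.1 (hX.sets_sub u hj)
    have := hmin j hjm (by rwa [e₆ 1 (by norm_num), hinc u hu _ hjm])
    rw [h₆C _ hlt', h₆C _ hjm] at this
    exact this.trans hj'
  have hE : Env X N sm s₇.mem := by
    refine ⟨by rw [e₇ 0 (by norm_num)]; rfl, ?_, ?_, ?_, ?_, ?_, ?_⟩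
    · rw [hs₇.1 35 (by decide), hs₆.1 35 (by decide), hs₅.1 35 (by decide),
        hs₄.1 35 (by decide), h₃M]
      rfl
    · rw [hs₇.1 20 (by decide), hs₆.1 20 (by decide), hs₅.1 20 (by decide),
        hs₄.1 20 (by decide), h₃m]
    · rw [e₇ 1 (by norm_num)]
      exact hinc
    · rw [h7]
      exact h₆C
    · intro u hu
      have hm' := Finset.mem_range.1 (hX.sets_sub u (hch u hu).1)
      rw [h7, h₆C _ hm', (hch u hu).2]
    · rw [e₇ 4 (by norm_num)]
      exact hsmp
  refine Spec.seq (Spec.sides hE hB hX (by omega) (by omega) ?_) ?_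
  · rw [hs₇.1 14 (by decide)]
    exact h₆z 14 (by simp)
  intro s₈ _ hs₈ h₈
  have e₈ : ∀ a < 7, s₈.mem a = I.inputMemory s a := fun a ha => by
    rw [hs₈.1 a (by interval_cases a <;> decide), e₇ a ha]
  have h₈Z : ∀ j < m, s₈.mem 14 j ≠ 0 ↔ I.Chosen n k (fun q => (c q).toNat) (I.inputMemory s 4)
      (fun e => binVal (fun l => c (n * k + e * (5 * sm) + l)) (5 * sm)) j := by
    intro j hj
    rw [h₈ j hj]
    have hpw : s₇.mem 22 0 = 2 ^ (5 * sm) := by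
      rw [hs₇.1 22 (by decide), hs₆.1 22 (by decide), h₅]
    have hL : s₇.mem 21 0 = Nat.size (n * k) := by
      rw [hs₇.1 21 (by decide), hs₆.1 21 (by decide), hs₅.1 21 (by decide),
        hs₄.1 21 (by decide), h₃]
    rw [hpw, hL, e₇ 4 (by norm_num)]
    refine Chosen.congr I (fun q hq => ?_) (fun e he => ?_) hj
    · rw [hs₇.1 8 (by decide), hs₆.1 8 (by decide), hs₅.1 8 (by decide), h₄.1 q hq]
    · rw [hs₇.1 9 (by decide), hs₆.1 9 (by decide), hs₅.1 9 (by decide), h₄.2 e he]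
  refine (Spec.output hS (m := m) (N := N) (k := k) (by rw [e₈ 0 (by norm_num)]; rfl)
    (by rw [e₈ 0 (by norm_num)]; rfl) (by rw [e₈ 0 (by norm_num)]; rfl) (by omega)
    (hlt _ (by omega)) (by omega) (hlt _ (by omega))).mono ?_
  rintro s₉ _ _ ⟨h₉, h₁₀⟩
  refine ⟨fun j hj => by rw [h₉ j hj, h₈Z j hj], fun u hu => ?_⟩
  have h11 : s₈.mem 11 = s₇.mem 11 := hs₈.1 11 (by decide)
  rcases h₁₀ u hu with ⟨j, hj, h₁, h₂, h₃⟩ | ⟨h₁, h₂⟩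
  · rw [e₈ 1 (by norm_num), hinc u hu j hj] at h₂
    exact Or.inl ⟨j, hj, h₁, h₂, (h₈Z j hj).1 h₃⟩
  · rw [h11] at h₁
    rw [h₁]
    refine Or.inr ⟨(hch u hu).1, (hch u hu).2, fun j hj hc => ?_⟩
    have hjm := Finset.mem_range.1 (hX.sets_sub u hj)
    have := h₂ j hjm (by rwa [e₈ 1 (by norm_num), hinc u hu j hjm])
    exact (h₈Z j hjm).2 hc this

end SetSystem

/-! ### Expectations -/

section IndepExp

variable {ι α : Type} [Fintype ι] [DecidableEq ι] [Fintype α] {D : ι → PMF α}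

theorem sum_toReal_pmf (p : PMF α) : ∑ u, (p u).toReal = 1 := by
  rw [← ENNReal.toReal_sum fun u _ => p.apply_ne_top u, ← tsum_fintype (L := .unconditional _),
    p.tsum_coe]
  rfl

theorem sum_prod_toReal_pmf (D : ι → PMF α) : ∑ x : ι → α, ∏ i, (D i (x i)).toReal = 1 := by
  classical
  have := Fintype.prod_sum fun i u => (D i u).toReal
  rw [← this]
  simp [sum_toReal_pmf]

theorem indepExp_add (f g : (ι → α) → ℝ) :
    indepExp D (fun x => f x + g x) = indepExp D f + indepExp D g := by
  simp only [indepExp, mul_add, Finset.sum_add_distrib]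

theorem indepExp_const_mul (c : ℝ) (f : (ι → α) → ℝ) :
    indepExp D (fun x => c * f x) = c * indepExp D f := by
  simp only [indepExp, Finset.mul_sum]
  exact Finset.sum_congr rfl fun _ _ => by ring

theorem indepExp_const (c : ℝ) : indepExp D (fun _ => c) = c := by
  simp only [indepExp, ← Finset.sum_mul, sum_prod_toReal_pmf, one_mul]

theorem indepExp_sum {β : Type*} (s : Finset β) (f : β → (ι → α) → ℝ) :
    indepExp D (fun x => ∑ b ∈ s, f b x) = ∑ b ∈ s, indepExp D (f b) := by
  simp only [indepExp, Finset.mul_sum]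
  exact Finset.sum_comm

/-- Outcomes outside the supports have weight zero. This is how feasibility, which is required only
almost surely, enters the expectations. -/
theorem indepExp_mono {f g : (ι → α) → ℝ}
    (h : ∀ x, (∀ i, x i ∈ (D i).support) → f x ≤ g x) : indepExp D f ≤ indepExp D g := by
  refine Finset.sum_le_sum fun x _ => ?_
  by_cases hx : ∀ i, x i ∈ (D i).support
  · exact mul_le_mul_of_nonneg_left (h x hx) (Finset.prod_nonneg fun _ _ => ENNReal.toReal_nonneg)
  · push Not at hx
    obtain ⟨i, hi⟩ := hx
    have : ∏ i, (D i (x i)).toReal = 0 := Finset.prod_eq_zero (Finset.mem_univ i) (by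
      rw [(PMF.apply_eq_zero_iff _ _).2 hi]
      rfl)
    simp [this]

/-- The marginal distribution on an injective family of coordinates. -/
theorem indepExp_comp {κ : Type} [Fintype κ] [DecidableEq κ] {e : κ → ι}
    (he : Function.Injective e) (g : (κ → α) → ℝ) :
    indepExp D (fun x => g (x ∘ e)) = indepExp (fun b => D (e b)) g := by
  classical
  -- Split the coordinates into the range of `e` and the rest; the weights of the rest sum to one.
  let φ := Equiv.piEquivPiSubtypeProd (fun i => i ∈ Set.range e) (fun _ : ι => α)
  let ψ : κ ≃ {i // i ∈ Set.range e} := Equiv.ofInjective e he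
  have hprod : ∀ x : ι → α, ∏ i, (D i (x i)).toReal =
      (∏ i : {i // i ∈ Set.range e}, (D i (x i)).toReal) *
        ∏ i : {i // i ∉ Set.range e}, (D i (x i)).toReal := fun x => by
    convert (Fintype.prod_subtype_mul_prod_subtype (fun i => i ∈ Set.range e)
      fun i => (D i (x i)).toReal).symm
  have h₁ : indepExp D (fun x => g (x ∘ e)) =
      ∑ z : ({i // i ∈ Set.range e} → α) × ({i // i ∉ Set.range e} → α),
        ((∏ i, (D i.1 (z.1 i)).toReal) * ∏ i, (D i.1 (z.2 i)).toReal) * g (z.1 ∘ ψ) := by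
    unfold indepExp
    refine Fintype.sum_equiv φ _ _ fun x => ?_
    rw [hprod]
    rfl
  rw [h₁, Fintype.sum_prod_type]
  have h₂ : ∀ z₁ : {i // i ∈ Set.range e} → α,
      ∑ z₂ : {i // i ∉ Set.range e} → α,
        ((∏ i, (D i.1 (z₁ i)).toReal) * ∏ i, (D i.1 (z₂ i)).toReal) * g (z₁ ∘ ψ) =
      (∏ i, (D i.1 (z₁ i)).toReal) * g (z₁ ∘ ψ) := by
    intro z₁
    rw [← Finset.sum_mul, ← Finset.mul_sum,
      sum_prod_toReal_pmf fun i : {i // i ∉ Set.range e} => D i.1, mul_one]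
  simp only [h₂]
  unfold indepExp
  refine Fintype.sum_equiv (Equiv.arrowCongr ψ.symm (Equiv.refl α)) _ _ fun z => ?_
  rw [← Equiv.prod_comp ψ]
  rfl

theorem indepExp_eval (i : ι) (h : α → ℝ) :
    indepExp D (fun x => h (x i)) = ∑ u, (D i u).toReal * h u := by
  have h₁ := indepExp_comp (D := D) (e := fun _ : Unit => i) (fun _ _ _ => rfl)
    fun z => h (z ())
  refine h₁.trans ?_
  unfold indepExp
  refine Fintype.sum_equiv (Equiv.funUnique Unit α) _ _ fun z => ?_
  simp

/-- An independent copy of a coordinate may replace it, if the rest does not depend on it. -/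
theorem sum_mul_indepExp_swap (q : ι) (h : (ι → α) → α → ℝ)
    (hh : ∀ s u w, h (Function.update s q w) u = h s u) :
    ∑ u, (D q u).toReal * indepExp D (fun s => h s u) = indepExp D (fun s => h s (s q)) := by
  have hw : ∀ (s : ι → α) (u : α),
      (∏ i, (D i (Function.update s q u i)).toReal) * (D q (s q)).toReal =
      (∏ i, (D i (s i)).toReal) * (D q u).toReal := by
    intro s u
    rw [← Finset.mul_prod_erase _ _ (Finset.mem_univ q),
      ← Finset.mul_prod_erase _ (fun i => (D i (s i)).toReal) (Finset.mem_univ q),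
      Function.update_self]
    have : ∏ i ∈ Finset.univ.erase q, (D i (Function.update s q u i)).toReal =
        ∏ i ∈ Finset.univ.erase q, (D i (s i)).toReal :=
      Finset.prod_congr rfl fun i hi => by rw [Function.update_of_ne (Finset.ne_of_mem_erase hi)]
    rw [this]
    ring
  -- Exchanging the coordinate q with the extra copy is an involution; it preserves the weights by
  -- `hw` and the first argument's influence on `h` by `hh`.
  let φ : (ι → α) × α ≃ (ι → α) × α := Function.Involutive.toPerm
    (fun z => (Function.update z.1 q z.2, z.1 q)) fun z => by simp
  have h₁ : ∑ u, (D q u).toReal * indepExp D (fun s => h s u) =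
      ∑ z : (ι → α) × α, (∏ i, (D i (z.1 i)).toReal) * (D q z.2).toReal * h z.1 z.2 := by
    rw [Fintype.sum_prod_type, Finset.sum_comm]
    refine Finset.sum_congr rfl fun u _ => ?_
    simp only [indepExp, Finset.mul_sum]
    exact Finset.sum_congr rfl fun _ _ => by ring
  have h₂ : ∑ z : (ι → α) × α, (∏ i, (D i (z.1 i)).toReal) * (D q z.2).toReal * h z.1 z.2 =
      ∑ z : (ι → α) × α, (∏ i, (D i (z.1 i)).toReal) * (D q z.2).toReal * h z.1 (z.1 q) := by
    refine Fintype.sum_equiv φ _ _ fun z => ?_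
    change _ = (∏ i, (D i (Function.update z.1 q z.2 i)).toReal) * (D q (z.1 q)).toReal *
      h (Function.update z.1 q z.2) (Function.update z.1 q z.2 q)
    rw [hw, hh, Function.update_self]
  rw [h₁, h₂, Fintype.sum_prod_type]
  refine Finset.sum_congr rfl fun s _ => ?_
  simp only
  rw [← Finset.sum_mul, ← Finset.mul_sum, sum_toReal_pmf, mul_one]

end IndepExp

/-- Average over a finite type. -/
noncomputable def avg {α : Type*} [Fintype α] (f : α → ℝ) : ℝ := (∑ x, f x) / Fintype.card α

section Avg

variable {α β : Type*} [Fintype α] [Fintype β]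

theorem avg_mono {f g : α → ℝ} (h : ∀ x, f x ≤ g x) : avg f ≤ avg g :=
  div_le_div_of_nonneg_right (Finset.sum_le_sum fun x _ => h x) (by positivity)

theorem avg_add (f g : α → ℝ) : avg (fun x => f x + g x) = avg f + avg g := by
  simp only [avg, Finset.sum_add_distrib, add_div]

theorem avg_const_mul (c : ℝ) (f : α → ℝ) : avg (fun x => c * f x) = c * avg f := by
  simp only [avg, ← Finset.mul_sum, mul_div_assoc]

theorem avg_sum {γ : Type*} (s : Finset γ) (f : γ → α → ℝ) :
    avg (fun x => ∑ b ∈ s, f b x) = ∑ b ∈ s, avg (f b) := by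
  simp only [avg, Finset.sum_div]
  rw [Finset.sum_comm]

theorem avg_const [Nonempty α] (c : ℝ) : avg (fun _ : α => c) = c := by
  have : (Fintype.card α : ℝ) ≠ 0 := by exact_mod_cast Fintype.card_ne_zero
  simp [avg]

theorem avg_equiv (e : α ≃ β) (f : β → ℝ) : avg (fun x => f (e x)) = avg f := by
  simp only [avg, Fintype.card_congr e]
  rw [Equiv.sum_comp e f]

theorem avg_prod (f : α × β → ℝ) : avg f = avg (fun x => avg fun y => f (x, y)) := by
  simp only [avg, Fintype.sum_prod_type, Fintype.card_prod, Finset.sum_div]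
  push_cast
  refine Finset.sum_congr rfl fun x _ => Finset.sum_congr rfl fun y _ => ?_
  rw [div_div, mul_comm (Fintype.card α : ℝ)]

theorem coinExp_eq_avg {T : ℕ} (f : (Fin T → Bool) → ℝ) : coinExp f = avg f := by
  simp [coinExp, avg]

/-- Independence of distinct coordinates. -/
theorem avg_pi_prod {ι γ : Type*} [Fintype ι] [DecidableEq ι] [Nonempty α] {i : γ → ι}
    (hi : Function.Injective i) (J : Finset γ) (f : γ → α → ℝ) :
    avg (fun y : ι → α => ∏ b ∈ J, f b (y (i b))) = ∏ b ∈ J, avg (f b) := by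
  classical
  have hcard : (Fintype.card α : ℝ) ≠ 0 := by exact_mod_cast Fintype.card_ne_zero
  -- All factors that read the coordinate e; by injectivity of `i` there is at most one.
  let F : ι → α → ℝ := fun e x => ∏ b ∈ J, if i b = e then f b x else 1
  have h₁ : ∀ y : ι → α, ∏ b ∈ J, f b (y (i b)) = ∏ e, F e (y e) := by
    intro y
    simp only [F]
    rw [Finset.prod_comm]
    refine Finset.prod_congr rfl fun b _ => ?_
    simp
  have h₂ : ∀ e, avg (F e) = ∏ b ∈ J, if i b = e then avg (f b) else 1 := by
    intro e
    by_cases h : ∃ b ∈ J, i b = e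
    · obtain ⟨b, hb, rfl⟩ := h
      have : ∀ (g : γ → ℝ), ∏ b' ∈ J, (if i b' = i b then g b' else 1) = g b := by
        intro g
        rw [Finset.prod_eq_single b]
        · simp
        · intro b' _ hne
          rw [if_neg fun h => hne (hi h)]
        · exact fun h => absurd hb h
      simp only [F, this fun b' => avg (f b')]
      congr 1
      funext x
      exact this fun b' => f b' x
    · push Not at h
      have : ∀ g : γ → ℝ, ∏ b ∈ J, (if i b = e then g b else 1) = 1 := fun g =>
        Finset.prod_eq_one fun b hb => if_neg (h b hb)
      simp only [F, this]
      rw [avg_const]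
  have h₃ : avg (fun y : ι → α => ∏ e, F e (y e)) = ∏ e, avg (F e) := by
    simp only [avg, Fintype.card_pi, Finset.prod_const, Finset.card_univ, Finset.prod_div_distrib]
    rw [Fintype.prod_sum]
    push_cast
    simp
  simp only [h₁, h₃, h₂]
  rw [Finset.prod_comm]
  refine Finset.prod_congr rfl fun b _ => ?_
  simp

theorem avg_pi_eval {ι : Type*} [Fintype ι] [DecidableEq ι] [Nonempty α] (e : ι) (f : α → ℝ) :
    avg (fun y : ι → α => f (y e)) = avg f := by
  have := avg_pi_prod (α := α) (i := fun _ : Unit => e) (fun _ _ _ => rfl) {()} fun _ => f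
  simpa using this

end Avg

/-- Extension of a sequence of coins by zeros. -/
def padCoins {T : ℕ} (r : Fin T → Bool) (l : ℕ) : Bool := if h : l < T then r ⟨l, h⟩ else false

/-- The coins split into independent blocks. -/
theorem coinExp_blocks {M E R T : ℕ} (hT : M + E * R ≤ T)
    (g : (Fin M → Bool) → (Fin E → Fin R → Bool) → ℝ) :
    coinExp (fun r : Fin T → Bool =>
      g (fun q => padCoins r q) (fun e l => padCoins r (M + e * R + l))) =
    avg (fun a => avg (g a)) := by
  obtain ⟨T', rfl⟩ := Nat.exists_eq_add_of_le hT
  let φ : (Fin M ⊕ Fin E × Fin R) ⊕ Fin T' ≃ Fin (M + E * R + T') :=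
    ((Equiv.sumCongr ((Equiv.sumCongr (Equiv.refl _) finProdFinEquiv).trans finSumFinEquiv)
      (Equiv.refl _)).trans finSumFinEquiv)
  have hφ₁ : ∀ q : Fin M, (φ (.inl (.inl q)) : ℕ) = q := fun q => by
    simp [φ]
  have hφ₂ : ∀ e l, (φ (.inl (.inr (e, l))) : ℕ) = M + e * R + l := fun e l => by
    simp [φ]
    ring
  have hp : ∀ (r : Fin (M + E * R + T') → Bool) x, padCoins r (φ x : ℕ) = r (φ x) := fun r x => by
    simp [padCoins]
  let ψ : (Fin (M + E * R + T') → Bool) ≃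
      (((Fin M → Bool) × (Fin E → Fin R → Bool)) × (Fin T' → Bool)) :=
    ((Equiv.arrowCongr φ.symm (Equiv.refl Bool)).trans (Equiv.sumArrowEquivProdArrow _ _ _)).trans
      (Equiv.prodCongr ((Equiv.sumArrowEquivProdArrow _ _ _).trans
        (Equiv.prodCongr (Equiv.refl _) (Equiv.curry _ _ _))) (Equiv.refl _))
  rw [coinExp_eq_avg]
  have h₁ : ∀ r : Fin (M + E * R + T') → Bool,
      g (fun q => padCoins r q) (fun e l => padCoins r (M + e * R + l)) =
      (fun z : ((Fin M → Bool) × (Fin E → Fin R → Bool)) × (Fin T' → Bool) =>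
        g z.1.1 z.1.2) (ψ r) := by
    intro r
    have e₁ : (fun q : Fin M => padCoins r q) = (ψ r).1.1 := by
      funext q
      rw [← hφ₁, hp]
      rfl
    have e₂ : (fun (e : Fin E) (l : Fin R) => padCoins r (M + e * R + l)) = (ψ r).1.2 := by
      funext e l
      rw [← hφ₂, hp]
      rfl
    rw [e₁, e₂]
  simp only [h₁]
  rw [avg_equiv ψ (fun z => g z.1.1 z.1.2), avg_prod]
  simp only [avg_const]
  rw [avg_prod]

/-- The number with binary digits `x`. -/
def digitsVal {R : ℕ} (x : Fin R → Bool) : ℕ := binVal (padCoins x) R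

theorem binVal_congr {c c' : ℕ → Bool} {l : ℕ} (h : ∀ i < l, c i = c' i) :
    binVal c l = binVal c' l := by
  induction l with
  | zero => rfl
  | succ l ih => rw [binVal, binVal, ih fun i hi => h i (by omega), h l (by omega)]

theorem binVal_inj {c c' : ℕ → Bool} {l : ℕ} (h : binVal c l = binVal c' l) :
    ∀ i < l, c i = c' i := by
  induction l with
  | zero => simp
  | succ l ih =>
    rw [binVal, binVal] at h
    have h₁ := Bool.toNat_le (c l)
    have h₂ := Bool.toNat_le (c' l)
    intro i hi
    rcases Nat.lt_succ_iff_lt_or_eq.1 hi with hi | rfl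
    · exact ih (by omega) i hi
    · have : (c i).toNat = (c' i).toNat := by omega
      cases hc : c i <;> cases hc' : c' i <;> simp_all

/-- Random digits give a uniform random number. -/
theorem avg_digitsVal {R : ℕ} (t : ℕ) :
    avg (fun x : Fin R → Bool => if digitsVal x < t then (1 : ℝ) else 0) =
      (min t (2 ^ R) : ℕ) / 2 ^ R := by
  -- Digits are determined by the number, and both types have 2^R elements, so uniform digits give a
  -- uniform number.
  let f : (Fin R → Bool) → Fin (2 ^ R) := fun x => ⟨digitsVal x, binVal_lt _ _⟩
  have hf : Function.Injective f := by
    intro x x' h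
    have h₁ : binVal (padCoins x) R = binVal (padCoins x') R := congrArg Fin.val h
    funext l
    have := binVal_inj h₁ l l.2
    simpa [padCoins] using this
  have hb : Function.Bijective f :=
    (Fintype.bijective_iff_injective_and_card f).2 ⟨hf, by simp⟩
  have h₁ : ∑ x : Fin R → Bool, (if digitsVal x < t then (1 : ℝ) else 0) =
      ∑ y : Fin (2 ^ R), if (y : ℕ) < t then (1 : ℝ) else 0 :=
    Fintype.sum_bijective f hb _ _ fun x => rfl
  unfold avg
  rw [h₁, Finset.sum_boole]
  congr 1
  · rw [Fin.card_filter_val_lt, min_comm]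
  · simp

/-! ### The rounding -/

namespace Learner

variable {X : Learner} {N sm : ℕ} {W : ℕ → Option ℕ} {st : LearnerState}

open Classical in
/-- Probability that the set `j` is picked. -/
noncomputable def pickProb (X : Learner) (st : LearnerState) (sm L j : ℕ) : ℝ :=
  avg (fun x : Fin (5 * sm) → Bool =>
    if X.Picked st (2 ^ (5 * sm)) L (digitsVal x) j then (1 : ℝ) else 0)

theorem Proper.total_pos (hX : X.Proper N sm) (st : LearnerState) : 0 < X.m * X.total st :=
  Nat.mul_pos hX.m_pos (hX.m_pos.trans_le (X.le_total st))

/-- With G = m·total and P = 2^(5·sm), the accepted numbers are those below ⌈P·L·wt/G⌉, and there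
are P numbers in all. -/
theorem pickProb_eq (hX : X.Proper N sm) (L j : ℕ) :
    X.pickProb st sm L j = (min ((2 ^ (5 * sm) * L * X.wt st j + X.m * X.total st - 1) /
      (X.m * X.total st)) (2 ^ (5 * sm)) : ℕ) / 2 ^ (5 * sm) := by
  have hG := hX.total_pos st
  rw [← avg_digitsVal]
  unfold pickProb
  congr 1
  funext x
  have : X.Picked st (2 ^ (5 * sm)) L (digitsVal x) j ↔ digitsVal x <
      (2 ^ (5 * sm) * L * X.wt st j + X.m * X.total st - 1) / (X.m * X.total st) := by
    rw [Nat.lt_iff_add_one_le (m := digitsVal x), Nat.le_div_iff_mul_le hG, add_mul, one_mul]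
    unfold Picked
    omega
  simp only [this]

/-- This is why 5·sm random bits are used: the grid of probabilities is at least as fine as the unit
1/(m·total) of the fractional values. -/
theorem Inv.total_le_two_pow (h : X.Inv W st) (hX : X.Proper N sm) :
    X.m * X.total st ≤ 2 ^ (5 * sm) := by
  calc X.m * X.total st ≤ 2 ^ sm * (2 ^ sm * 2 ^ (3 * sm)) :=
        Nat.mul_le_mul hX.m_lt.le ((h.total_le hX).trans (Nat.mul_le_mul_right _ hX.m_lt.le))
    _ = 2 ^ (5 * sm) := by
      rw [← pow_add, ← pow_add]
      congr 1
      ring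

/-- The ceiling adds less than one grid step. If wt ≥ 1, then P·L·wt ≥ G and a factor 2 absorbs it;
if wt = 0, the probability is exactly 0. -/
theorem Inv.pickProb_le (h : X.Inv W st) (hX : X.Proper N sm) {L : ℕ} (hL : 0 < L) (j : ℕ) :
    X.pickProb st sm L j ≤ 2 * L * X.wt st j / (X.m * X.total st) := by
  rw [pickProb_eq hX]
  have hG := hX.total_pos st
  have hGP := h.total_le_two_pow hX
  set G := X.m * X.total st with hGdef
  have hGr : (X.m : ℝ) * X.total st = G := by
    rw [hGdef]
    push_cast
    rfl
  have hG0 : (0 : ℝ) < G := by exact_mod_cast hG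
  rw [hGr, div_le_div_iff₀ (by positivity) hG0]
  have key : min ((2 ^ (5 * sm) * L * X.wt st j + G - 1) / G) (2 ^ (5 * sm)) * G ≤
      2 * L * X.wt st j * 2 ^ (5 * sm) := by
    refine (Nat.mul_le_mul_right _ (min_le_left _ _)).trans ?_
    rcases Nat.eq_zero_or_pos (X.wt st j) with hw | hw
    · have : (G - 1) / G = 0 := Nat.div_eq_of_lt (by omega)
      simp [hw, this]
    · refine (Nat.div_mul_le_self _ _).trans ?_
      have h₁ : 2 ^ (5 * sm) * 1 ≤ 2 ^ (5 * sm) * (L * X.wt st j) :=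
        Nat.mul_le_mul_left _ (Nat.mul_pos hL hw)
      have h₂ : 2 * L * X.wt st j * 2 ^ (5 * sm) =
        2 ^ (5 * sm) * (L * X.wt st j) + 2 ^ (5 * sm) * (L * X.wt st j) := by ring
      rw [mul_assoc (2 ^ (5 * sm)) L]
      omega
  exact_mod_cast key

/-- Rounding up only helps here: the probability is at least min(1, L·wt/G), and 1 − x ≤ e^(−x). -/
theorem Inv.one_sub_pickProb_le (hX : X.Proper N sm) (L j : ℕ) :
    1 - X.pickProb st sm L j ≤ Real.exp (-(L * X.wt st j / (X.m * X.total st))) := by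
  rw [pickProb_eq hX]
  have hG := hX.total_pos st
  set G := X.m * X.total st with hGdef
  have hGr : (X.m : ℝ) * X.total st = G := by
    rw [hGdef]
    push_cast
    rfl
  have hG0 : (0 : ℝ) < G := by exact_mod_cast hG
  rw [hGr]
  set t := (2 ^ (5 * sm) * L * X.wt st j + G - 1) / G with ht
  rcases _root_.le_total t (2 ^ (5 * sm)) with hle | hle
  · rw [min_eq_left hle]
    have h₁ : 2 ^ (5 * sm) * L * X.wt st j ≤ t * G := by
      have h₂ := Nat.div_add_mod (2 ^ (5 * sm) * L * X.wt st j + G - 1) G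
      have h₃ := Nat.mod_lt (2 ^ (5 * sm) * L * X.wt st j + G - 1) hG
      rw [← ht, mul_comm] at h₂
      omega
    have h₂ : (L : ℝ) * X.wt st j / G ≤ t / 2 ^ (5 * sm) := by
      rw [div_le_div_iff₀ hG0 (by positivity)]
      have : (2 : ℝ) ^ (5 * sm) * L * X.wt st j ≤ t * G := by exact_mod_cast h₁
      linarith
    have h₃ := Real.add_one_le_exp (-((L : ℝ) * X.wt st j / G))
    linarith
  · rw [min_eq_right hle]
    have : ((2 ^ (5 * sm) : ℕ) : ℝ) / 2 ^ (5 * sm) = 1 := by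
      push_cast
      exact div_self (by positivity)
    rw [this, sub_self]
    exact (Real.exp_pos _).le

theorem C_mul_wt_le (st : LearnerState) (j : ℕ) :
    X.C j * X.wt st j ≤ 16 * X.m * st.β * X.pw st j :=
  Nat.mul_div_le _ _

/-- Expected cost of the picked sets. -/
theorem Inv.sum_pickProb_le (h : X.Inv W st) (hX : X.Proper N sm) {L : ℕ} (hL : 0 < L)
    {F : Finset ℕ} (hF : X.IsCover W F) :
    ∑ j ∈ Finset.range X.m, (X.C j : ℝ) * X.pickProb st sm L j ≤
      64 * L * (∑ j ∈ F, X.C j : ℕ) := by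
  have hG0 : (0 : ℝ) < X.m * X.total st := by exact_mod_cast hX.total_pos st
  have h₁ : ∀ j ∈ Finset.range X.m, (X.C j : ℝ) * X.pickProb st sm L j ≤
      (2 * L / (X.m * X.total st)) * (16 * X.m * st.β) * X.pw st j := by
    intro j _
    refine (mul_le_mul_of_nonneg_left (h.pickProb_le hX hL j) (by positivity)).trans ?_
    have h₂ : (X.C j : ℝ) * X.wt st j ≤ 16 * X.m * st.β * X.pw st j := by
      exact_mod_cast X.C_mul_wt_le st j
    calc (X.C j : ℝ) * (2 * L * X.wt st j / (X.m * X.total st)) =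
        (2 * L / (X.m * X.total st)) * (X.C j * X.wt st j) := by ring
      _ ≤ (2 * L / (X.m * X.total st)) * (16 * X.m * st.β * X.pw st j) :=
        mul_le_mul_of_nonneg_left h₂ (by positivity)
      _ = _ := by ring
  refine (Finset.sum_le_sum h₁).trans ?_
  rw [← Finset.mul_sum]
  have h₂ : ∑ j ∈ Finset.range X.m, (X.pw st j : ℝ) = X.total st := by
    unfold total
    push_cast
    rfl
  have h₃ : (st.β : ℝ) ≤ 2 * (∑ j ∈ F, X.C j : ℕ) := by exact_mod_cast h.β_le F hF
  have hm : (0 : ℝ) < X.m := by exact_mod_cast hX.m_pos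
  have ht : (0 : ℝ) < X.total st := by
    exact_mod_cast hX.m_pos.trans_le (X.le_total st)
  rw [h₂]
  -- The fractional cover costs at most 16β and the rounding contributes 2L; finally β ≤ 2c(F)
  -- yields 64L.
  have h₄ : 2 * (L : ℝ) / (X.m * X.total st) * (16 * X.m * st.β) * X.total st =
      32 * L * st.β := by
    field_simp
    ring
  rw [h₄]
  nlinarith [mul_le_mul_of_nonneg_left h₃ (by positivity : (0 : ℝ) ≤ 32 * L)]

end Learner

/-! ### The two sides of the samples -/

namespace SetSystem

variable {N m : ℕ} (I : SetSystem N m)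

/-- The sides of the samples. -/
def mask {M : ℕ} (a : Fin M → Bool) (q : ℕ) : ℕ := (padCoins a q).toNat

/-- The random numbers used for the rounding. -/
def numbers {R : ℕ} (y : Fin (2 * m) → Fin R → Bool) (e : ℕ) : ℕ :=
  if h : e < 2 * m then digitsVal (y ⟨e, h⟩) else 0

variable {n k : ℕ}

/-- The samples of one side. -/
noncomputable def sideSamples (s : Fin n × Fin k → Fin N) (a : Fin (n * k) → Bool) (σ : ℕ) :
    ℕ → Option ℕ :=
  (I.learner (n * k)).samples (mask a) (I.inputMemory s 4) σ

/-- The final state of the learner of one side. -/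
noncomputable def sideState (s : Fin n × Fin k → Fin N) (a : Fin (n * k) → Bool) (σ : ℕ) :
    LearnerState := (I.learner (n * k)).final (Nat.size m) (I.sideSamples s a σ)

theorem inputMemory_sample (s : Fin n × Fin k → Fin N) (q : Fin n × Fin k) :
    I.inputMemory s 4 (finProdFinEquiv q : Fin (n * k)) = s q := by
  obtain ⟨t, i⟩ := q
  have hk : 0 < k := (Nat.zero_le _).trans_lt i.2
  have h₁ : ((i : ℕ) + k * t) / k = t := by
    rw [Nat.add_mul_div_left _ _ hk, Nat.div_eq_of_lt i.2, zero_add]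
  have h₂ : ((i : ℕ) + k * t) % k = i := by
    rw [Nat.add_mul_mod_self_left, Nat.mod_eq_of_lt i.2]
  simp only [inputMemory, finProdFinEquiv_apply_val, h₁, h₂, Fin.is_lt, and_self, dif_pos]

theorem mask_val {M : ℕ} (a : Fin M → Bool) (q : Fin M) : mask a q = (a q).toNat := by
  simp [mask, padCoins]

theorem sideSamples_val (s : Fin n × Fin k → Fin N) (a : Fin (n * k) → Bool) (σ : ℕ)
    (q : Fin n × Fin k) : I.sideSamples s a σ (finProdFinEquiv q : Fin (n * k)) =
      if (a (finProdFinEquiv q)).toNat = σ then some ((s q : Fin N) : ℕ) else none := by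
  have h : ((finProdFinEquiv q : Fin (n * k)) : ℕ) < (I.learner (n * k)).M := Fin.is_lt _
  rw [sideSamples, Learner.samples, mask_val, inputMemory_sample]
  simp only [h, true_and]

theorem sideSamples_eq_some {s : Fin n × Fin k → Fin N} {a : Fin (n * k) → Bool} {σ q u : ℕ}
    (h : I.sideSamples s a σ q = some u) :
    ∃ q' : Fin n × Fin k, ((finProdFinEquiv q' : Fin (n * k)) : ℕ) = q ∧ (s q' : ℕ) = u := by
  have hq : q < n * k := by
    rw [sideSamples, Learner.samples] at h
    split at h
    case isTrue h' => exact h'.1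
    case isFalse => cases h
  obtain ⟨q', hq'⟩ := finProdFinEquiv.surjective (⟨q, hq⟩ : Fin (n * k))
  have hv : ((finProdFinEquiv q' : Fin (n * k)) : ℕ) = q := congrArg Fin.val hq'
  refine ⟨q', hv, ?_⟩
  rw [← hv, sideSamples_val] at h
  split at h
  case isTrue => simpa using h
  case isFalse => cases h

theorem sideSamples_lt {s : Fin n × Fin k → Fin N} {a : Fin (n * k) → Bool} {σ : ℕ} :
    ∀ q u, I.sideSamples s a σ q = some u → u < N := fun q u h => by
  obtain ⟨q', _, rfl⟩ := I.sideSamples_eq_some h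
  exact Fin.is_lt _

theorem sideSamples_ext {s : Fin n × Fin k → Fin N} {a : Fin (n * k) → Bool} {σ : ℕ}
    {W : ℕ → Option ℕ} (hW : ∀ q, ¬ q < n * k → W q = none)
    (h : ∀ q, W (finProdFinEquiv q : Fin (n * k)) =
      if (a (finProdFinEquiv q)).toNat = σ then some ((s q : Fin N) : ℕ) else none) :
    W = I.sideSamples s a σ := by
  funext q
  by_cases hq : q < n * k
  · obtain ⟨q', hq'⟩ := finProdFinEquiv.surjective (⟨q, hq⟩ : Fin (n * k))
    have hv : ((finProdFinEquiv q' : Fin (n * k)) : ℕ) = q := congrArg Fin.val hq'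
    rw [← hv, h, sideSamples_val]
  · rw [hW q hq, sideSamples, Learner.samples, if_neg]
    exact fun h => hq h.1

theorem sideSamples_none {s : Fin n × Fin k → Fin N} {a : Fin (n * k) → Bool} {σ q : ℕ}
    (hq : ¬ q < n * k) : I.sideSamples s a σ q = none := by
  rw [sideSamples, Learner.samples, if_neg]
  exact fun h => hq h.1

/-- The other side does not look at a sample. -/
theorem sideSamples_update_sample (s : Fin n × Fin k → Fin N) (a : Fin (n * k) → Bool)
    (q : Fin n × Fin k) (w : Fin N) :
    I.sideSamples (Function.update s q w) a (!a (finProdFinEquiv q)).toNat =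
      I.sideSamples s a (!a (finProdFinEquiv q)).toNat := by
  refine I.sideSamples_ext (fun q hq => I.sideSamples_none hq) fun q' => ?_
  rw [sideSamples_val]
  by_cases h : q' = q
  · subst h
    have : ¬ (a (finProdFinEquiv q')).toNat = (!a (finProdFinEquiv q')).toNat := by
      cases a (finProdFinEquiv q') <;> simp
    rw [if_neg this, if_neg this]
  · rw [Function.update_of_ne h]

/-- Moving a sample to the other side removes it. -/
theorem sideSamples_update_mask (s : Fin n × Fin k → Fin N) (a : Fin (n * k) → Bool)
    (q : Fin n × Fin k) :
    I.sideSamples s (Function.update a (finProdFinEquiv q) (!a (finProdFinEquiv q)))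
      (a (finProdFinEquiv q)).toNat =
      Function.update (I.sideSamples s a (a (finProdFinEquiv q)).toNat)
        (finProdFinEquiv q : Fin (n * k)) none := by
  symm
  refine I.sideSamples_ext (fun q' hq => ?_) fun q' => ?_
  · rw [Function.update_of_ne, I.sideSamples_none hq]
    rintro rfl
    exact hq (Fin.is_lt _)
  · by_cases h : q' = q
    · subst h
      rw [Function.update_self, Function.update_self, if_neg]
      cases a (finProdFinEquiv q') <;> simp
    · have h₁ : finProdFinEquiv q' ≠ finProdFinEquiv q := fun h' => h (finProdFinEquiv.injective h')
      rw [Function.update_of_ne (fun h' => h₁ (Fin.ext h')), sideSamples_val,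
        Function.update_of_ne h₁]

end SetSystem

/-! ### Expected cost of the algorithm -/

namespace SetSystem

section Expectation

open scoped Classical

variable {N m : ℕ} (I : SetSystem N m) {n k : ℕ}

/-- `F` covers all samples. -/
def CoversAll (I : SetSystem N m) (s : Fin n × Fin k → Fin N) (F : Finset (Fin m)) : Prop :=
  ∀ q, ∃ j ∈ F, s q ∈ I.sets j

/-- Cost of a subcollection in multiples of the common denominator. -/
def scaledCostOf (F : Finset (Fin m)) : ℕ := ∑ j ∈ F, I.scaledCost j

theorem CoversAll.isCover {I : SetSystem N m} {s : Fin n × Fin k → Fin N} {F : Finset (Fin m)}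
    (h : I.CoversAll s F) (a : Fin (n * k) → Bool) (σ : ℕ) :
    (I.learner (n * k)).IsCover (I.sideSamples s a σ) (F.map Fin.valEmbedding) := by
  intro q _ u hu
  obtain ⟨q', _, rfl⟩ := I.sideSamples_eq_some hu
  obtain ⟨j, hj, hj'⟩ := h q'
  exact ⟨j, Finset.mem_map_of_mem _ hj, I.mem_learner_sets.2 ⟨Fin.is_lt _, j.2, hj'⟩⟩

theorem sum_map_val (F : Finset (Fin m)) :
    ∑ j ∈ F.map Fin.valEmbedding, (I.learner (n * k)).C j = I.scaledCostOf F := by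
  rw [Finset.sum_map]
  rfl

theorem CoversAll.κ_le {I : SetSystem N m} {s : Fin n × Fin k → Fin N} {F : Finset (Fin m)}
    (h : I.CoversAll s F) (q : Fin n × Fin k) :
    (I.learner (n * k)).κ (s q) ≤ I.scaledCostOf F := by
  obtain ⟨j, hj, hj'⟩ := h q
  exact (I.κ_learner_le (M := n * k) (I.mem_learner_sets.2 ⟨(s q).2, j.2, hj'⟩)).trans
    (Finset.single_le_sum (f := fun j : Fin m => I.scaledCost j) (fun _ _ => Nat.zero_le _) hj)

/-- Samples of one side that are missed by the learner of the other side. -/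
theorem avg_missed_le (hm : 0 < m) {s : Fin n × Fin k → Fin N} {F : Finset (Fin m)}
    (hF : I.CoversAll s F) :
    ∑ q, avg (fun a : Fin (n * k) → Bool =>
      if (I.learner (n * k)).Missed (I.sideState s a (!a (finProdFinEquiv q)).toNat) (s q)
      then ((I.learner (n * k)).κ (s q) : ℝ) else 0) ≤
    2 * ((4 * (5 * Nat.size m) + 2) * I.scaledCostOf F : ℕ) := by
  set X := I.learner (n * k) with hXdef
  -- Moves the sample q to the other side; as a bijection of the masks it preserves averages.
  let flip : Fin n × Fin k → (Fin (n * k) → Bool) ≃ (Fin (n * k) → Bool) := fun q =>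
    Function.Involutive.toPerm
      (fun a => Function.update a (finProdFinEquiv q) (!a (finProdFinEquiv q))) fun a => by simp
  -- Leave-one-out loss of the sample q on the side σ, zero if q is not on that side.
  let T : (Fin (n * k) → Bool) → ℕ → ℕ → ℕ := fun a σ q =>
    (I.sideSamples s a σ q).elim 0 fun u =>
      if X.Missed (X.final (Nat.size m) (Function.update (I.sideSamples s a σ) q none)) u
      then X.κ u else 0
  have hT : ∀ a σ, ∑ q : Fin n × Fin k, T a σ (finProdFinEquiv q : Fin (n * k)) ≤
      (4 * (5 * Nat.size m) + 2) * I.scaledCostOf F := by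
    intro a σ
    have h := Learner.leave_one_out (I.learner_proper hm (n * k))
      (I.sideSamples_lt (s := s) (a := a) (σ := σ)) (hF.isCover a σ)
    rw [sum_map_val] at h
    refine le_trans (le_of_eq ?_) h
    rw [Equiv.sum_comp finProdFinEquiv fun q : Fin (n * k) => T a σ q,
      Fin.sum_univ_eq_sum_range]
    rfl
  calc _ = ∑ q, avg (fun a : Fin (n * k) → Bool =>
      if X.Missed (I.sideState s (flip q a) (!flip q a (finProdFinEquiv q)).toNat) (s q)
      then (X.κ (s q) : ℝ) else 0) :=
        Finset.sum_congr rfl fun q _ => (avg_equiv (flip q) _).symm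
    _ ≤ ∑ q : Fin n × Fin k, avg (fun a : Fin (n * k) → Bool =>
        ((T a 0 (finProdFinEquiv q : Fin (n * k)) +
          T a 1 (finProdFinEquiv q : Fin (n * k)) : ℕ) : ℝ)) := by
      refine Finset.sum_le_sum fun q _ => avg_mono fun a => ?_
      -- After the flip, the side without q is the one that contained q before, and its learner sees
      -- that side with q deleted.
      have e : (!flip q a (finProdFinEquiv q)) = a (finProdFinEquiv q) := by
        change (!(Function.update a (finProdFinEquiv q) (!a (finProdFinEquiv q)))
          (finProdFinEquiv q)) = _
        simp
      have h₁ : I.sideState s (flip q a) (a (finProdFinEquiv q)).toNat =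
          X.final (Nat.size m) (Function.update
            (I.sideSamples s a (a (finProdFinEquiv q)).toNat)
              (finProdFinEquiv q : Fin (n * k)) none) := by
        rw [sideState, ← sideSamples_update_mask]
        rfl
      have h₂ : T a (a (finProdFinEquiv q)).toNat (finProdFinEquiv q : Fin (n * k)) =
          if X.Missed (I.sideState s (flip q a) (a (finProdFinEquiv q)).toNat) (s q)
          then X.κ (s q) else 0 := by
        simp only [T]
        rw [sideSamples_val, if_pos rfl, Option.elim_some, h₁]
      rw [e]
      have h₃ : T a (a (finProdFinEquiv q)).toNat (finProdFinEquiv q : Fin (n * k)) ≤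
          T a 0 (finProdFinEquiv q : Fin (n * k)) +
            T a 1 (finProdFinEquiv q : Fin (n * k)) := by
        cases a (finProdFinEquiv q) <;> simp
      rw [h₂] at h₃
      refine le_trans (le_of_eq ?_) (Nat.cast_le.2 h₃)
      split <;> simp
    _ = avg (fun a => ∑ q : Fin n × Fin k, ((T a 0 (finProdFinEquiv q : Fin (n * k)) +
          T a 1 (finProdFinEquiv q : Fin (n * k)) : ℕ) : ℝ)) := (avg_sum _ _).symm
    _ ≤ avg (fun _ : Fin (n * k) → Bool =>
        2 * (((4 * (5 * Nat.size m) + 2) * I.scaledCostOf F : ℕ) : ℝ)) := by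
      refine avg_mono fun a => ?_
      rw [← Nat.cast_sum, Finset.sum_add_distrib]
      have := add_le_add (hT a 0) (hT a 1)
      rw [← two_mul] at this
      exact_mod_cast this
    _ = _ := avg_const _

/-- The set `j` is chosen by the algorithm. -/
def chosen (s : Fin n × Fin k → Fin N) (a : Fin (n * k) → Bool)
    (y : Fin (2 * m) → Fin (5 * Nat.size m) → Bool) (j : ℕ) : Prop :=
  I.Chosen n k (mask a) (I.inputMemory s 4) (numbers y) j

theorem chosen_iff {s : Fin n × Fin k → Fin N} {a : Fin (n * k) → Bool}
    {y : Fin (2 * m) → Fin (5 * Nat.size m) → Bool} {j : ℕ} : I.chosen s a y j ↔ ∃ σ < 2,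
      (I.learner (n * k)).Picked (I.sideState s a σ) (2 ^ (5 * Nat.size m))
        (Nat.size (n * k)) (numbers y (σ * m + j)) j := Iff.rfl

theorem number_index {σ j : ℕ} (hσ : σ < 2) (hj : j < m) : σ * m + j < 2 * m := by
  have := Nat.mul_le_mul_right m (Nat.le_of_lt_succ hσ)
  omega

theorem avg_picked (s : Fin n × Fin k → Fin N) (a : Fin (n * k) → Bool) {σ j : ℕ} (hσ : σ < 2)
    (hj : j < m) : avg (fun y : Fin (2 * m) → Fin (5 * Nat.size m) → Bool =>
      if (I.learner (n * k)).Picked (I.sideState s a σ) (2 ^ (5 * Nat.size m))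
        (Nat.size (n * k)) (numbers y (σ * m + j)) j then (1 : ℝ) else 0) =
      (I.learner (n * k)).pickProb (I.sideState s a σ) (Nat.size m) (Nat.size (n * k)) j := by
  refine Eq.trans ?_ (avg_pi_eval (ι := Fin (2 * m)) ⟨σ * m + j, number_index hσ hj⟩
    fun x : Fin (5 * Nat.size m) → Bool => if (I.learner (n * k)).Picked (I.sideState s a σ)
      (2 ^ (5 * Nat.size m)) (Nat.size (n * k)) (digitsVal x) j then (1 : ℝ) else 0)
  congr 1
  funext y
  simp only [numbers, number_index hσ hj, dif_pos]

theorem sideState_inv (hm : 0 < m) (s : Fin n × Fin k → Fin N) (a : Fin (n * k) → Bool) (σ : ℕ) :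
    (I.learner (n * k)).Inv (I.sideSamples s a σ) (I.sideState s a σ) :=
  Learner.inv_final (I.learner_proper hm _) I.sideSamples_lt

/-- Expected cost of the chosen sets. -/
theorem avg_chosen_le (hm : 0 < m) (hM : 0 < n * k) {s : Fin n × Fin k → Fin N}
    {F : Finset (Fin m)} (hF : I.CoversAll s F) (a : Fin (n * k) → Bool) :
    avg (fun y : Fin (2 * m) → Fin (5 * Nat.size m) → Bool =>
      ∑ j : Fin m, if I.chosen s a y j then (I.scaledCost j : ℝ) else 0) ≤
    128 * Nat.size (n * k) * I.scaledCostOf F := by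
  set X := I.learner (n * k) with hXdef
  have h₁ : ∀ σ, ∑ j : Fin m, (I.scaledCost j : ℝ) *
      X.pickProb (I.sideState s a σ) (Nat.size m) (Nat.size (n * k)) j ≤
      64 * Nat.size (n * k) * I.scaledCostOf F := by
    intro σ
    have h := (I.sideState_inv hm s a σ).sum_pickProb_le (I.learner_proper hm _)
      (Nat.size_pos.2 hM) (hF.isCover a σ)
    rw [sum_map_val] at h
    refine le_trans (le_of_eq ?_) h
    exact (Finset.sum_range fun j => (I.scaledCost j : ℝ) *
      X.pickProb (I.sideState s a σ) (Nat.size m) (Nat.size (n * k)) j).symm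
  let P : ℕ → (Fin (2 * m) → Fin (5 * Nat.size m) → Bool) → ℕ → Prop := fun σ y j =>
    X.Picked (I.sideState s a σ) (2 ^ (5 * Nat.size m))
        (Nat.size (n * k)) (numbers y (σ * m + j)) j
  -- Union bound: a chosen set is picked on at least one of the two sides, each of which costs at
  -- most 64L times the cover.
  calc _ ≤ avg (fun y : Fin (2 * m) → Fin (5 * Nat.size m) → Bool =>
        ∑ σ ∈ Finset.range 2, ∑ j : Fin m,
          (I.scaledCost j : ℝ) * if P σ y j then (1 : ℝ) else 0) := by
        refine avg_mono fun y => ?_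
        rw [Finset.sum_comm]
        refine Finset.sum_le_sum fun j _ => ?_
        split
        case isTrue h =>
          obtain ⟨σ, hσ, hp⟩ := I.chosen_iff.1 h
          refine le_trans (le_of_eq ?_) (Finset.single_le_sum (fun _ _ => by positivity)
            (Finset.mem_range.2 hσ))
          rw [if_pos hp, mul_one]
        case isFalse => exact Finset.sum_nonneg fun _ _ => by positivity
    _ = ∑ σ ∈ Finset.range 2, ∑ j : Fin m, (I.scaledCost j : ℝ) *
      X.pickProb (I.sideState s a σ) (Nat.size m) (Nat.size (n * k)) j := by
        rw [avg_sum]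
        refine Finset.sum_congr rfl fun σ hσ => ?_
        rw [avg_sum]
        refine Finset.sum_congr rfl fun j _ => ?_
        rw [avg_const_mul, ← I.avg_picked s a (Finset.mem_range.1 hσ) j.2]
    _ ≤ ∑ σ ∈ Finset.range 2, 64 * (Nat.size (n * k) : ℝ) * I.scaledCostOf F :=
        Finset.sum_le_sum fun σ _ => h₁ σ
    _ = _ := by
        simp
        ring

/-- Probability that an element that is not missed is not covered. -/
theorem avg_uncovered_le (hm : 0 < m) (s : Fin n × Fin k → Fin N) (a : Fin (n * k) → Bool)
    {σ u : ℕ} (hσ : σ < 2)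
    (hu : ∑ j ∈ (I.learner (n * k)).sets u, (I.learner (n * k)).wt (I.sideState s a σ) j ≥
      m * (I.learner (n * k)).total (I.sideState s a σ)) :
    avg (fun y : Fin (2 * m) → Fin (5 * Nat.size m) → Bool =>
      if ∀ j ∈ (I.learner (n * k)).sets u, ¬ I.chosen s a y j then (1 : ℝ) else 0) ≤
    Real.exp (-(Nat.size (n * k) : ℝ)) := by
  set X := I.learner (n * k) with hXdef
  set st := I.sideState s a σ with hst
  set L := Nat.size (n * k)
  have hX : X.Proper N (Nat.size m) := I.learner_proper hm _
  let J : Finset (Fin m) := Finset.univ.filter fun j : Fin m => (j : ℕ) ∈ X.sets u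
  -- On side σ the set j uses the random number σm + j. Distinct sets use distinct numbers, so the
  -- picks of one side are independent once samples and mask are fixed.
  let i : Fin m → Fin (2 * m) := fun j => ⟨σ * m + j, number_index hσ j.2⟩
  have hi : Function.Injective i := fun j j' h => by
    have : σ * m + (j : ℕ) = σ * m + j' := congrArg Fin.val h
    exact Fin.ext (by omega)
  let f : Fin m → (Fin (5 * Nat.size m) → Bool) → ℝ := fun j x =>
    1 + (-1) * if X.Picked st (2 ^ (5 * Nat.size m)) L (digitsVal x) j then 1 else 0
  have hf : ∀ j, avg (f j) = 1 - X.pickProb st (Nat.size m) L j := by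
    intro j
    simp only [f]
    rw [avg_add, avg_const, avg_const_mul, Learner.pickProb]
    ring
  have hf0 : ∀ j x, 0 ≤ f j x := by
    intro j x
    simp only [f]
    split <;> norm_num
  have hsum : ∑ j ∈ J, (X.wt st j : ℝ) = ∑ j ∈ X.sets u, (X.wt st j : ℝ) := by
    have h₁ := Finset.sum_ite_mem (Finset.range m) (X.sets u) fun j => (X.wt st j : ℝ)
    have hsub : X.sets u ⊆ Finset.range m := hX.sets_sub u
    rw [Finset.inter_eq_right.2 hsub, Finset.sum_range] at h₁
    rw [← h₁, Finset.sum_filter]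
  have hG0 : (0 : ℝ) < X.m * X.total st := by exact_mod_cast hX.total_pos st
  calc _ ≤ avg (fun y : Fin (2 * m) → Fin (5 * Nat.size m) → Bool => ∏ j ∈ J, f j (y (i j))) := by
        refine avg_mono fun y => ?_
        split
        case isTrue h =>
          refine le_of_eq (Finset.prod_eq_one fun j hj => ?_).symm
          have h₁ : ¬ X.Picked st (2 ^ (5 * Nat.size m)) L (digitsVal (y (i j))) j := fun hp =>
            h j (Finset.mem_filter.1 hj).2 (I.chosen_iff.2 ⟨σ, hσ, by
              simpa only [numbers, number_index hσ j.2, dif_pos] using hp⟩)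
          simp only [f, if_neg h₁]
          norm_num
        case isFalse => exact Finset.prod_nonneg fun j _ => hf0 j _
    _ = ∏ j ∈ J, avg (f j) := avg_pi_prod hi J f
    _ ≤ ∏ j ∈ J, Real.exp (-(L * X.wt st j / (X.m * X.total st))) := by
        refine Finset.prod_le_prod (fun j _ => ?_) fun j _ => ?_
        · exact div_nonneg (Finset.sum_nonneg fun x _ => hf0 j x) (by positivity)
        · rw [hf]
          exact Learner.Inv.one_sub_pickProb_le hX L j
    _ = Real.exp (-(L * (∑ j ∈ X.sets u, (X.wt st j : ℝ)) / (X.m * X.total st))) := by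
        rw [← Real.exp_sum, ← hsum, Finset.sum_neg_distrib, Finset.mul_sum, Finset.sum_div]
    _ ≤ _ := by
        refine Real.exp_le_exp.2 (neg_le_neg ?_)
        rw [le_div_iff₀ hG0]
        refine mul_le_mul_of_nonneg_left ?_ (by positivity)
        exact_mod_cast hu

/-- Expected cost of covering an element that is not covered in advance. -/
theorem avg_loss_le (hm : 0 < m) (s : Fin n × Fin k → Fin N) (a : Fin (n * k) → Bool)
    {σ u : ℕ} (hσ : σ < 2) :
    avg (fun y : Fin (2 * m) → Fin (5 * Nat.size m) → Bool =>
      if ∀ j ∈ (I.learner (n * k)).sets u, ¬ I.chosen s a y j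
      then ((I.learner (n * k)).κ u : ℝ) else 0) ≤
    (if (I.learner (n * k)).Missed (I.sideState s a σ) u
      then ((I.learner (n * k)).κ u : ℝ) else 0) +
      (I.learner (n * k)).κ u * Real.exp (-(Nat.size (n * k) : ℝ)) := by
  set X := I.learner (n * k) with hXdef
  have hκ : (0 : ℝ) ≤ X.κ u := by positivity
  by_cases hmiss : X.Missed (I.sideState s a σ) u
  · rw [if_pos hmiss]
    have h₁ := avg_mono (f := fun y : Fin (2 * m) → Fin (5 * Nat.size m) → Bool =>
      if ∀ j ∈ X.sets u, ¬ I.chosen s a y j then (X.κ u : ℝ) else 0) (g := fun _ => (X.κ u : ℝ))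
      fun y => by split <;> simp
    rw [avg_const] at h₁
    have := Real.exp_pos (-(Nat.size (n * k) : ℝ))
    nlinarith [mul_nonneg hκ this.le]
  · rw [if_neg hmiss, zero_add]
    have h₁ : ∀ y : Fin (2 * m) → Fin (5 * Nat.size m) → Bool,
        (if ∀ j ∈ X.sets u, ¬ I.chosen s a y j then (X.κ u : ℝ) else 0) =
        X.κ u * if ∀ j ∈ X.sets u, ¬ I.chosen s a y j then (1 : ℝ) else 0 := fun y => by
      split <;> simp
    simp only [h₁]
    rw [avg_const_mul]
    rcases Nat.eq_zero_or_pos (X.κ u) with h0 | h0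
    · simp [h0]
    · refine mul_le_mul_of_nonneg_left (I.avg_uncovered_le hm s a hσ ?_) hκ
      by_contra! hlt
      exact hmiss ⟨h0.ne', hlt⟩

/-- Cost of the algorithm, in multiples of the common denominator. -/
noncomputable def algCost (s : Fin n × Fin k → Fin N) (v : Fin n → Fin N)
    (a : Fin (n * k) → Bool) (y : Fin (2 * m) → Fin (5 * Nat.size m) → Bool) : ℝ :=
  (∑ j : Fin m, if I.chosen s a y j then (I.scaledCost j : ℝ) else 0) +
    k * ∑ t, if ∀ j ∈ (I.learner (n * k)).sets (v t), ¬ I.chosen s a y j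
      then ((I.learner (n * k)).κ (v t) : ℝ) else 0

/-- M < 2^(size M) ≤ e^(size M). With M = nk this makes the failures of the rounding cost at most
one further cover. -/
theorem exp_neg_size_le {M : ℕ} : M * Real.exp (-(Nat.size M : ℝ)) ≤ 1 := by
  rw [Real.exp_neg, ← div_eq_mul_inv, div_le_one (Real.exp_pos _)]
  have h₁ : (M : ℝ) ≤ 2 ^ Nat.size M := by exact_mod_cast (Nat.lt_size_self M).le
  have h₂ : (2 : ℝ) ≤ Real.exp 1 := by
    have := Real.add_one_le_exp 1
    linarith
  calc (M : ℝ) ≤ 2 ^ Nat.size M := h₁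
    _ ≤ Real.exp 1 ^ Nat.size M := pow_le_pow_left₀ (by norm_num) h₂ _
    _ = _ := by rw [← Real.exp_nat_mul, mul_one]

/-- Expected cost of the algorithm, compared to covers `F s` of the samples. -/
theorem expected_algCost_le (hm : 0 < m) (hM : 0 < n * k) (D : Fin n → PMF (Fin N))
    (F : (Fin n × Fin k → Fin N) → Finset (Fin m))
    (hF : ∀ s, (∀ q : Fin n × Fin k, s q ∈ (D q.1).support) → I.CoversAll s (F s)) :
    indepExp (fun q : Fin n × Fin k => D q.1) (fun s => indepExp D (fun v =>
      avg (fun a => avg (fun y => I.algCost s v a y)))) ≤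
    (128 * Nat.size (n * k) + 40 * Nat.size m + 5) *
      indepExp (fun q : Fin n × Fin k => D q.1) (fun s => (I.scaledCostOf (F s) : ℝ)) := by
  set X := I.learner (n * k) with hXdef
  set ε := Real.exp (-(Nat.size (n * k) : ℝ)) with hε
  set L : ℝ := ((Nat.size (n * k) : ℕ) : ℝ) with hL
  -- Expected price of a new element u if it is missed by the learner on the side opposite to the
  -- sample q.
  let h : Fin n × Fin k → (Fin n × Fin k → Fin N) → Fin N → ℝ := fun q s u =>
    avg (fun a : Fin (n * k) → Bool =>
      if X.Missed (I.sideState s a (!a (finProdFinEquiv q)).toNat) u then (X.κ u : ℝ) else 0)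
  have h₁ : ∀ s v, I.CoversAll s (F s) → avg (fun a => avg (fun y => I.algCost s v a y)) ≤
      128 * L * I.scaledCostOf (F s) +
        ∑ q : Fin n × Fin k, (h q s (v q.1) + X.κ (v q.1) * ε) := by
    intro s v hcov
    have h₂ : ∀ a : Fin (n * k) → Bool, avg (fun y => I.algCost s v a y) ≤
        128 * L * I.scaledCostOf (F s) + ∑ q : Fin n × Fin k,
          ((if X.Missed (I.sideState s a (!a (finProdFinEquiv q)).toNat) (v q.1)
            then (X.κ (v q.1) : ℝ) else 0) + X.κ (v q.1) * ε) := by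
      intro a
      simp only [algCost]
      rw [avg_add, avg_const_mul]
      refine add_le_add (I.avg_chosen_le hm hM hcov a) ?_
      rw [avg_sum, Fintype.sum_prod_type, Finset.mul_sum]
      refine Finset.sum_le_sum fun t _ => ?_
      -- The loss at time t may be estimated with either side. Using for each i the side opposite to
      -- (t,i) turns k copies of this loss into a sum over the samples of the t-th distribution.
      have h₃ : ∀ i : Fin k, _ ≤ _ := fun i => I.avg_loss_le hm s a (u := v t)
        (σ := (!a (finProdFinEquiv (t, i))).toNat) (by cases a (finProdFinEquiv (t, i)) <;> simp)
      have h₄ := Finset.sum_le_sum fun i (_ : i ∈ Finset.univ) => h₃ i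
      rw [Finset.sum_const, Finset.card_univ, Fintype.card_fin, nsmul_eq_mul] at h₄
      exact h₄
    refine (avg_mono h₂).trans (le_of_eq ?_)
    rw [avg_add, avg_const, avg_sum]
    congr 1
    refine Finset.sum_congr rfl fun q _ => ?_
    rw [avg_add, avg_const]
  have hswap : ∀ (q : Fin n × Fin k) (g : (Fin n × Fin k → Fin N) → Fin N → ℝ),
      (∀ s u w, g (Function.update s q w) u = g s u) →
      indepExp (fun q : Fin n × Fin k => D q.1) (fun s => indepExp D fun v => g s (v q.1)) =
      indepExp (fun q : Fin n × Fin k => D q.1) (fun s => g s (s q)) := by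
    intro q g hg
    rw [← sum_mul_indepExp_swap q g hg]
    simp only [indepExp_eval, ← indepExp_const_mul]
    rw [indepExp_sum]
  have hh : ∀ q s u w, h q (Function.update s q w) u = h q s u := by
    intro q s u w
    have h₃ : ∀ a : Fin (n * k) → Bool,
        I.sideState (Function.update s q w) a (!a (finProdFinEquiv q)).toNat =
          I.sideState s a (!a (finProdFinEquiv q)).toNat := fun a => by
      rw [sideState, sideSamples_update_sample]
      rfl
    exact congrArg avg (funext fun a => by rw [h₃])
  calc _ ≤ indepExp (fun q : Fin n × Fin k => D q.1) (fun s => indepExp D (fun v =>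
        128 * L * I.scaledCostOf (F s) +
          ∑ q : Fin n × Fin k, (h q s (v q.1) + X.κ (v q.1) * ε))) :=
        indepExp_mono fun s hs => indepExp_mono fun v _ => h₁ s v (hF s hs)
    _ = indepExp (fun q : Fin n × Fin k => D q.1) (fun s =>
        128 * L * I.scaledCostOf (F s) +
          ∑ q : Fin n × Fin k, (h q s (s q) + X.κ (s q) * ε)) := by
        simp only [indepExp_add, indepExp_const, indepExp_sum]
        congr 1
        refine Finset.sum_congr rfl fun q _ => ?_
        -- The rounding term does not depend on the samples; here the exchange just renames v^t as a
        -- sample of the same law.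
        have h₉ := hswap q (fun _ u => X.κ u * ε) fun _ _ _ => rfl
        rw [indepExp_const] at h₉
        rw [hswap q (h q) (hh q), h₉]
    _ ≤ indepExp (fun q : Fin n × Fin k => D q.1) (fun s =>
        (128 * L + 40 * Nat.size m + 5) * I.scaledCostOf (F s)) := by
        refine indepExp_mono fun s hs => ?_
        have hcov := hF s hs
        have h₅ := I.avg_missed_le hm hcov
        -- There are nk samples, each of price at most the cost of the cover, and nk·ε ≤ 1.
        have h₆ : ∑ q : Fin n × Fin k, (X.κ (s q) : ℝ) * ε ≤ I.scaledCostOf (F s) := by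
          have h₇ : ∀ q ∈ (Finset.univ : Finset (Fin n × Fin k)),
              (X.κ (s q) : ℝ) * ε ≤ I.scaledCostOf (F s) * ε := fun q _ =>
            mul_le_mul_of_nonneg_right (by exact_mod_cast hcov.κ_le q) (Real.exp_pos _).le
          refine (Finset.sum_le_sum h₇).trans ?_
          rw [Finset.sum_const, Finset.card_univ, Fintype.card_prod, Fintype.card_fin,
            Fintype.card_fin, nsmul_eq_mul, mul_left_comm]
          exact mul_le_of_le_one_right (by positivity) exp_neg_size_le
        rw [Finset.sum_add_distrib]
        push_cast at h₅
        have h₈ : ∑ q, h q s (s q) ≤ 2 * ((4 * (5 * (Nat.size m : ℝ)) + 2) *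
          I.scaledCostOf (F s)) := h₅
        nlinarith
    _ = _ := indepExp_const_mul _ _

end Expectation

end SetSystem

/-! ### Competitiveness -/

theorem sum_biUnion_le {ι α : Type*} [DecidableEq α] (s : Finset ι) (t : ι → Finset α)
    (g : α → ℕ) : ∑ j ∈ s.biUnion t, g j ≤ ∑ i ∈ s, ∑ j ∈ t i, g j := by
  classical
  induction s using Finset.induction_on with
  | empty => simp
  | insert i s hi ih =>
    rw [Finset.biUnion_insert, Finset.sum_insert hi]
    have := Finset.sum_union_inter (s₁ := t i) (s₂ := s.biUnion t) (f := g)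
    omega

theorem size_le_log {a : ℕ} (ha : 0 < a) : (Nat.size a : ℝ) ≤ 1 + 2 * Real.log a := by
  obtain ⟨l, hl⟩ : ∃ l, Nat.size a = l + 1 :=
    Nat.exists_eq_add_one.2 (Nat.size_pos.2 ha)
  have h₁ : 2 ^ l ≤ a := Nat.lt_size.1 (by omega)
  have h₂ : (2 : ℝ) ^ l ≤ a := by exact_mod_cast h₁
  have h₃ := Real.log_le_log (by positivity) h₂
  rw [Real.log_pow] at h₃
  have h₄ := Real.log_two_gt_d9
  have h₅ : (l : ℝ) * (1 / 2) ≤ l * Real.log 2 :=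
    mul_le_mul_of_nonneg_left (by linarith) (by positivity)
  rw [hl]
  push_cast
  linarith

namespace SetSystem

variable {N m : ℕ} (I : SetSystem N m) {n k : ℕ}

theorem cast_scaledCostOf (F : Finset (Fin m)) :
    (I.scaledCostOf F : ℝ) = I.denom * I.costOf F := by
  rw [scaledCostOf, costOf, Finset.mul_sum, Nat.cast_sum]
  exact Finset.sum_congr rfl fun j _ => I.cast_scaledCost j

theorem scaledCostOf_mono {F G : Finset (Fin m)} (h : F ⊆ G) :
    I.scaledCostOf F ≤ I.scaledCostOf G := Finset.sum_le_sum_of_subset h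

theorem scaledCostOf_union_le (F G : Finset (Fin m)) :
    I.scaledCostOf (F ∪ G) ≤ I.scaledCostOf F + I.scaledCostOf G := by
  have := Finset.sum_union_inter (s₁ := F) (s₂ := G) (f := fun j : Fin m => I.scaledCost j)
  simp only [scaledCostOf]
  omega

theorem denom_mul_twoStageCost (lam : ℝ) (z₀ z₁ : Finset (Fin m)) :
    I.denom * I.twoStageCost lam z₀ z₁ = I.scaledCostOf z₀ + lam * I.scaledCostOf (z₁ \ z₀) := by
  rw [cast_scaledCostOf, cast_scaledCostOf, twoStageCost]
  ring

/-- The plan `A` arises from the samples `s`, their sides `a`, and the random numbers `y`. -/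
structure Follows (s : Fin n × Fin k → Fin N) (a : Fin (n * k) → Bool)
    (y : Fin (2 * m) → Fin (5 * Nat.size m) → Bool) (A : UniversalPlan N m) : Prop where
  valid : A.Valid I
  advance_iff : ∀ j, j ∈ A.advance ↔ I.chosen s a y j ∧ 2 ≤ k
  assign : ∀ u, I.chosen s a y (A.assign u) ∨
    I.scaledCost (A.assign u) = (I.learner (n * k)).κ u ∧
      ∀ j ∈ (I.learner (n * k)).sets u, ¬ I.chosen s a y j

-- For k ≥ 2 the chosen sets Z are bought in advance, an arrival not covered by Z costs at most λκ,
-- and λ ≤ k. For k = 1 nothing is bought in advance, and all sets used, whether in Z or cheapest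
-- sets, are paid at rate λ.
open scoped Classical in
theorem Follows.twoStageCost_le {I : SetSystem N m} {s : Fin n × Fin k → Fin N}
    {a : Fin (n * k) → Bool} {y : Fin (2 * m) → Fin (5 * Nat.size m) → Bool}
    {A : UniversalPlan N m} (h : I.Follows s a y A) (hk : 0 < k) {lam : ℝ} (hlam : 0 < lam)
    (hle : lam ≤ k) (v : Fin n → Fin N) :
    I.denom * I.twoStageCost lam A.advance (A.used v) ≤
      (if k = 1 then lam else 1) * I.algCost s v a y := by
  set Z : Finset (Fin m) := Finset.univ.filter fun j : Fin m => I.chosen s a y j with hZ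
  have hmem : ∀ j, j ∈ Z ↔ I.chosen s a y j := fun j => by simp [hZ]
  set S : ℕ := ∑ t, if ∀ j ∈ (I.learner (n * k)).sets (v t), ¬ I.chosen s a y j
      then (I.learner (n * k)).κ (v t) else 0 with hS
  have hcost : I.algCost s v a y = I.scaledCostOf Z + k * S := by
    rw [algCost, hS, scaledCostOf, hZ, Finset.sum_filter]
    push_cast
    rfl
  have hU : I.scaledCostOf (A.used v \ Z) ≤ S := by
    have h₁ : A.used v \ Z = Finset.univ.biUnion fun t => {A.assign (v t)} \ Z := by
      ext j
      simp only [UniversalPlan.used, Finset.mem_sdiff, Finset.mem_image, Finset.mem_univ,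
        true_and, Finset.mem_biUnion, Finset.mem_singleton]
      constructor
      · rintro ⟨⟨t, rfl⟩, hj⟩
        exact ⟨t, rfl, hj⟩
      · rintro ⟨t, rfl, hj⟩
        exact ⟨⟨t, rfl⟩, hj⟩
    rw [h₁]
    refine (sum_biUnion_le _ _ _).trans (Finset.sum_le_sum fun t _ => ?_)
    rcases h.assign (v t) with hc | ⟨hc, hn⟩
    · rw [Finset.sdiff_eq_empty_iff_subset.2
        (Finset.singleton_subset_iff.2 ((hmem _).2 hc)), Finset.sum_empty]
      exact Nat.zero_le _
    · rw [if_pos hn, ← hc]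
      exact (Finset.sum_le_sum_of_subset Finset.sdiff_subset).trans (by simp)
  have hUr : (I.scaledCostOf (A.used v \ Z) : ℝ) ≤ S := by exact_mod_cast hU
  rw [denom_mul_twoStageCost, hcost]
  rcases Nat.lt_or_ge k 2 with hk2 | hk2
  · have hk1 : k = 1 := by omega
    have hadv : A.advance = ∅ :=
      Finset.eq_empty_of_forall_notMem fun j hj => absurd ((h.advance_iff j).1 hj).2 (by omega)
    have h₁ : I.scaledCostOf (A.used v) ≤ I.scaledCostOf Z + I.scaledCostOf (A.used v \ Z) := by
      refine (I.scaledCostOf_mono ?_).trans (I.scaledCostOf_union_le _ _)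
      rw [Finset.union_sdiff_self_eq_union]
      exact Finset.subset_union_right
    have h₂ : (I.scaledCostOf (A.used v) : ℝ) ≤ I.scaledCostOf Z + S := by
      exact_mod_cast h₁.trans (Nat.add_le_add_left hU _)
    rw [if_pos hk1, hadv, Finset.sdiff_empty, hk1, Nat.cast_one, one_mul]
    have h₃ : I.scaledCostOf (∅ : Finset (Fin m)) = 0 := Finset.sum_empty
    rw [h₃, Nat.cast_zero, zero_add]
    exact mul_le_mul_of_nonneg_left h₂ hlam.le
  · have hadv : A.advance = Z := Finset.ext fun j => by
      rw [h.advance_iff, hmem, and_iff_left hk2]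
    rw [if_neg (by omega), hadv, one_mul]
    have := mul_le_mul hle hUr (Nat.cast_nonneg _) (Nat.cast_nonneg _)
    linarith

/-- The random numbers that the program reads from its coins. -/
def coinNumbers (n k m : ℕ) {T : ℕ} (r : Fin T → Bool) (e : Fin (2 * m))
    (l : Fin (5 * Nat.size m)) : Bool :=
  padCoins r (n * k + e * (5 * Nat.size m) + l)

/-- The link between program and analysis: the plan is read off the final memory, and the coins
enter only through the sides and the random numbers. -/
theorem exists_follows (hN : 0 < N) (hm : 0 < m) (s : Fin n × Fin k → Fin N) {T : ℕ}
    (r : Fin T → Bool) : ∃ A : UniversalPlan N m,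
      I.Follows s (fun q => padCoins r q) (coinNumbers n k m r) A ∧
      ∃ (t : ℕ) (s' : State), Exec Program.main (I.initState s r) t s' ∧
        t ≤ Program.main.time (word (I.inputSize n k)) (iters (I.inputSize n k)) ∧
        A.WrittenIn s'.mem := by
  obtain ⟨t, s', hexec, ht, -, h₅, h₆⟩ :=
    I.spec_main (n := n) (k := k) hN hm s (padCoins r) (I.inputMemory_bdd s)
  have hc : ∀ j < m, I.Chosen n k (fun q => (padCoins r q).toNat) (I.inputMemory s 4)
      (fun e => binVal (fun l => padCoins r (n * k + e * (5 * Nat.size m) + l))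
        (5 * Nat.size m)) j ↔
      I.chosen s (fun q => padCoins r q) (coinNumbers n k m r) j := fun j hj => by
    refine Chosen.congr I (fun q hq => ?_) (fun e he => ?_) hj
    · exact (mask_val (fun q : Fin (n * k) => padCoins r q) ⟨q, hq⟩).symm
    · rw [numbers, dif_pos he, digitsVal]
      refine binVal_congr fun l hl => ?_
      simp [coinNumbers, padCoins, hl]
  have hlt : ∀ u : Fin N, s'.mem 6 u ∈ (I.learner (n * k)).sets u := fun u => by
    rcases h₆ u u.2 with ⟨j, _, h, h', _⟩ | ⟨h, _⟩
    · rwa [h]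
    · exact h
  have hltm : ∀ u : Fin N, s'.mem 6 u < m := fun u => by
    obtain ⟨_, h, _⟩ := I.mem_learner_sets.1 (hlt u)
    exact h
  refine ⟨⟨Finset.univ.filter fun j : Fin m => s'.mem 5 j ≠ 0,
    fun u => ⟨s'.mem 6 u, hltm u⟩⟩, ⟨fun u => ?_, fun j => ?_, fun u => ?_⟩, t, s', hexec, ht,
    fun j => ?_, fun u => rfl⟩
  · obtain ⟨_, _, h⟩ := I.mem_learner_sets.1 (hlt u)
    exact h
  · rw [Finset.mem_filter, h₅ j j.2, hc j j.2]
    simp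
  · rcases h₆ u u.2 with ⟨j, hj, h, _, h'⟩ | ⟨_, h, h'⟩
    · left
      change I.chosen _ _ _ (s'.mem 6 u)
      rw [h]
      exact (hc j hj).1 h'
    · refine Or.inr ⟨h, fun j hj hj' => h' j hj ?_⟩
      obtain ⟨_, hjm, _⟩ := I.mem_learner_sets.1 hj
      exact (hc j hjm).2 hj'
  · simp

theorem coinExp_algCost {T : ℕ} (hT : n * k + 2 * m * (5 * Nat.size m) ≤ T)
    (s : Fin n × Fin k → Fin N) (v : Fin n → Fin N) :
    coinExp (fun r : Fin T → Bool =>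
      I.algCost s v (fun q => padCoins r q) (coinNumbers n k m r)) =
    avg (fun a => avg (fun y => I.algCost s v a y)) :=
  coinExp_blocks hT (I.algCost s v)

/-- The sets that an online policy buys for all the samples. -/
def policyCover (Q : OnlinePolicy N m n) (s : Fin n × Fin k → Fin N) : Finset (Fin m) :=
  Q.advance ∪ Finset.univ.biUnion fun i : Fin k => Q.bought fun t => s (t, i)

theorem coversAll_policyCover {I : SetSystem N m} {D : Fin n → PMF (Fin N)}
    {Q : OnlinePolicy N m n} (hQ : Q.Feasible I D) {s : Fin n × Fin k → Fin N}
    (hs : ∀ q : Fin n × Fin k, s q ∈ (D q.1).support) : I.CoversAll s (policyCover Q s) := by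
  rintro ⟨t, i⟩
  obtain ⟨j, hj, h | ⟨t', _, h⟩⟩ := hQ (fun t => s (t, i)) (fun t => hs (t, i)) t
  · exact ⟨j, Finset.mem_union_left _ h, hj⟩
  · exact ⟨j, Finset.mem_union_right _ (Finset.mem_biUnion.2 ⟨i, Finset.mem_univ _,
      Finset.mem_biUnion.2 ⟨t', Finset.mem_univ _, h⟩⟩), hj⟩

/-- The advance purchase is shared by all k simulated runs; only the second-stage sets are counted
once per run. -/
theorem scaledCostOf_policyCover_le (Q : OnlinePolicy N m n) (s : Fin n × Fin k → Fin N) :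
    I.scaledCostOf (policyCover Q s) ≤ I.scaledCostOf Q.advance +
      ∑ i : Fin k, I.scaledCostOf (Q.bought (fun t => s (t, i)) \ Q.advance) := by
  have h : policyCover Q s = Q.advance ∪
      Finset.univ.biUnion fun i : Fin k => Q.bought (fun t => s (t, i)) \ Q.advance := by
    ext j
    simp only [policyCover, Finset.mem_union, Finset.mem_biUnion, Finset.mem_univ, true_and,
      Finset.mem_sdiff]
    by_cases hj : j ∈ Q.advance <;> simp [hj]
  rw [h]
  exact (I.scaledCostOf_union_le _ _).trans (Nat.add_le_add_left (sum_biUnion_le _ _ _) _)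

/-- For fixed i the samples (t,i) are distributed like the arriving sequence, so every simulated run
has the policy's own expected second-stage cost. -/
theorem expected_policyCover_le (D : Fin n → PMF (Fin N)) (Q : OnlinePolicy N m n) :
    indepExp (fun q : Fin n × Fin k => D q.1) (fun s => (I.scaledCostOf (policyCover Q s) : ℝ)) ≤
      I.scaledCostOf Q.advance +
        k * indepExp D (fun v => (I.scaledCostOf (Q.bought v \ Q.advance) : ℝ)) := by
  have h : ∀ i : Fin k, indepExp (fun q : Fin n × Fin k => D q.1)
      (fun s => (I.scaledCostOf (Q.bought (fun t => s (t, i)) \ Q.advance) : ℝ)) =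
      indepExp D (fun v => (I.scaledCostOf (Q.bought v \ Q.advance) : ℝ)) := fun i =>
    indepExp_comp (D := fun q : Fin n × Fin k => D q.1) (e := fun t : Fin n => (t, i))
      (fun _ _ h => (Prod.mk.inj h).1)
      fun v => (I.scaledCostOf (Q.bought v \ Q.advance) : ℝ)
  calc _ ≤ indepExp (fun q : Fin n × Fin k => D q.1) (fun s =>
        (I.scaledCostOf Q.advance : ℝ) +
          ∑ i : Fin k, (I.scaledCostOf (Q.bought (fun t => s (t, i)) \ Q.advance) : ℝ)) :=
        indepExp_mono fun s _ => by exact_mod_cast I.scaledCostOf_policyCover_le Q s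
    _ = _ := by
        rw [indepExp_add, indepExp_const, indepExp_sum]
        simp only [h, Finset.sum_const, Finset.card_univ, Fintype.card_fin, nsmul_eq_mul]

/-- `size_le_log` turns the left side into at most 173 + 256 log(nk) + 80 log m. -/
theorem size_factor_le (hm : 0 < m) (hn : 0 < n) (hk : 0 < k) :
    (128 * Nat.size (n * k) + 40 * Nat.size m + 5 : ℝ) ≤ 256 * (1 + Real.log (m * n * k)) := by
  have h₁ := size_le_log (Nat.mul_pos hn hk)
  have h₂ := size_le_log hm
  have hm' : (m : ℝ) ≠ 0 := by exact_mod_cast hm.ne'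
  have hnk : ((n * k : ℕ) : ℝ) ≠ 0 := by exact_mod_cast (Nat.mul_pos hn hk).ne'
  have h₃ : Real.log (m * n * k) = Real.log m + Real.log (n * k : ℕ) := by
    rw [← Real.log_mul hm' hnk]
    push_cast
    rw [mul_assoc]
  have h₄ : 0 ≤ Real.log m := Real.log_natCast_nonneg _
  rw [h₃]
  linarith

/-- Expected cost of the algorithm, compared to an online policy. -/
theorem competitive (hm : 0 < m) (hn : 0 < n) (hk : 0 < k) {T : ℕ}
    (hT : n * k + 2 * m * (5 * Nat.size m) ≤ T)
    {plan : (Fin n × Fin k → Fin N) → (Fin T → Bool) → UniversalPlan N m}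
    (hplan : ∀ s r, I.Follows s (fun q => padCoins r q) (coinNumbers n k m r) (plan s r))
    (D : Fin n → PMF (Fin N)) {lam : ℝ} (hlam : 0 < lam) (hceil : ⌈lam⌉₊ = k)
    (Q : OnlinePolicy N m n) (hQ : Q.Feasible I D) :
    indepExp (fun q : Fin n × Fin k => D q.1) (fun s => indepExp D (fun v => coinExp (fun r =>
      I.twoStageCost lam (plan s r).advance ((plan s r).used v)))) ≤
    512 * (1 + Real.log (m * n * k)) *
      indepExp D (fun v => I.twoStageCost lam Q.advance (Q.bought v)) := by
  have hle : lam ≤ k := hceil ▸ Nat.le_ceil lam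
  have hd : (0 : ℝ) < I.denom := by exact_mod_cast I.denom_pos
  -- Rate at which the chosen sets are paid for.
  set ρ : ℝ := if k = 1 then lam else 1 with hρ
  have hρ0 : 0 ≤ ρ := by
    rw [hρ]
    split
    · exact hlam.le
    · exact zero_le_one
  set c₀ : ℝ := ((I.scaledCostOf Q.advance : ℕ) : ℝ) with hc₀
  set c₁ : ℝ := indepExp D (fun v => (I.scaledCostOf (Q.bought v \ Q.advance) : ℝ)) with hc₁
  have hc₀0 : 0 ≤ c₀ := Nat.cast_nonneg _
  have hc₁0 : 0 ≤ c₁ := by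
    have := indepExp_mono (D := D) (f := fun _ => 0)
      (g := fun v => (I.scaledCostOf (Q.bought v \ Q.advance) : ℝ)) fun _ _ => Nat.cast_nonneg _
    rwa [indepExp_const] at this
  have hopt : I.denom * indepExp D (fun v => I.twoStageCost lam Q.advance (Q.bought v)) =
      c₀ + lam * c₁ := by
    rw [← indepExp_const_mul]
    simp only [denom_mul_twoStageCost]
    rw [indepExp_add, indepExp_const, indepExp_const_mul]
  have halg : I.denom * indepExp (fun q : Fin n × Fin k => D q.1) (fun s => indepExp D (fun v =>
      coinExp (fun r => I.twoStageCost lam (plan s r).advance ((plan s r).used v)))) ≤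
      ρ * ((128 * Nat.size (n * k) + 40 * Nat.size m + 5) * (c₀ + k * c₁)) := by
    have h₁ := I.expected_algCost_le hm (Nat.mul_pos hn hk) D (policyCover Q)
      fun s hs => coversAll_policyCover hQ hs
    have h₂ := I.expected_policyCover_le (k := k) D Q
    refine le_trans ?_ (mul_le_mul_of_nonneg_left
      (h₁.trans (mul_le_mul_of_nonneg_left h₂ (by positivity))) hρ0)
    rw [← indepExp_const_mul, ← indepExp_const_mul]
    refine indepExp_mono fun s _ => ?_
    rw [← indepExp_const_mul, ← indepExp_const_mul]
    refine indepExp_mono fun v _ => ?_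
    rw [← I.coinExp_algCost hT, coinExp_eq_avg, coinExp_eq_avg, ← avg_const_mul, ← avg_const_mul]
    exact avg_mono fun r => (hplan s r).twoStageCost_le hk hlam hle v
  -- If k = 1, then λ ≤ 1 and λ(c₀ + c₁) ≤ c₀ + λc₁. If k ≥ 2, then λ > 1 and k < λ + 1 < 2λ.
  have hratio : ρ * (c₀ + k * c₁) ≤ 2 * (c₀ + lam * c₁) := by
    rw [hρ]
    split
    case isTrue h =>
      rw [h, Nat.cast_one] at hle
      rw [h, Nat.cast_one]
      nlinarith [mul_nonneg hlam.le hc₁0, mul_nonneg (sub_nonneg.2 hle) hc₀0]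
    case isFalse h =>
      have hk2 : 2 ≤ k := by omega
      have h₁ : 1 < lam := by
        have : 1 < ⌈lam⌉₊ := by omega
        simpa using Nat.lt_ceil.1 this
      have h₂ : (k : ℝ) < lam + 1 := hceil ▸ Nat.ceil_lt_add_one hlam.le
      nlinarith [mul_nonneg (by linarith : 0 ≤ 2 * lam - k) hc₁0]
  have hsize := size_factor_le hm hn hk
  refine le_of_mul_le_mul_left ?_ hd
  have hlog : 0 ≤ 256 * (1 + Real.log (m * n * k)) := le_trans (by positivity) hsize
  calc _ ≤ (128 * Nat.size (n * k) + 40 * Nat.size m + 5) * (ρ * (c₀ + k * c₁)) :=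
        halg.trans (le_of_eq (by ring))
    _ ≤ 256 * (1 + Real.log (m * n * k)) * (2 * (c₀ + lam * c₁)) :=
        mul_le_mul hsize hratio (by positivity) hlog
    _ = _ := by
        rw [← hopt]
        ring

end SetSystem

/-- The running time and the number of coins of the program are polynomial. -/
theorem exists_main_polynomial : ∃ p : Polynomial ℕ, ∀ z,
    Program.main.time (SetSystem.word z) (SetSystem.iters z) ≤ p.eval z ∧
      z + 10 * z ^ 2 ≤ p.eval z := by
  open Polynomial in
  obtain ⟨p, hp⟩ := Program.main.exists_time_polynomial (8 * X + 10)
    (((2 * X + 2) * (X * (3 * X) + 1) + X * (3 * X)) * (X + 1) + X + (5 * X + 2))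
  refine ⟨p + (Polynomial.X + 10 * Polynomial.X ^ 2), fun z => ?_⟩
  have h : Program.main.time (SetSystem.word z) (SetSystem.iters z) = p.eval z := by
    rw [← hp z]
    simp [SetSystem.word, SetSystem.iters]
  rw [h]
  simp

theorem mainTheorem3 :
    ∃ (P : Program) (p : Polynomial ℕ) (C : ℝ),
      ∀ (N m : ℕ) (I : SetSystem N m) (n k : ℕ), 0 < n → 0 < k →
        ∃ plan : (Fin n × Fin k → Fin N) → (Fin (p.eval (I.inputSize n k)) → Bool) →
            UniversalPlan N m,
          (∀ s r, (plan s r).Valid I ∧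
            ∃ (T : ℕ) (s' : State), Exec P (I.initState s r) T s' ∧
              T ≤ p.eval (I.inputSize n k) ∧ (plan s r).WrittenIn s'.mem) ∧
          ∀ (D : Fin n → PMF (Fin N)) (lam : ℝ), 0 < lam → ⌈lam⌉₊ = k →
            ∀ Q : OnlinePolicy N m n, Q.Feasible I D →
              indepExp (fun q : Fin n × Fin k => D q.1) (fun s =>
                indepExp D (fun v => coinExp (fun r =>
                  I.twoStageCost lam (plan s r).advance ((plan s r).used v)))) ≤
              C * (1 + Real.log (m * n * k)) *
                indepExp D (fun v => I.twoStageCost lam Q.advance (Q.bought v)) := by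
  obtain ⟨p, hp⟩ := exists_main_polynomial
  refine ⟨Program.main, p, 512, fun N m I n k hn hk => ?_⟩
  set z := I.inputSize n k with hz
  -- An element forces a set that covers it. As n and k are positive, any sample or distribution
  -- supplies an element, so empty systems satisfy everything vacuously.
  have hpos : ∀ u : Fin N, 0 < N ∧ 0 < m := fun u =>
    ⟨(Nat.zero_le _).trans_lt u.2, (Nat.zero_le _).trans_lt (I.covers u).choose.2⟩
  have hex : ∀ (s : Fin n × Fin k → Fin N) (r : Fin (p.eval z) → Bool),
      ∃ A : UniversalPlan N m,
        I.Follows s (fun q => padCoins r q) (SetSystem.coinNumbers n k m r) A ∧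
        ∃ (t : ℕ) (s' : State), Exec Program.main (I.initState s r) t s' ∧
          t ≤ p.eval z ∧ A.WrittenIn s'.mem := fun s r => by
    obtain ⟨hN, hm⟩ := hpos (s (⟨0, hn⟩, ⟨0, hk⟩))
    obtain ⟨A, hA, t, s', he, ht, hw⟩ := I.exists_follows hN hm s r
    exact ⟨A, hA, t, s', he, ht.trans (hp z).1, hw⟩
  choose plan hplan hrun using hex
  refine ⟨plan, fun s r => ⟨(hplan s r).valid, hrun s r⟩, fun D lam hlam hceil Q hQ => ?_⟩
  obtain ⟨u, -⟩ := (D ⟨0, hn⟩).support_nonempty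
  obtain ⟨hN, hm⟩ := hpos u
  refine I.competitive hm hn hk ?_ hplan D hlam hceil Q hQ
  refine le_trans ?_ (hp z).2
  have h₁ := I.samples_le_inputSize n k hN
  have h₂ := I.m_le_inputSize n k
  -- Besides nk coins for the sides, 2m random numbers of 5·size(m) bits are tossed, which accounts
  -- for the term 10z² in the polynomial.
  have h₃ : 2 * m * (5 * Nat.size m) ≤ 2 * z * (5 * z) :=
    Nat.mul_le_mul (Nat.mul_le_mul_left _ h₂)
      (Nat.mul_le_mul_left _ ((SetSystem.size_le_self m).trans h₂))
  calc _ ≤ z + 2 * z * (5 * z) := Nat.add_le_add h₁ h₃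
    _ = _ := by ring
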